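/- Let $X$ be an irreducible algebraic variety over $\mathbb{C}$ (an integral, separated scheme of finite type over $\mathbb{C}$; its points are the closed points), and let $\mathcal{E}=(E_1,\ldots,E_k)$ be a collection of finite-dimensional base-point free linear series $E_i\subset H^0(X,\mathcal{L}_i)$, with $\mathcal{L}_i$ line bundles on $X$. For a system $\mathbf{s}=(s_1,\ldots,s_k)\in\mathbf{E}=E_1\times\cdots\times E_k$ let $Z_{\mathbf{s}}\subset X$ be the set of its common zeros, and let the consistency variety $R_{\mathcal{E}}\subset\mathbf{E}$ be the Zariski closure of the set of all $\mathbf{s}$ with $Z_{\mathbf{s}}\neq\varnothing$. Call $\mathcal{E}$ overdetermined if $Z_{\mathbf{s}}=\varnothing$ for all $\mathbf{s}$ in some non-empty Zariski open subset of $\mathbf{E}$, and generically consistent if $Z_{\mathbf{s}}\ne\varnothing$ for all $\mathbf{s}$ in some non-empty Zariski open subset of $\mathbf{E}$ (the latter also for collections on possibly reducible varieties). For $J\subset\{1,\ldots,k\}$ let $E_J\subset H^0\big(X,\bigotimes_{j\in J}\mathcal{L}_j\big)$ be the span of all products $\bigotimes_{j\in J}f_j$ with $f_j\in E_j$, let $\Phi_J:X\to\mathbb{P}(E_J^*)$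 be its Kodaira map, sending $x$ to the hyperplane of sections in $E_J$ that vanish at $x$, let $\tau_J$ be the dimension of the image of $\Phi_J$, and let $\operatorname{def}(E_J)=\tau_J-|J|$. A subcollection $J$ is essential if $\operatorname{def}(E_J)=\min_{I\subset\{1,\ldots,k\}}\operatorname{def}(E_I)$ and $\operatorname{def}(E_I)>\operatorname{def}(E_J)$ for every proper subset $I\subsetneq J$. For a fibre $F$ of $\Phi_J$ (with its reduced structure) let $E_i|_F$ denote the image of $E_i$ in $H^0(F,\mathcal{L}_i|_F)$. Suppose that $\mathcal{E}$ is overdetermined and that $J$ is its essential subcollection. Then for a generic consistent system, the zero set is the (non-empty) zero set of a generic system of the generically consistent collection $(E_i|_F)_{i\notin J}$ on one fibre $F$ of $\Phi_J$. Precisely: there is a non-empty, relatively Zariski open subset $W\subset R_{\mathcal{E}}$ such that for every $\mathbf{s}\in W$ the set $Z_{\mathbf{s}}$ is non-empty and there is a non-empty fibre $F$ of $\Phi_J$ with the following properties. 1. $Z_{\mathbf{s}}=\{x\in F : s_i|_F(x)=0 \text{ for all } i\notin J\}$. 2. The collection $(E_i|_F)_{i\notin J}$ on $F$ is generically consistent.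 3. The systems $\mathbf{u}=(u_i)_{i\notin J}\in\prod_{i\notin J}E_i|_F$ that arise as $u_i=t_i|_F$ from some $\mathbf{t}\in W$ with $t_j=s_j$ for all $j\in J$ and $Z_{\mathbf{t}}=\{x\in F: u_i(x)=0\text{ for all }i\notin J\}$ form a Zariski open subset of $\prod_{i\notin J}E_i|_F$ (which is non-empty, as by 1 it contains $(s_i|_F)_{i\notin J}$). -/

import Mathlib

open AlgebraicGeometry CategoryTheory TopologicalSpace Opposite
open scoped LinearAlgebra.Projectivization

noncomputable section

namespace LinSeries

/-! ### Zariski topologies on complex vector spaces and their projectivizations -/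

section Zariski

variable (V : Type) [AddCommGroup V] [Module ℂ V]

/-- The polynomial functions on a complex vector space: the algebra of functions generated by the
linear functionals. -/
def polyFun : Subalgebra ℂ (V → ℂ) :=
  Algebra.adjoin ℂ (Set.range fun (φ : Module.Dual ℂ V) (v : V) => φ v)

/-- The Zariski topology on a complex vector space, generated by the sets where a polynomial
function does not vanish (these are stable under finite intersections). -/
abbrev zariski : TopologicalSpace V :=
  TopologicalSpace.generateFrom {U | ∃ f ∈ polyFun V, U = {v | f v ≠ 0}}

/-- The Zariski topology on the projective space `ℙ(V)`, generated by the sets where a homogeneous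
polynomial function does not vanish. -/
abbrev projZariski : TopologicalSpace (ℙ ℂ V) :=
  TopologicalSpace.generateFrom {U | ∃ f ∈ polyFun V,
    (∃ d : ℕ, ∀ (c : ℂ) (v : V), f (c • v) = c ^ d * f v) ∧ U = {p | f p.rep ≠ 0}}

variable {V}

/-- The (Krull) dimension of a subset of a projective space, in its Zariski topology. -/
def projDim (Y : Set (ℙ ℂ V)) : WithBot ℕ∞ :=
  @topologicalKrullDim Y ((projZariski V).induced Subtype.val)

end Zariski

/-! ### Regular functions, line bundles and their sections -/

section Bundles

variable {X : Scheme.{0}}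

/-- Restriction of regular functions. -/
def res {U V : X.Opens} (h : V ≤ U) : Γ(X, U) →+* Γ(X, V) :=
  (X.presheaf.map (homOfLE h).op).hom

lemma res_res {U V W : X.Opens} (h : V ≤ U) (h' : W ≤ V) (f : Γ(X, U)) :
    res h' (res h f) = res (h'.trans h) f := by
  simp only [res, ← RingHom.comp_apply, ← CommRingCat.hom_comp, ← Functor.map_comp]
  rfl

/-- For a scheme over `Spec ℂ`, the complex constants among the regular functions on `U`. -/
def constHom (X : Scheme.{0}) [X.Over (Spec (.of ℂ))] (U : X.Opens) : ℂ →+* Γ(X, U) :=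
  (res le_top).comp
    (((Scheme.ΓSpecIso (.of ℂ)).inv ≫ (X ↘ Spec (.of ℂ)).appTop).hom)

instance algebraSections [X.Over (Spec (.of ℂ))] (U : X.Opens) : Algebra ℂ Γ(X, U) :=
  (constHom X U).toAlgebra

lemma res_smul [X.Over (Spec (.of ℂ))] {U V : X.Opens} (h : V ≤ U) (c : ℂ) (f : Γ(X, U)) :
    res h (c • f) = c • res h f := by
  rw [Algebra.smul_def, Algebra.smul_def, map_mul]
  congr 1
  exact res_res _ _ _

variable (X) in
/-- A line bundle on a scheme, given by transition functions on an open cover. -/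
structure LineBundle where
  /-- index set of the trivializing cover -/
  ι : Type
  /-- the trivializing open sets -/
  U : ι → X.Opens
  cover : ∀ x : X, ∃ a, x ∈ U a
  /-- the transition functions; a section is a family of functions with `f a = g a b * f b` -/
  g : ∀ a b, Γ(X, U a ⊓ U b)
  g_self : ∀ a, g a a = 1
  cocycle : ∀ a b c,
    res (V := U a ⊓ U b ⊓ U c) inf_le_left (g a b) *
      res (V := U a ⊓ U b ⊓ U c) (inf_le_inf_right _ inf_le_right) (g b c) =
      res (V := U a ⊓ U b ⊓ U c) (inf_le_inf_right _ inf_le_left) (g a c)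

lemma exists_mem_iInf {κ : Type} [Fintype κ] (L : κ → LineBundle X) (x : X) :
    ∃ a : ∀ j, (L j).ι, x ∈ ⨅ j, (L j).U (a j) := by
  choose a ha using fun j => (L j).cover x
  refine ⟨a, ?_⟩
  rw [← SetLike.mem_coe, Opens.coe_iInf]
  exact Set.mem_iInter.2 ha

/-- The tensor product of a finite family of line bundles (the trivial bundle for the empty
family): transition functions are multiplied over the common refinement of the covers. -/
def LineBundle.tensor {κ : Type} [Fintype κ] (L : κ → LineBundle X) : LineBundle X where
  ι := ∀ j, (L j).ι
  U a := ⨅ j, (L j).U (a j)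
  cover := exists_mem_iInf L
  g a b := ∏ j, res (inf_le_inf (iInf_le _ j) (iInf_le _ j)) ((L j).g (a j) (b j))
  g_self a := Finset.prod_eq_one fun j _ => by rw [(L j).g_self, map_one]
  cocycle a b c := by
    simp only [map_prod, ← Finset.prod_mul_distrib]
    refine Finset.prod_congr rfl fun j _ => ?_
    have h : (⨅ j, (L j).U (a j)) ⊓ (⨅ j, (L j).U (b j)) ⊓ (⨅ j, (L j).U (c j)) ≤
        (L j).U (a j) ⊓ (L j).U (b j) ⊓ (L j).U (c j) :=
      inf_le_inf (inf_le_inf (iInf_le _ j) (iInf_le _ j)) (iInf_le _ j)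
    have := congrArg (res h) ((L j).cocycle (a j) (b j) (c j))
    simpa only [map_mul, res_res] using this

variable [X.Over (Spec (.of ℂ))]

/-- The families of regular functions, in the trivializations of `L`, that are compatible with the
transition functions. -/
def LineBundle.secSubmodule (L : LineBundle X) : Submodule ℂ (∀ a, Γ(X, L.U a)) where
  carrier := {f | ∀ a b, res (V := L.U a ⊓ L.U b) inf_le_left (f a) =
    L.g a b * res (V := L.U a ⊓ L.U b) inf_le_right (f b)}
  zero_mem' a b := by simp
  add_mem' {f f'} hf hf' a b := by
    simp only [Pi.add_apply, map_add, hf a b, hf' a b, mul_add]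
  smul_mem' c f hf a b := by
    simp only [Pi.smul_apply, res_smul, hf a b, mul_smul_comm]

/-- The complex vector space `H⁰(X, L)` of global regular sections of a line bundle `L`. -/
def LineBundle.Sec (L : LineBundle X) : Type := L.secSubmodule

instance (L : LineBundle X) : AddCommGroup L.Sec := inferInstanceAs (AddCommGroup L.secSubmodule)

instance (L : LineBundle X) : Module ℂ L.Sec := inferInstanceAs (Module ℂ L.secSubmodule)

/-- The regular function representing a section in the trivialization with index `a`. -/
def LineBundle.Sec.coord {L : LineBundle X} (a : L.ι) : L.Sec →ₗ[ℂ] Γ(X, L.U a) :=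
  (LinearMap.proj a).comp L.secSubmodule.subtype

/-- The tensor product of a finite family of sections (the section `1` for the empty family). -/
def tensorSection {κ : Type} [Fintype κ] {L : κ → LineBundle X} (s : ∀ j, (L j).Sec) :
    (LineBundle.tensor L).Sec :=
  ⟨fun a : ∀ j, (L j).ι => ∏ j, res (iInf_le (fun j => (L j).U (a j)) j) ((s j).coord (a j)),
    fun (a b : ∀ j, (L j).ι) => by
    change res _ (∏ j, res _ _) = (∏ j, res _ _) * res _ (∏ j, res _ _)
    rw [map_prod, map_prod, ← Finset.prod_mul_distrib]
    refine Finset.prod_congr rfl fun j _ => ?_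
    have h : (⨅ j, (L j).U (a j)) ⊓ (⨅ j, (L j).U (b j)) ≤ (L j).U (a j) ⊓ (L j).U (b j) :=
      inf_le_inf (iInf_le _ j) (iInf_le _ j)
    have := congrArg (res h) ((s j).2 (a j) (b j))
    rw [map_mul, res_res, res_res] at this
    exact (res_res _ _ _).trans (this.trans (congrArg (_ * ·) (res_res _ _ _).symm))⟩

end Bundles

/-! ### Linear series and their Kodaira maps -/

section Series

/-- The points of a complex variety: the closed points of the scheme. -/
abbrev Pt (X : Scheme.{0}) : Type := {x : X // IsClosed ({x} : Set X)}

variable {X : Scheme.{0}} [X.Over (Spec (.of ℂ))]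

lemma evaluation_const_smul (U : X.Opens) (x : X) (hx : x ∈ U) (c : ℂ) (f : Γ(X, U))
    (hf : X.evaluation U x hx f = 0) : X.evaluation U x hx (c • f) = 0 := by
  rw [Algebra.smul_def, map_mul, hf, mul_zero]

/-- The hyperplane of all sections in `E` that vanish at the point `x`. As a function of `x` this is
the Kodaira map `Φ_E`, a point of `ℙ(E*)` being thought of as a hyperplane in `E`. -/
def kodaira {L : LineBundle X} (E : Submodule ℂ L.Sec) (x : Pt X) : Submodule ℂ E where
  carrier := {s | ∀ (a : L.ι) (hx : x.1 ∈ L.U a), X.evaluation (L.U a) x.1 hx (s.1.coord a) = 0}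
  zero_mem' a hx := by
    rw [ZeroMemClass.coe_zero, map_zero, map_zero]
  add_mem' {s t} hs ht a hx := by
    rw [Submodule.coe_add, map_add, map_add, hs a hx, ht a hx, add_zero]
  smul_mem' c s hs a hx := by
    rw [Submodule.coe_smul, map_smul]
    exact evaluation_const_smul _ _ _ c _ (hs a hx)

/-- The section `s` vanishes at the point `x`. -/
def Vanishes {L : LineBundle X} {E : Submodule ℂ L.Sec} (s : E) (x : Pt X) : Prop :=
  s ∈ kodaira E x

/-- `E` is base-point free: no point is a common zero of all sections in `E`. -/
def BasePointFree {L : LineBundle X} (E : Submodule ℂ L.Sec) : Prop :=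
  ∀ x : Pt X, ∃ s : E, ¬ Vanishes s x

/-- The image `Y_E ⊆ ℙ(E*)` of the Kodaira map: the functionals (up to scalars) whose kernel is the
hyperplane `Φ_E(x)` for some point `x`. -/
def kodairaImage {L : LineBundle X} (E : Submodule ℂ L.Sec) : Set (ℙ ℂ (Module.Dual ℂ E)) :=
  {p | ∃ x : Pt X, LinearMap.ker p.rep = kodaira E x}

/-- `τ_E`, the dimension of the image of the Kodaira map. -/
def tau {L : LineBundle X} (E : Submodule ℂ L.Sec) : ℕ :=
  ((projDim (kodairaImage E)).unbotD 0).toNat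

/-- The product of a finite family of linear series: the span of all tensor products of sections. -/
def prodSeries {κ : Type} [Fintype κ] {L : κ → LineBundle X}
    (E : ∀ j, Submodule ℂ (L j).Sec) : Submodule ℂ (LineBundle.tensor L).Sec :=
  Submodule.span ℂ (Set.range fun s : (∀ j, E j) => tensorSection fun j => (s j).1)

/-- The sections in `E` that vanish at all points of `F`. -/
def vanishingOn {L : LineBundle X} (E : Submodule ℂ L.Sec) (F : Set (Pt X)) :
    Submodule ℂ E :=
  ⨅ x ∈ F, kodaira E x

/-- The restriction `E|_F` of the linear series `E` to a subvariety with set of points `F`: sections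
in `E` are identified when they agree on `F`. -/
abbrev Restr {L : LineBundle X} (E : Submodule ℂ L.Sec) (F : Set (Pt X)) : Type :=
  E ⧸ vanishingOn E F

/-- The restriction `s|_F` of a section `s`. -/
def restr {L : LineBundle X} {E : Submodule ℂ L.Sec} (F : Set (Pt X)) (s : E) : Restr E F :=
  (vanishingOn E F).mkQ s

/-- The element `u` of `E|_F` vanishes at the point `x` of `F`. -/
def RestrVanishes {L : LineBundle X} {E : Submodule ℂ L.Sec} {F : Set (Pt X)}
    (u : Restr E F) (x : F) : Prop :=
  u ∈ (kodaira E x.1).map (vanishingOn E F).mkQ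

/-- Sanity check: a restricted section vanishes at a point of `F` iff the section does. -/
lemma restrVanishes_restr {L : LineBundle X} {E : Submodule ℂ L.Sec} {F : Set (Pt X)}
    (s : E) (x : F) : RestrVanishes (restr F s) x ↔ Vanishes s x.1 := by
  constructor
  · rintro ⟨t, ht, hts⟩
    have h : t - s ∈ vanishingOn E F := (Submodule.Quotient.eq _).1 hts
    have h' : t - s ∈ kodaira E x.1 := by
      simp only [vanishingOn, Submodule.mem_iInf] at h
      exact h x.1 x.2
    have := Submodule.sub_mem _ ht h'
    simpa [Vanishes] using this
  · intro h
    exact ⟨s, h, rfl⟩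

end Series

/-! ### Collections of linear series -/

section Collections

variable {X : Scheme.{0}} [X.Over (Spec (.of ℂ))] {κ : Type}
  {L : κ → LineBundle X} (E : ∀ i, Submodule ℂ (L i).Sec)

/-- The zero set `Z_s` of a system `s`. -/
def zeroSet {E : ∀ i, Submodule ℂ (L i).Sec} (s : ∀ i, E i) : Set (Pt X) :=
  {x | ∀ i, Vanishes (s i) x}

/-- The zero set, inside `F`, of a system of restricted sections. -/
def restrZeroSet {E : ∀ i, Submodule ℂ (L i).Sec} {F : Set (Pt X)}
    (u : ∀ i, Restr (E i) F) : Set (Pt X) :=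
  {x | ∃ hx : x ∈ F, ∀ i, RestrVanishes (u i) ⟨x, hx⟩}

/-- The generic system has no roots on `X`. -/
def IsOverdetermined : Prop :=
  ∃ W : Set (∀ i, E i), @IsOpen _ (zariski (∀ i, E i)) W ∧ W.Nonempty ∧ ∀ s ∈ W, zeroSet s = ∅

/-- The generic system of the collection of the restricted linear series `E_i|_F` has a root on
`F`. -/
def IsGenericallyConsistentOn (F : Set (Pt X)) : Prop :=
  ∃ W : Set (∀ i, Restr (E i) F), @IsOpen _ (zariski (∀ i, Restr (E i) F)) W ∧ W.Nonempty ∧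
    ∀ u ∈ W, (restrZeroSet u).Nonempty

/-- The consistency variety `R_E`: the Zariski closure of the set of systems with a root. -/
def consistencyVariety : Set (∀ i, E i) :=
  @closure (∀ i, E i) (zariski (∀ i, E i)) {s | (zeroSet s).Nonempty}

/-- `E_J`, the product of the series `E_j` with `j ∈ J`. -/
def seriesJ (J : Finset κ) : Submodule ℂ (LineBundle.tensor fun j : J => L j).Sec :=
  prodSeries fun j : J => E j

/-- The defect `def(E_J) = τ_J - |J|`. -/
def defect (J : Finset κ) : ℤ :=
  (tau (seriesJ E J) : ℤ) - J.card

/-- `J` is an essential subcollection: it has the minimal defect, and all its proper subcollections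
have larger defect. -/
def IsEssential (J : Finset κ) : Prop :=
  (∀ I : Finset κ, defect E J ≤ defect E I) ∧ ∀ I : Finset κ, I ⊂ J → defect E J < defect E I

/-- The fibre, through the point `a`, of the Kodaira map `Φ_J` of `E_J`. -/
def fibre (J : Finset κ) (a : Pt X) : Set (Pt X) :=
  {x | kodaira (seriesJ E J) x = kodaira (seriesJ E J) a}

/-- The complementary part of a system `s`, restricted to `F`. -/
def restrCompl {E : ∀ i, Submodule ℂ (L i).Sec} (J : Finset κ) (F : Set (Pt X))
    (s : ∀ i, E i) : ∀ i : {i // i ∉ J}, Restr (E i) F :=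
  fun i => restr F (s i)

end Collections

end LinSeries

end

open LinSeries

/-! The proof is a dimension count at the generic point of the consistency variety, with
transcendence degrees over ℂ in place of dimensions. Choose bases of the `E i`, put n_i = dim E_i
and N = ∑ n_i, and let v_i be the vector of basis sections of `E i` at the generic point of X, as
homogeneous coordinates over the function field K. Then τ_I is the transcendence degree of the
ratios of coordinates of the v_i with i ∈ I (`tau_seriesJ`). Over an extension of K by independent
coefficients, let w be the generic solution of the equations ∑_j w_ij v_ij = 0. It is a generic
point of R_E, which is therefore irreducible.

Two estimates determine the shape of R_E. A rank bound for generic linear combinations,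
`exists_rk_le_rk_generic`, shows that w has degree at least N + def(E_I) for some I, hence at least
N + def(E_J) by minimality (`le_rk_genericSol`). The part w_J with indices in J has degree at most
∑_{i ∈ J} n_i + def(E_J) (`rk_genericSol_le`). So both bounds are attained, and the coordinates of w
outside J are algebraically independent over w_J. Thus R_E is the product of its projection to the
equations in J with an affine space (`eval_eq_zero_of_eqOn`): the equations outside J are free,
which gives properties 2 and 3.

It remains to see that the equations in J single out one fibre. Suppose that w_J vanishes at a
second point with a different image under Φ_J, and let A ⊊ J be the set of indices at which the two
images agree. By submodularity the pair of images has degree at most 2τ_J - τ_A. Each i ∈ A imposes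
one linear condition on w_i, and each i ∈ J \ A imposes two. Hence w_J has degree at most 2τ_J - τ_A
+ ∑_{i ∈ J} n_i - 2|J| + |A|. Comparing with the lower bound gives def(E_A) ≤ def(E_J), contrary to
the choice of J (`false_of_two_points`). `exists_ne_zero_of_generic` spreads this out to closed
points, and Chevalley's theorem supplies the polynomial g whose nonvanishing defines W
(`exists_generic`).

The algebra is done for a `ChartSystem`, which keeps only the function field, affine charts and
coordinates. `exists_chartSystem` extracts it from the scheme, and `projDim_eq_rk` identifies Krull
dimensions with transcendence degrees. -/

/-! ### The rank function of the algebraic matroid of a field extension -/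

namespace TrRank

open AlgebraicIndependent

section Basic

variable (k : Type*) {Ω : Type*} [Field k] [Field Ω] [Algebra k Ω]

/-- The set of elements algebraic over the subfield generated by `S`. -/
def acl (S : Set Ω) : Set Ω := (matroid k Ω).closure S

/-- The transcendence degree of the subfield generated by `S` (meaningful for finite `S`). -/
noncomputable def rk (S : Set Ω) : ℕ := ((matroid k Ω).eRk S).toNat

variable {k}

lemma coe_rk {S : Set Ω} (hS : S.Finite) : (rk k S : ℕ∞) = (matroid k Ω).eRk S :=
  ENat.natCast_toNat (Matroid.eRk_ne_top_iff.2 ((matroid k Ω).isRkFinite_of_finite hS))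

lemma subset_acl (S : Set Ω) : S ⊆ acl k S :=
  (matroid k Ω).subset_closure S (by simp)

lemma acl_subset_acl {S T : Set Ω} (h : S ⊆ acl k T) : acl k S ⊆ acl k T :=
  (matroid k Ω).closure_subset_closure_of_subset_closure h

lemma acl_mono {S T : Set Ω} (h : S ⊆ T) : acl k S ⊆ acl k T :=
  (matroid k Ω).closure_subset_closure h

lemma mem_acl_iff {S : Set Ω} {x : Ω} : x ∈ acl k S ↔ IsAlgebraic (Algebra.adjoin k S) x := by
  rw [acl, matroid_closure_eq]; exact Iff.rfl

lemma rk_le_of_subset_acl {S T : Set Ω} (hT : T.Finite) (h : S ⊆ acl k T) : rk k S ≤ rk k T := by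
  refine ENat.toNat_le_toNat ?_
    (Matroid.eRk_ne_top_iff.2 ((matroid k Ω).isRkFinite_of_finite hT))
  rw [← (matroid k Ω).eRk_closure_eq T]
  exact (matroid k Ω).eRk_mono h

lemma rk_mono {S T : Set Ω} (hT : T.Finite) (h : S ⊆ T) : rk k S ≤ rk k T :=
  rk_le_of_subset_acl hT (h.trans (subset_acl T))

lemma rk_insert_of_notMem {S : Set Ω} (hS : S.Finite) {x : Ω} (hx : x ∉ acl k S) :
    rk k (insert x S) = rk k S + 1 := by
  have := (matroid k Ω).eRk_insert_eq_add_one (e := x) (X := S) ⟨by simp, hx⟩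
  rw [← coe_rk hS, ← coe_rk (hS.insert x)] at this
  exact_mod_cast this

lemma rk_union_le {S T : Set Ω} (hS : S.Finite) (hT : T.Finite) :
    rk k (S ∪ T) ≤ rk k S + rk k T := by
  have := (matroid k Ω).eRk_union_le_eRk_add_eRk S T
  rw [← coe_rk hS, ← coe_rk hT, ← coe_rk (hS.union hT)] at this
  exact_mod_cast this

lemma rk_le_ncard {S : Set Ω} (hS : S.Finite) : rk k S ≤ S.ncard := by
  have := (matroid k Ω).eRk_le_encard S
  rw [← coe_rk hS, ← hS.cast_ncard_eq] at this
  exact_mod_cast this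

lemma rk_image_le {ι : Type*} (s : Finset ι) (f : ι → Ω) : rk k (f '' s) ≤ s.card :=
  (rk_le_ncard (s.finite_toSet.image f)).trans
    ((Set.ncard_image_le s.finite_toSet).trans (Set.ncard_coe_finset s).le)

/-- This is submodularity of the rank, applied to the closures of `S` and `T`, whose intersection
contains `U`. -/
lemma rk_add_rk_union_le {S T U : Set Ω} (hS : S.Finite) (hT : T.Finite) (hU : U.Finite)
    (hUS : U ⊆ acl k S) (hUT : U ⊆ acl k T) :
    rk k U + rk k (S ∪ T) ≤ rk k S + rk k T := by
  have h := (matroid k Ω).eRk_inter_add_eRk_union_le (acl k S) (acl k T)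
  have e : ∀ A : Set Ω, (matroid k Ω).eRk (acl k A) = (matroid k Ω).eRk A :=
    (matroid k Ω).eRk_closure_eq
  have h1 := (matroid k Ω).eRk_mono (Set.subset_inter hUS hUT)
  have h2 := (matroid k Ω).eRk_mono
    (Set.union_subset_union (subset_acl (k := k) S) (subset_acl (k := k) T))
  have h3 := (add_le_add h1 h2).trans h
  rw [e, e, ← coe_rk hS, ← coe_rk hT, ← coe_rk hU, ← coe_rk (hS.union hT)] at h3
  exact_mod_cast h3

variable (k) in
/-- The relatively algebraically closed subfield generated by `S`. -/
noncomputable def aclField (S : Set Ω) : IntermediateField k Ω :=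
  ((Subalgebra.algebraicClosure (Algebra.adjoin k S) Ω).restrictScalars k).toIntermediateField
    fun x (hx : IsAlgebraic (Algebra.adjoin k S) x) => hx.inv

lemma mem_aclField {S : Set Ω} {x : Ω} : x ∈ aclField k S ↔ x ∈ acl k S :=
  mem_acl_iff.symm

attribute [irreducible] aclField

lemma coe_aclField (S : Set Ω) : (aclField k S : Set Ω) = acl k S :=
  Set.ext fun _ => mem_aclField

lemma adjoin_subset_acl (S : Set Ω) : (Algebra.adjoin k S : Set Ω) ⊆ acl k S := by
  rw [← coe_aclField]
  have : Algebra.adjoin k S ≤ (aclField k S).toSubalgebra :=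
    Algebra.adjoin_le fun x hx => mem_aclField.2 (subset_acl S hx)
  exact this

lemma mem_acl_of_isAlgebraic {S : Set Ω} {x : Ω} (h : IsAlgebraic (aclField k S) x) :
    x ∈ acl k S := by
  refine acl_subset_acl (S := acl k S) le_rfl ?_
  rw [mem_acl_iff]
  have e : Algebra.adjoin k (acl k S) = (aclField k S).toSubalgebra := by
    rw [← coe_aclField]
    exact Algebra.adjoin_eq (aclField k S).toSubalgebra
  rw [e]
  exact h

/-- If `c` is transcendental over `G` and `c * a + b` is algebraic over `F(c)`, where `F ≤ G` and
`a, b ∈ G`, then infinitely many `F`-multiples of `a` translated by `b` are algebraic over `F`. -/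
lemma exists_infinite_isAlgebraic {F G : IntermediateField k Ω} (hFG : F ≤ G) {c : Ω}
    (hctr : Transcendental G c) (a b : G)
    (h : IsAlgebraic (Polynomial.aeval c : Polynomial F →ₐ[F] Ω).range (c * a + b)) :
    ∃ f : Polynomial F, f ≠ 0 ∧ ∀ m : F, f.eval m ≠ 0 → IsAlgebraic F ((m : Ω) * a + b) := by
  let i : F →+* G := (IntermediateField.inclusion hFG).toRingHom
  let ψ : Polynomial F →+* Ω := (Polynomial.aeval c : Polynomial F →ₐ[F] Ω).toRingHom
  obtain ⟨p, hp0, hp⟩ := h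
  have hlift : p.map (algebraMap (Polynomial.aeval c : Polynomial F →ₐ[F] Ω).range Ω) ∈
      Polynomial.lifts ψ := by
    rw [Polynomial.lifts_iff_coeff_lifts]
    intro n
    rw [Polynomial.coeff_map]
    exact (p.coeff n).2
  obtain ⟨P, hP⟩ := (Polynomial.mem_lifts _).1 hlift
  have hPeval : P.eval₂ ψ (c * a + b) = 0 := by
    rw [← Polynomial.eval_map, hP, Polynomial.eval_map]
    exact hp
  have hP0 : P ≠ 0 := by
    rintro rfl
    rw [Polynomial.map_zero] at hP
    exact hp0 ((Polynomial.map_eq_zero_iff Subtype.val_injective).1 hP.symm)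
  -- Since `c` is transcendental over `G`, the relation holds identically in a variable put in place
  -- of `c`, and this variable may then be specialized to any `m` in `F`.
  have hQ : P.eval₂ (Polynomial.mapRingHom i)
      (Polynomial.C a * Polynomial.X + Polynomial.C b) = 0 := by
    refine (transcendental_iff.1 hctr) _ ?_
    have := Polynomial.hom_eval₂ P (Polynomial.mapRingHom i)
      (Polynomial.aeval c : Polynomial G →ₐ[G] Ω).toRingHom
      (Polynomial.C a * Polynomial.X + Polynomial.C b)
    refine this.trans ?_
    have e1 : ((Polynomial.aeval c : Polynomial G →ₐ[G] Ω).toRingHom).comp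
        (Polynomial.mapRingHom i) = ψ := by
      ext x
      · simp [ψ]; rfl
      · simp [ψ]
    have e2 : (Polynomial.aeval c : Polynomial G →ₐ[G] Ω).toRingHom
        (Polynomial.C a * Polynomial.X + Polynomial.C b) = c * a + b := by
      rw [mul_comm c]
      simp
    rw [e1, e2, hPeval]
  obtain ⟨n, hn⟩ : ∃ n, P.coeff n ≠ 0 := by
    by_contra! hcon
    exact hP0 (Polynomial.ext hcon)
  refine ⟨P.coeff n, hn, fun m hm => ⟨P.map (Polynomial.evalRingHom m), fun h0 => hm ?_, ?_⟩⟩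
  · have := congrArg (fun q => q.coeff n) h0
    simpa using this
  · have h1 := Polynomial.hom_eval₂ P (Polynomial.mapRingHom i) (Polynomial.evalRingHom (i m))
      (Polynomial.C a * Polynomial.X + Polynomial.C b)
    rw [hQ, map_zero] at h1
    have e1 : (Polynomial.evalRingHom (i m)).comp (Polynomial.mapRingHom i) =
        i.comp (Polynomial.evalRingHom m) := by
      ext x <;> simp
    have e2 : Polynomial.evalRingHom (i m) (Polynomial.C a * Polynomial.X + Polynomial.C b) =
        i m * a + b := by
      rw [mul_comm (i m)]
      simp
    rw [e1, e2] at h1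
    have h2 := congrArg (algebraMap G Ω) h1
    rw [map_zero, Polynomial.hom_eval₂] at h2
    rw [Polynomial.aeval_def, Polynomial.eval₂_map]
    exact h2.symm

/-- If `c` is transcendental over a field containing `S`, `a` and `b`, and `c * a + b` is algebraic
over the field generated by `S` and `c`, then `a` is algebraic over the field generated by `S`. -/
lemma mem_acl_of_mul_add_mem [Infinite k] {S T : Set Ω} (hST : S ⊆ acl k T) {a b c : Ω}
    (ha : a ∈ acl k T) (hb : b ∈ acl k T) (hc : c ∉ acl k T)
    (h : c * a + b ∈ acl k (insert c S)) : a ∈ acl k S := by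
  obtain ⟨F, hF⟩ : ∃ F, F = aclField k S := ⟨_, rfl⟩
  obtain ⟨G, hG⟩ : ∃ G, G = aclField k T := ⟨_, rfl⟩
  have hFG : F ≤ G := fun x hx => by
    rw [hG]
    exact mem_aclField.2 (acl_subset_acl hST (mem_aclField.1 (hF ▸ hx)))
  have hctr : Transcendental G c := fun h => hc (mem_acl_of_isAlgebraic (hG ▸ h))
  have halg : IsAlgebraic (Polynomial.aeval c : Polynomial F →ₐ[F] Ω).range (c * a + b) := by
    have hle : Algebra.adjoin k (insert c S) ≤
        ((Polynomial.aeval c : Polynomial F →ₐ[F] Ω).restrictScalars k).range := by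
      refine Algebra.adjoin_le (Set.insert_subset ⟨Polynomial.X, ?_⟩ fun s hs =>
        ⟨Polynomial.C ⟨s, hF ▸ mem_aclField.2 (subset_acl S hs)⟩, ?_⟩)
      · exact Polynomial.aeval_X c
      · exact Polynomial.aeval_C c _
    exact IsAlgebraic.tower_top_of_subalgebra_le hle (mem_acl_iff.1 h)
  obtain ⟨f, hf0, hf⟩ := exists_infinite_isAlgebraic hFG hctr
    ⟨a, hG ▸ mem_aclField.2 ha⟩ ⟨b, hG ▸ mem_aclField.2 hb⟩ halg
  have : Infinite F := Infinite.of_injective _ (algebraMap k F).injective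
  have hinf : {m : F | f.eval m ≠ 0}.Infinite := by
    have : {m : F | f.eval m ≠ 0} = {m | f.IsRoot m}ᶜ := rfl
    rw [this]
    exact (Polynomial.finite_setOfPred_isRoot hf0).infinite_compl
  have hmem : ∀ m : F, f.eval m ≠ 0 → (m : Ω) * a + b ∈ F := fun m hm => by
    have h1 := hf m hm
    change IsAlgebraic F ((m : Ω) * a + b) at h1
    generalize (m : Ω) * a + b = x at h1 ⊢
    subst hF
    exact mem_aclField.2 (mem_acl_of_isAlgebraic h1)
  -- Two different multipliers suffice: subtracting removes `b` and leaves a nonzero multiple of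
  -- `a`.
  obtain ⟨m, hm1, m', hm2, hne⟩ := hinf.nontrivial
  have h3 : ((m - m' : F) : Ω) * a ∈ F := by
    have := F.sub_mem (hmem m hm1) (hmem m' hm2)
    push_cast
    convert this using 1
    ring
  have h4 : ((m - m' : F) : Ω) ≠ 0 := fun h0 => sub_ne_zero.2 hne (Subtype.ext h0)
  have h5 := F.mul_mem (F.inv_mem (m - m').2) h3
  rw [inv_mul_cancel_left₀ h4, hF] at h5
  exact mem_aclField.1 h5

/-- Elements that are free over `T` stay free over the smaller `S`. This is submodularity for `T`
and `S ∪ c '' a`, whose closures share `S`. -/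
lemma rk_union_image_eq {ι : Type*} {S T : Set Ω} (hS : S.Finite) (hT : T.Finite)
    (hST : S ⊆ acl k T) (a : Finset ι) (c : ι → Ω)
    (hc : rk k (T ∪ c '' a) = rk k T + a.card) : rk k (S ∪ c '' a) = rk k S + a.card := by
  have hC : (c '' (a : Set ι)).Finite := a.finite_toSet.image c
  have h1 := rk_add_rk_union_le (k := k) hT (hS.union hC) hS hST
    (Set.subset_union_left.trans (subset_acl _))
  have h2 : rk k (T ∪ c '' a) ≤ rk k (T ∪ (S ∪ c '' a)) :=
    rk_mono (hT.union (hS.union hC)) (Set.union_subset_union_right _ Set.subset_union_right)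
  have h3 := rk_union_le (k := k) hS hC
  have h4 := rk_image_le (k := k) a c
  omega

/-- Both `S` and `insert x S` gain exactly `a.card` when the free elements are adjoined, so `x`
cannot become algebraic only afterwards. -/
lemma mem_acl_of_mem_acl_union {ι : Type*} {S T : Set Ω} (hS : S.Finite) (hT : T.Finite)
    (hST : S ⊆ acl k T) (a : Finset ι) (c : ι → Ω)
    (hc : rk k (T ∪ c '' a) = rk k T + a.card) {x : Ω} (hxT : x ∈ acl k T)
    (hx : x ∈ acl k (S ∪ c '' a)) : x ∈ acl k S := by
  have h1 := rk_union_image_eq hS hT hST a c hc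
  have h2 := rk_union_image_eq (hS.insert x) hT (Set.insert_subset hxT hST) a c hc
  have h3 : rk k (insert x S ∪ c '' a) ≤ rk k (S ∪ c '' a) := by
    refine rk_le_of_subset_acl (hS.union (a.finite_toSet.image c)) ?_
    rw [Set.insert_union]
    exact Set.insert_subset hx (subset_acl _)
  by_contra hxS
  have := rk_insert_of_notMem hS hxS
  omega

lemma sum_mul_mem_acl {ι : Type*} (a : Finset ι) (c f : ι → Ω) {T : Set Ω}
    (hc : ∀ t ∈ a, c t ∈ acl k T) (hf : ∀ t ∈ a, f t ∈ acl k T) :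
    ∑ t ∈ a, c t * f t ∈ acl k T :=
  mem_aclField.1 <| (aclField k T).sum_mem fun t ht =>
    (aclField k T).mul_mem (mem_aclField.2 (hc t ht)) (mem_aclField.2 (hf t ht))

/-- Isolate the term of `t₀` and move the other coefficients into the base. Then
`mem_acl_of_mul_add_mem` would make `f t₀` algebraic over `S` and those coefficients, which can be
dropped because they are free. -/
lemma sum_mul_notMem_acl [Infinite k] {ι : Type*} {S T : Set Ω} (hS : S.Finite) (hT : T.Finite)
    (hST : S ⊆ acl k T) (a : Finset ι) (c f : ι → Ω) (hf : ∀ t ∈ a, f t ∈ acl k T)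
    (hc : rk k (T ∪ c '' a) = rk k T + a.card) {t₀ : ι} (ht₀ : t₀ ∈ a) (hft₀ : f t₀ ∉ acl k S) :
    ∑ t ∈ a, c t * f t ∉ acl k (S ∪ c '' a) := by
  classical
  intro hmem
  have hC' : (c '' (a.erase t₀ : Set ι)).Finite := (a.erase t₀).finite_toSet.image c
  have hCe : c '' (a : Set ι) = insert (c t₀) (c '' (a.erase t₀ : Finset ι)) := by
    rw [← Set.image_insert_eq, ← Finset.coe_insert, Finset.insert_erase ht₀]
  have hcard : (a.erase t₀).card + 1 = a.card := Finset.card_erase_add_one ht₀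
  have h4 := rk_image_le (k := k) (a.erase t₀) c
  have h5 := rk_union_le (k := k) hT hC'
  have hct : c t₀ ∉ acl k (T ∪ c '' (a.erase t₀ : Finset ι)) := by
    intro h
    have : rk k (T ∪ c '' a) ≤ rk k (T ∪ c '' (a.erase t₀ : Finset ι)) := by
      refine rk_le_of_subset_acl (hT.union hC') ?_
      rw [hCe, Set.union_insert]
      exact Set.insert_subset h (subset_acl _)
    omega
  have hc' : rk k (T ∪ c '' (a.erase t₀ : Finset ι)) = rk k T + (a.erase t₀).card := by
    have := rk_insert_of_notMem (hT.union hC') hct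
    rw [← Set.union_insert, ← hCe] at this
    omega
  rw [← Finset.add_sum_erase a _ ht₀, hCe, Set.union_insert] at hmem
  have hTT : acl k T ⊆ acl k (T ∪ c '' (a.erase t₀ : Finset ι)) := acl_mono Set.subset_union_left
  have hφ := mem_acl_of_mul_add_mem (T := T ∪ c '' (a.erase t₀ : Finset ι))
    (Set.union_subset (hST.trans hTT) (Set.subset_union_right.trans (subset_acl _)))
    (hTT (hf t₀ ht₀))
    (sum_mul_mem_acl _ c f
      (fun t ht => subset_acl _ (Or.inr (Set.mem_image_of_mem c ht)))
      fun t ht => hTT (hf t (Finset.mem_of_mem_erase ht))) hct hmem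
  exact hft₀ (mem_acl_of_mem_acl_union hS hT hST _ c hc' (hf t₀ ht₀) hφ)

/-- A lower bound for the transcendence degree of a family of generic linear combinations. -/
theorem exists_rk_le_rk_generic [Infinite k] {κ ι : Type*} [DecidableEq κ] [DecidableEq ι]
    (a : κ → Finset ι) (c f : ι → Ω) (s : Finset κ) :
    ∀ {S T : Set Ω}, S.Finite → T.Finite → S ⊆ acl k T → (∀ i ∈ s, ∀ t ∈ a i, f t ∈ acl k T) →
      rk k (T ∪ c '' (s.biUnion a)) = rk k T + ∑ i ∈ s, (a i).card →
      ∃ I ⊆ s, rk k (S ∪ f '' (I.biUnion a)) + (s \ I).card + ∑ i ∈ s, (a i).card ≤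
        rk k (S ∪ c '' (s.biUnion a) ∪ (fun i => ∑ t ∈ a i, c t * f t) '' s) := by
  induction s using Finset.induction_on with
  | empty => intro S T hS hT hST hf hc; exact ⟨∅, le_rfl, by simp⟩
  | insert i₀ s hi₀ ih =>
    intro S T hS hT hST hf hc
    set y : κ → Ω := fun i => ∑ t ∈ a i, c t * f t with hy
    have hA : (c '' (a i₀ : Set ι)).Finite := (a i₀).finite_toSet.image c
    have hB : (c '' (s.biUnion a : Set ι)).Finite := (s.biUnion a).finite_toSet.image c
    have hun : c '' ((insert i₀ s).biUnion a : Finset ι) = c '' (a i₀) ∪ c '' (s.biUnion a) := by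
      rw [Finset.biUnion_insert, Finset.coe_union, Set.image_union]
    rw [Finset.sum_insert hi₀, hun, ← Set.union_assoc] at hc
    have h1 := rk_union_le (k := k) (hT.union hA) hB
    have h2 := (rk_image_le (k := k) (s.biUnion a) c).trans Finset.card_biUnion_le
    have h3 := rk_union_le (k := k) hT hA
    have h4 := rk_image_le (k := k) (a i₀) c
    have hTT : acl k T ⊆ acl k (T ∪ c '' (a i₀)) := acl_mono Set.subset_union_left
    have hi₀T : rk k (T ∪ c '' (a i₀)) = rk k T + (a i₀).card := by omega
    have hyT : y i₀ ∈ acl k (T ∪ c '' (a i₀)) := sum_mul_mem_acl _ c f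
      (fun t ht => subset_acl _ (Or.inr (Set.mem_image_of_mem c ht)))
      fun t ht => hTT (hf i₀ (Finset.mem_insert_self _ _) t ht)
    -- The combination for `i₀` and its coefficients move into `S`, but only the coefficients move
    -- into `T`. The combination is algebraic over the new `T`, so the hypotheses persist.
    obtain ⟨I, hI, hle⟩ := ih (S := insert (y i₀) (S ∪ c '' (a i₀))) (T := T ∪ c '' (a i₀))
      ((hS.union hA).insert _) (hT.union hA)
      (Set.insert_subset hyT (Set.union_subset (hST.trans hTT)
        (Set.subset_union_right.trans (subset_acl _))))
      (fun i hi t ht => hTT (hf i (Finset.mem_insert_of_mem hi) t ht)) (by omega)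
    have hR : insert (y i₀) (S ∪ c '' (a i₀)) ∪ c '' (s.biUnion a) ∪ y '' s =
        S ∪ c '' ((insert i₀ s).biUnion a : Finset ι) ∪ y '' (insert i₀ s : Finset κ) := by
      rw [hun, Finset.coe_insert, Set.image_insert_eq]
      ext x
      simp only [Set.mem_union, Set.mem_insert_iff]
      tauto
    rw [hR] at hle
    have hF : (f '' (I.biUnion a : Set ι)).Finite := (I.biUnion a).finite_toSet.image f
    have hSF : S ∪ f '' (I.biUnion a) ⊆ acl k T := by
      refine Set.union_subset hST ?_
      rintro _ ⟨t, ht, rfl⟩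
      obtain ⟨i, hi, hti⟩ := Finset.mem_biUnion.1 ht
      exact hf i (Finset.mem_insert_of_mem (hI hi)) t hti
    have hind := rk_union_image_eq (hS.union hF) hT hSF (a i₀) c hi₀T
    have hi₀I : i₀ ∉ I := fun h => hi₀ (hI h)
    -- If the block of `i₀` is already algebraic over what `I` generates, adding `i₀` to `I` costs
    -- nothing. Otherwise the new combination is transcendental and raises the rank by one, which
    -- accounts for `i₀` in `s \ I`.
    by_cases hall : ∀ t ∈ a i₀, f t ∈ acl k (S ∪ f '' (I.biUnion a))
    · refine ⟨insert i₀ I, Finset.insert_subset_insert _ hI, ?_⟩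
      have e1 : rk k (S ∪ f '' ((insert i₀ I).biUnion a : Finset ι)) ≤
          rk k (S ∪ f '' (I.biUnion a)) := by
        refine rk_le_of_subset_acl (hS.union hF) ?_
        rw [Finset.biUnion_insert, Finset.coe_union, Set.image_union, Set.union_left_comm]
        refine Set.union_subset ?_ (subset_acl _)
        rintro _ ⟨t, ht, rfl⟩
        exact hall t ht
      have e2 : insert i₀ s \ insert i₀ I = s \ I := by
        rw [Finset.insert_sdiff_insert, Finset.sdiff_insert_of_notMem hi₀]
      have e3 : rk k (S ∪ f '' (I.biUnion a) ∪ c '' (a i₀)) ≤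
          rk k (insert (y i₀) (S ∪ c '' (a i₀)) ∪ f '' (I.biUnion a)) := by
        refine rk_mono (((hS.union hA).insert _).union hF) fun x => ?_
        simp only [Set.mem_union, Set.mem_insert_iff]
        tauto
      rw [e2, Finset.sum_insert hi₀]
      omega
    · push Not at hall
      obtain ⟨t₀, ht₀, hft₀⟩ := hall
      refine ⟨I, hI.trans (Finset.subset_insert _ _), ?_⟩
      have hnot := sum_mul_notMem_acl (hS.union hF) hT hSF (a i₀) c f
        (hf i₀ (Finset.mem_insert_self _ _)) hi₀T ht₀ hft₀
      have e1 := rk_insert_of_notMem ((hS.union hF).union hA) hnot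
      have e2 : (insert i₀ s \ I).card = (s \ I).card + 1 := by
        rw [Finset.insert_sdiff_of_notMem _ hi₀I, Finset.card_insert_of_notMem]
        simp [hi₀]
      have e3 : rk k (insert (y i₀) (S ∪ f '' (I.biUnion a) ∪ c '' (a i₀))) ≤
          rk k (insert (y i₀) (S ∪ c '' (a i₀)) ∪ f '' (I.biUnion a)) := by
        refine rk_mono (((hS.union hA).insert _).union hF) fun x => ?_
        simp only [Set.mem_union, Set.mem_insert_iff]
        tauto
      rw [e2, Finset.sum_insert hi₀]
      change rk k (insert (y i₀) _) = _ at e1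
      omega

/-- Transcendence degrees do not increase under specialization. -/
theorem rk_image_le_rk_image {R Ω' : Type*} [CommRing R] [Algebra k R] [Field Ω'] [Algebra k Ω']
    (g : R →ₐ[k] Ω') (h : R →ₐ[k] Ω) (hh : Function.Injective h) {S : Set R} (hS : S.Finite) :
    rk k (g '' S) ≤ rk k (h '' S) := by
  -- A maximal independent set in the image under `g` lifts to an independent set in `R`, and the
  -- injective `h` preserves independence.
  obtain ⟨B, hB⟩ := (matroid k Ω').exists_isBasis (g '' S)
  obtain ⟨B₀, hB₀S, hB₀⟩ := Set.subset_image_iff.1 hB.subset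
  obtain ⟨B₁, hB₁B₀, hbij⟩ := Set.exists_subset_bijOn B₀ g
  rw [hB₀] at hbij
  have hfin : B₁.Finite := hS.subset (hB₁B₀.trans hB₀S)
  have hind : AlgebraicIndependent k (fun x : B₁ => g x) :=
    ((matroid_indep_iff.1 hB.indep).comp (fun x : B₁ => ⟨g x, hbij.mapsTo x.2⟩)
      fun x y hxy => Subtype.ext (hbij.injOn x.2 y.2 (congrArg Subtype.val hxy)))
  have hind₁ : AlgebraicIndependent k (fun x : B₁ => (x : R)) := hind.of_comp g
  have hind₂ : AlgebraicIndependent k (fun x : B₁ => h x) := hind₁.map' hh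
  have hind₃ : (matroid k Ω).Indep (h '' B₁) := by
    have : h '' B₁ = Set.range (fun x : B₁ => h x) := by
      ext; simp
    rw [this]
    exact hind₂.coe_range
  have h1 : rk k (g '' S) = B₁.encard.toNat := by
    rw [rk, ← hB.encard_eq_eRk, ← hbij.image_eq, hbij.injOn.encard_image]
  rw [h1, ← hh.injOn.encard_image, ← hind₃.eRk_eq_encard]
  exact rk_mono (hS.image h) (Set.image_mono (hB₁B₀.trans hB₀S))

end Basic

end TrRank

/-! ### Points of finitely generated algebras over an algebraically closed field -/

namespace TrRank

section Points

variable {k : Type*} [Field k] [IsAlgClosed k]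

/-- Nullstellensatz: the residue field of a maximal ideal above `I` is finite over `k` and so maps
to `k`. -/
lemma exists_algHom_ker_ge {A : Type*} [CommRing A] [Algebra k A] [Algebra.FiniteType k A]
    (I : Ideal A) (hI : I ≠ ⊤) : ∃ h : A →ₐ[k] k, ∀ a ∈ I, h a = 0 := by
  obtain ⟨m, hm, hIm⟩ := I.exists_le_maximal hI
  let : Field (A ⧸ m) := Ideal.Quotient.field m
  have : Algebra.FiniteType k (A ⧸ m) :=
    Algebra.FiniteType.of_surjective (Ideal.Quotient.mkₐ k m) (Ideal.Quotient.mkₐ_surjective k m)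
  have : Module.Finite k (A ⧸ m) := finite_of_finite_type_of_isJacobsonRing k (A ⧸ m)
  refine ⟨(IsAlgClosed.lift : (A ⧸ m) →ₐ[k] k).comp (Ideal.Quotient.mkₐ k m), fun a ha => ?_⟩
  have : Ideal.Quotient.mkₐ k m a = 0 := Ideal.Quotient.eq_zero_iff_mem.2 (hIm ha)
  rw [AlgHom.comp_apply, this, map_zero]

lemma exists_algHom (A : Type*) [CommRing A] [Nontrivial A] [Algebra k A]
    [Algebra.FiniteType k A] : Nonempty (A →ₐ[k] k) :=
  let ⟨h, _⟩ := exists_algHom_ker_ge (k := k) (⊥ : Ideal A) bot_ne_top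
  ⟨h⟩

/-- A morphism of finite type from an irreducible variety to an affine space has the property that
the image contains a non-empty open subset of its closure. -/
lemma exists_notMem_ker_forall_exists_lift {ι : Type*} [Finite ι] {D : Type*} [CommRing D]
    [IsDomain D] [Algebra k D] [Algebra.FiniteType k D] (φ : MvPolynomial ι k →ₐ[k] D) :
    ∃ g, φ g ≠ 0 ∧ ∀ s : ι → k, (∀ f, φ f = 0 → MvPolynomial.eval s f = 0) →
      MvPolynomial.eval s g ≠ 0 → ∃ h : D →ₐ[k] k, ∀ i, h (φ (MvPolynomial.X i)) = s i := by
  have hft : φ.toRingHom.FiniteType := by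
    have h1 : (φ.toRingHom.comp MvPolynomial.C).FiniteType := by
      have : φ.toRingHom.comp MvPolynomial.C = algebraMap k D := by
        ext x; exact φ.commutes x
      rw [this]
      exact RingHom.finiteType_algebraMap.2 inferInstance
    exact RingHom.FiniteType.of_comp_finiteType h1
  have hfp : φ.toRingHom.FinitePresentation := RingHom.FinitePresentation.of_finiteType.1 hft
  obtain ⟨S, hS⟩ := PrimeSpectrum.exists_constructibleSetData_iff.2
    (PrimeSpectrum.isConstructible_range_comap hfp)
  -- By Chevalley's theorem the image is constructible. It contains the generic point `ker φ` of its
  -- closure, so some locally closed piece does too, and that piece contains all points of the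
  -- closure at which `C.f` is not zero.
  have h0 : PrimeSpectrum.comap φ.toRingHom ⊥ ∈ S.toSet := hS ▸ Set.mem_range_self _
  rw [PrimeSpectrum.ConstructibleSetData.toSet, Set.mem_iUnion₂] at h0
  obtain ⟨C, hCS, hC1, hC2⟩ := h0
  refine ⟨C.f, ?_, fun s hs hsg => ?_⟩
  · intro h
    refine hC2 ?_
    rw [PrimeSpectrum.mem_zeroLocus, Set.singleton_subset_iff]
    exact h
  · have hmax : (RingHom.ker (MvPolynomial.eval s)).IsMaximal :=
      RingHom.ker_isMaximal_of_surjective _ fun x => ⟨MvPolynomial.C x, MvPolynomial.eval_C x⟩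
    have hmem : (⟨RingHom.ker (MvPolynomial.eval s), hmax.isPrime⟩ :
        PrimeSpectrum (MvPolynomial ι k)) ∈ S.toSet := by
      rw [PrimeSpectrum.ConstructibleSetData.toSet, Set.mem_iUnion₂]
      refine ⟨C, hCS, fun f hf => hs f (hC1 hf), fun h => hsg ?_⟩
      rw [PrimeSpectrum.mem_zeroLocus, Set.singleton_subset_iff] at h
      exact h
    rw [hS] at hmem
    obtain ⟨Q, hQ⟩ := hmem
    obtain ⟨h, hh⟩ := exists_algHom_ker_ge (k := k) Q.asIdeal Q.2.ne_top
    refine ⟨h, fun i => ?_⟩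
    have h1 : MvPolynomial.X i - MvPolynomial.C (s i) ∈ RingHom.ker (MvPolynomial.eval s) := by
      rw [RingHom.mem_ker]; simp
    have h2 : φ (MvPolynomial.X i - MvPolynomial.C (s i)) ∈ Q.asIdeal := by
      have := congrArg PrimeSpectrum.asIdeal hQ
      change Ideal.comap φ.toRingHom Q.asIdeal = RingHom.ker (MvPolynomial.eval s) at this
      rw [← this] at h1
      exact h1
    have h3 := hh _ h2
    have h4 : φ (MvPolynomial.C (s i)) = algebraMap k D (s i) := φ.commutes (s i)
    rw [map_sub, map_sub, h4, AlgHom.commutes] at h3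
    exact sub_eq_zero.1 h3

end Points

/-! ### Transcendence degree after adjoining independent elements. -/

section Generic

open AlgebraicIndependent

variable {k K ι : Type*} [Field k] [Field K] [Algebra k K]

/-- A transcendence basis of `T` over `k` and the `c t`, which are independent over `K`, together
form an independent family over `k`. -/
lemma rk_union_X {Ω : Type*} [Field Ω] [Algebra k Ω] [Algebra K Ω] [IsScalarTower k K Ω]
    {c : ι → Ω} (hc : AlgebraicIndependent K c) {T : Set K} (hT : T.Finite) (a : Finset ι) :
    rk k (algebraMap K Ω '' T ∪ c '' a) = rk k (algebraMap K Ω '' T) + a.card := by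
  have hA := hT.image (algebraMap K Ω)
  have hC : (c '' (a : Set ι)).Finite := a.finite_toSet.image c
  refine le_antisymm ((rk_union_le hA hC).trans (by gcongr; exact rk_image_le a c)) ?_
  obtain ⟨B, hB⟩ := (matroid k Ω).exists_isBasis (algebraMap K Ω '' T)
  obtain ⟨B₀, hB₀S, hB₀⟩ := Set.subset_image_iff.1 hB.subset
  have hindB : AlgebraicIndependent k (fun x : B₀ => (x : K)) := by
    refine AlgebraicIndependent.of_comp (IsScalarTower.toAlgHom k K Ω) ?_
    exact (matroid_indep_iff.1 hB.indep).comp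
      (fun x : B₀ => ⟨algebraMap K Ω x, hB₀ ▸ Set.mem_image_of_mem _ x.2⟩)
      fun x y hxy => Subtype.ext ((algebraMap K Ω).injective (congrArg Subtype.val hxy))
  have hca : AlgebraicIndependent K (fun t : a => c t) := hc.comp _ Subtype.val_injective
  have hsum := hindB.sumElim_comp hca
  have hind : (matroid k Ω).Indep (Set.range _) := hsum.coe_range
  have hsub : Set.range (Sum.elim (fun t : a => c t) (algebraMap K Ω ∘ fun x : B₀ => (x : K))) ⊆
      algebraMap K Ω '' T ∪ c '' a := by
    rintro _ ⟨x | x, rfl⟩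
    · exact Or.inr ⟨x, x.2, rfl⟩
    · exact Or.inl ⟨x, hB₀S x.2, rfl⟩
  have h1 := rk_mono (k := k) (hA.union hC) hsub
  have hfinB : B₀.Finite := hT.subset hB₀S
  have h2 : rk k (Set.range (Sum.elim (fun t : a => c t)
      (algebraMap K Ω ∘ fun x : B₀ => (x : K)))) = a.card + B₀.ncard := by
    rw [rk, hind.eRk_eq_encard, ← Set.image_univ, hsum.injective.encard_image, Set.encard_univ]
    simp only [ENat.card_sum, ENat.card_eq_coe_fintype_card, Fintype.card_coe]
    rw [ENat.card_coe_set_eq, ← hfinB.cast_ncard_eq]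
    exact_mod_cast ENat.toNat_natCast _
  have h3 : rk k (algebraMap K Ω '' T) = B₀.ncard := by
    rw [rk, ← hB.encard_eq_eRk, ← hB₀, (algebraMap K Ω).injective.encard_image]
    rfl
  omega

end Generic

end TrRank

/-! ### Ratios of homogeneous coordinates and the generic consistent system. -/

namespace TrRank

section Ratios

variable {k K Ω κ : Type*} [Field k] [Field K] [Algebra k K] [Field Ω] [Algebra k Ω]
  {n : κ → Type*}

/-- The ratios of homogeneous coordinates with index in `J` of a family `v` of points in projective
spaces. -/
def ratios (v : ∀ i, n i → K) (J : Finset κ) : Set K :=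
  {x | ∃ i ∈ J, ∃ j l, x = v i j / v i l}

/-- The ratios of homogeneous coordinates with a fixed choice of denominators. -/
def normRatios (v : ∀ i, n i → K) (m : ∀ i, n i) (J : Finset κ) : Set K :=
  (fun t : Σ i, n i => v t.1 t.2 / v t.1 (m t.1)) '' {t | t.1 ∈ J}

lemma finite_normRatios [∀ i, Finite (n i)] [Finite κ] (v : ∀ i, n i → K) (m : ∀ i, n i)
    (J : Finset κ) : (normRatios v m J).Finite :=
  (Set.toFinite _).image _

lemma normRatios_subset (v : ∀ i, n i → K) (m : ∀ i, n i) (J : Finset κ) :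
    normRatios v m J ⊆ ratios v J := by
  rintro _ ⟨t, ht, rfl⟩
  exact ⟨t.1, ht, t.2, m t.1, rfl⟩

lemma finite_ratios [∀ i, Finite (n i)] [Finite κ] (v : ∀ i, n i → K) (J : Finset κ) :
    (ratios v J).Finite := by
  refine (Set.finite_range fun p : Σ i, n i × n i => v p.1 p.2.1 / v p.1 p.2.2).subset ?_
  rintro _ ⟨i, -, j, l, rfl⟩
  exact ⟨⟨i, j, l⟩, rfl⟩

lemma ratios_subset_acl {v : ∀ i, n i → K} {m : ∀ i, n i} (hm : ∀ i, v i (m i) ≠ 0)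
    (J : Finset κ) : ratios v J ⊆ acl k (normRatios v m J) := by
  rintro _ ⟨i, hi, j, l, rfl⟩
  have h : ∀ j, v i j / v i (m i) ∈ aclField k (normRatios v m J) := fun j =>
    mem_aclField.2 (subset_acl _ ⟨⟨i, j⟩, hi, rfl⟩)
  rw [← mem_aclField, ← div_div_div_cancel_right₀ (hm i)]
  exact (aclField k _).div_mem (h j) (h l)

lemma rk_normRatios [∀ i, Finite (n i)] [Finite κ] {v : ∀ i, n i → K} {m : ∀ i, n i}
    (hm : ∀ i, v i (m i) ≠ 0) (J : Finset κ) : rk k (normRatios v m J) = rk k (ratios v J) :=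
  le_antisymm (rk_mono (finite_ratios v J) (normRatios_subset v m J))
    (rk_le_of_subset_acl (finite_normRatios v m J) (ratios_subset_acl hm J))

lemma ratios_eq_of_smul {v v' : ∀ i, n i → K} (h : ∀ i, ∃ l : K, l ≠ 0 ∧ ∀ j, v' i j = l * v i j)
    (J : Finset κ) : ratios v' J = ratios v J := by
  ext x
  refine exists_congr fun i => and_congr_right fun _ => exists₂_congr fun j l => ?_
  obtain ⟨c, hc, hv⟩ := h i
  rw [hv, hv, mul_div_mul_left _ _ hc]

lemma rk_image_eq (f : K →ₐ[k] Ω) {S : Set K} (hS : S.Finite) : rk k (f '' S) = rk k S := by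
  have h1 := rk_image_le_rk_image (AlgHom.id k K) f f.injective hS
  have h2 := rk_image_le_rk_image f (AlgHom.id k K) Function.injective_id hS
  simp only [AlgHom.coe_id, Set.image_id] at h1 h2
  omega

/-- The ratios whose denominators survive under `g` live in the local ring of `R` at the kernel of
`g`. Both maps extend to it, `h` remains injective, and `rk_image_le_rk_image` applies there. -/
lemma rk_normRatios_le [∀ i, Finite (n i)] [Finite κ] {R : Type*} [CommRing R] [Algebra k R]
    (g : R →ₐ[k] Ω) (h : R →ₐ[k] K) (hh : Function.Injective h) (σ : ∀ i, n i → R) (m : ∀ i, n i)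
    (hm : ∀ i, g (σ i (m i)) ≠ 0) (J : Finset κ) :
    rk k (normRatios (fun i j => g (σ i j)) m J) ≤ rk k (ratios (fun i j => h (σ i j)) J) := by
  have := (RingHom.ker_isPrime g.toRingHom)
  let p := RingHom.ker g.toRingHom
  let Q := Localization.AtPrime p
  have hg : ∀ y : p.primeCompl, IsUnit (g y) := fun y => isUnit_iff_ne_zero.2 y.2
  have hh' : ∀ y : p.primeCompl, h y ≠ 0 := fun y h0 => y.2 <| by
    have : (y : R) = 0 := hh (h0.trans (map_zero h).symm)
    rw [this]
    exact p.zero_mem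
  let g' : Q →ₐ[k] Ω := IsLocalization.liftAlgHom (M := p.primeCompl) (f := g) hg
  let h' : Q →ₐ[k] K := IsLocalization.liftAlgHom (M := p.primeCompl) (f := h)
    fun y => isUnit_iff_ne_zero.2 (hh' y)
  have hmk : ∀ x y, g' (IsLocalization.mk' Q x y) = g x / g (y : p.primeCompl) := fun x y => by
    rw [eq_div_iff (hg y).ne_zero]
    have : g' (algebraMap R Q x) = g x := IsLocalization.lift_eq _ x
    rw [← this, ← IsLocalization.mk'_spec Q x y, map_mul]
    congr 1
    exact (IsLocalization.lift_eq _ (y : R)).symm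
  have hmk' : ∀ x y, h' (IsLocalization.mk' Q x y) = h x / h (y : p.primeCompl) := fun x y => by
    rw [eq_div_iff (hh' y)]
    have : h' (algebraMap R Q x) = h x := IsLocalization.lift_eq _ x
    rw [← this, ← IsLocalization.mk'_spec Q x y, map_mul]
    congr 1
    exact (IsLocalization.lift_eq _ (y : R)).symm
  have hinj : Function.Injective h' := by
    rw [injective_iff_map_eq_zero]
    intro q hq
    obtain ⟨x, y, rfl⟩ := IsLocalization.exists_mk'_eq p.primeCompl q
    rw [hmk', div_eq_zero_iff, or_iff_left (hh' y)] at hq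
    rw [hh (hq.trans (map_zero h).symm), IsLocalization.mk'_zero]
  let S : Set Q := (fun t : Σ i, n i => IsLocalization.mk' Q (σ t.1 t.2)
    (⟨σ t.1 (m t.1), hm t.1⟩ : p.primeCompl)) '' {t | t.1 ∈ J}
  have h1 := rk_image_le_rk_image g' h' hinj (S := S) ((Set.toFinite _).image _)
  have e1 : g' '' S = normRatios (fun i j => g (σ i j)) m J := by
    simp only [S, normRatios, Set.image_image, hmk]
  have e2 : h' '' S = normRatios (fun i j => h (σ i j)) m J := by
    simp only [S, normRatios, Set.image_image, hmk']
  rw [e1, e2] at h1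
  exact h1.trans (rk_mono (finite_ratios _ J) (normRatios_subset _ m J))

end Ratios

section GenericSystem

variable {k K κ : Type*} [Field k] [Field K] [Algebra k K]
  {n : κ → Type*} [∀ i, Fintype (n i)] [∀ i, DecidableEq (n i)]

/-- The generic solution `w` of the system of linear equations `∑ j, w ⟨i, j⟩ * v i j = 0`. -/
noncomputable def genericSol (v : ∀ i, n i → K) (m : ∀ i, n i) (t : Σ i, n i) :
    MvPolynomial (Σ i, n i) K :=
  if t.2 = m t.1 then
    -∑ j ∈ Finset.univ.erase (m t.1),
      MvPolynomial.C (v t.1 j / v t.1 (m t.1)) * MvPolynomial.X ⟨t.1, j⟩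
  else MvPolynomial.X t

lemma genericSol_of_ne (v : ∀ i, n i → K) (m : ∀ i, n i) {i : κ} {j : n i} (h : j ≠ m i) :
    genericSol v m ⟨i, j⟩ = MvPolynomial.X ⟨i, j⟩ := if_neg h

lemma genericSol_self (v : ∀ i, n i → K) (m : ∀ i, n i) (i : κ) :
    genericSol v m ⟨i, m i⟩ = -∑ j ∈ Finset.univ.erase (m i),
      MvPolynomial.C (v i j / v i (m i)) * MvPolynomial.X ⟨i, j⟩ := if_pos rfl

lemma sum_genericSol_mul {v : ∀ i, n i → K} {m : ∀ i, n i} (hm : ∀ i, v i (m i) ≠ 0) (i : κ) :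
    ∑ j, genericSol v m ⟨i, j⟩ * MvPolynomial.C (v i j) = 0 := by
  rw [← Finset.add_sum_erase _ _ (Finset.mem_univ (m i)), genericSol_self, neg_mul,
    Finset.sum_mul, neg_add_eq_zero]
  refine Finset.sum_congr rfl fun j hj => ?_
  rw [genericSol_of_ne _ _ (Finset.ne_of_mem_erase hj), mul_right_comm, ← MvPolynomial.C_mul,
    div_mul_cancel₀ _ (hm i), mul_comm]

/-- A solution is determined by its entries off the pivots `m i`. Hence every solution over `K` is a
specialization of the generic one. -/
lemma eval_genericSol {v : ∀ i, n i → K} {m : ∀ i, n i} (hm : ∀ i, v i (m i) ≠ 0)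
    {s : (Σ i, n i) → K} (hs : ∀ i, ∑ j, s ⟨i, j⟩ * v i j = 0) (t : Σ i, n i) :
    MvPolynomial.eval s (genericSol v m t) = s t := by
  obtain ⟨i, j⟩ := t
  by_cases h : j = m i
  · subst h
    rw [genericSol_self, map_neg, map_sum]
    have := hs i
    rw [← Finset.add_sum_erase _ _ (Finset.mem_univ (m i))] at this
    have h2 : (∑ x ∈ Finset.univ.erase (m i), MvPolynomial.eval s
        (MvPolynomial.C (v i x / v i (m i)) * MvPolynomial.X ⟨i, x⟩)) =
        (∑ x ∈ Finset.univ.erase (m i), s ⟨i, x⟩ * v i x) / v i (m i) := by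
      rw [Finset.sum_div]
      refine Finset.sum_congr rfl fun x _ => ?_
      rw [map_mul, MvPolynomial.eval_C, MvPolynomial.eval_X]
      ring
    rw [h2, eq_neg_of_add_eq_zero_right this, neg_div, neg_neg, mul_div_cancel_right₀ _ (hm i)]
  · rw [genericSol_of_ne _ _ h, MvPolynomial.eval_X]

variable {Ω : Type*} [Field Ω] [Algebra k Ω] [Algebra K Ω] [IsScalarTower k K Ω]

/-- The indices of the free coefficients of the `i`-th generic equation. -/
def freeIdx (m : ∀ i, n i) (i : κ) : Finset (Σ i, n i) :=
  (Finset.univ.erase (m i)).map (Function.Embedding.sigmaMk i)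

lemma mem_freeIdx {m : ∀ i, n i} {i : κ} {t : Σ i, n i} :
    t ∈ freeIdx m i ↔ t.1 = i ∧ t.2 ≠ m t.1 := by
  obtain ⟨i', j⟩ := t
  simp only [freeIdx, Finset.mem_map, Finset.mem_erase, Function.Embedding.sigmaMk_apply,
    Finset.mem_univ, and_true]
  constructor
  · rintro ⟨a, ha, h⟩
    cases h
    exact ⟨rfl, ha⟩
  · rintro ⟨rfl, h⟩
    exact ⟨j, h, rfl⟩

lemma card_freeIdx (m : ∀ i, n i) (i : κ) : (freeIdx m i).card + 1 = Fintype.card (n i) := by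
  rw [freeIdx, Finset.card_map, Finset.card_erase_add_one (Finset.mem_univ _), Finset.card_univ]

lemma card_biUnion_freeIdx [DecidableEq κ] (m : ∀ i, n i) (J : Finset κ) :
    (J.biUnion (freeIdx m)).card + J.card = ∑ i ∈ J, Fintype.card (n i) := by
  rw [Finset.card_biUnion]
  · simp_rw [← card_freeIdx m, Finset.sum_add_distrib]
    simp
  · intro i _ j _ hij
    rw [Function.onFun, Finset.disjoint_left]
    intro t ht ht'
    exact hij ((mem_freeIdx.1 ht).1.symm.trans (mem_freeIdx.1 ht').1)

lemma aeval_genericSol_self (v : ∀ i, n i → K) (m : ∀ i, n i) (c : (Σ i, n i) → Ω) (i : κ) :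
    MvPolynomial.aeval c (genericSol v m ⟨i, m i⟩) =
      -∑ t ∈ freeIdx m i, c t * algebraMap K Ω (v t.1 t.2 / v t.1 (m t.1)) := by
  rw [genericSol_self, map_neg, map_sum, freeIdx, Finset.sum_map]
  congr 1
  refine Finset.sum_congr rfl fun j _ => ?_
  rw [map_mul, MvPolynomial.aeval_C, MvPolynomial.aeval_X, mul_comm]
  rfl

lemma aeval_genericSol_of_ne (v : ∀ i, n i → K) (m : ∀ i, n i) (c : (Σ i, n i) → Ω)
    {t : Σ i, n i} (h : t.2 ≠ m t.1) : MvPolynomial.aeval c (genericSol v m t) = c t := by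
  obtain ⟨i, j⟩ := t
  rw [genericSol_of_ne v m h, MvPolynomial.aeval_X]

variable [DecidableEq κ] [Fintype κ]

/-- A lower bound for the dimension of the consistency variety. -/
theorem le_rk_genericSol [Infinite k] {v : ∀ i, n i → K} {m : ∀ i, n i}
    (hm : ∀ i, v i (m i) ≠ 0) {c : (Σ i, n i) → Ω} (hc : AlgebraicIndependent K c) :
    ∃ I : Finset κ, rk k (ratios v I) + Fintype.card (Σ i, n i) ≤
      rk k (Set.range fun t => MvPolynomial.aeval c (genericSol v m t)) + I.card := by
  classical
  set f : (Σ i, n i) → Ω := fun t => algebraMap K Ω (v t.1 t.2 / v t.1 (m t.1)) with hf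
  set w := fun t => MvPolynomial.aeval c (genericSol v m t)
  have hsum : ∑ i, (freeIdx m i).card = (Finset.univ.biUnion (freeIdx m)).card := by
    have h1 := card_biUnion_freeIdx m Finset.univ
    have h2 : ∑ i, (freeIdx m i).card + Fintype.card κ = ∑ i, Fintype.card (n i) := by
      simp_rw [← card_freeIdx m, Finset.sum_add_distrib]
      simp
    rw [Finset.card_univ] at h1
    omega
  -- Each block has n_i - 1 free coefficients, and the combination is, up to sign, the pivot entry
  -- of the generic solution.
  obtain ⟨I, -, hI⟩ := exists_rk_le_rk_generic (k := k) (freeIdx m) c f Finset.univ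
    (S := ∅) (T := algebraMap K Ω '' normRatios v m Finset.univ) Set.finite_empty
    ((finite_normRatios v m _).image _) (Set.empty_subset _)
    (fun i _ t _ => subset_acl _ ⟨_, ⟨t, Finset.mem_univ _, rfl⟩, rfl⟩)
    (by rw [rk_union_X hc (finite_normRatios v m _), hsum])
  refine ⟨I, ?_⟩
  have h1 : rk k (∅ ∪ c '' (Finset.univ.biUnion (freeIdx m) : Finset _) ∪
      (fun i => ∑ t ∈ freeIdx m i, c t * f t) '' (Finset.univ : Finset κ)) ≤
      rk k (Set.range w) := by
    refine rk_le_of_subset_acl (Set.finite_range _) ?_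
    rw [Set.empty_union]
    refine Set.union_subset ?_ ?_
    · rintro _ ⟨t, ht, rfl⟩
      obtain ⟨i, -, ht⟩ := Finset.mem_biUnion.1 ht
      exact subset_acl _ ⟨t, aeval_genericSol_of_ne v m c (mem_freeIdx.1 ht).2⟩
    · rintro _ ⟨i, -, rfl⟩
      rw [← mem_aclField, ← neg_mem_iff, mem_aclField]
      exact subset_acl _ ⟨⟨i, m i⟩, aeval_genericSol_self v m c i⟩
  have h2 : rk k (ratios v I) ≤ rk k (∅ ∪ f '' (I.biUnion (freeIdx m))) := by
    rw [← rk_normRatios hm, Set.empty_union, ← rk_image_eq (IsScalarTower.toAlgHom k K Ω)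
      (finite_normRatios v m I)]
    refine rk_le_of_subset_acl ((Finset.finite_toSet _).image _) ?_
    rintro _ ⟨_, ⟨⟨i, j⟩, ht, rfl⟩, rfl⟩
    by_cases hj : j = m i
    · subst hj
      rw [← mem_aclField]
      dsimp only
      rw [div_self (hm i), map_one]
      exact one_mem _
    · exact subset_acl _ ⟨⟨i, j⟩, Finset.mem_biUnion.2 ⟨i, ht, mem_freeIdx.2 ⟨rfl, hj⟩⟩, rfl⟩
  have h3 := card_biUnion_freeIdx m Finset.univ
  have h4 : (Finset.univ \ I).card + I.card = Fintype.card κ := by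
    rw [Finset.card_sdiff_add_card_eq_card (Finset.subset_univ I), Finset.card_univ]
  rw [Finset.card_univ] at h3
  rw [Fintype.card_sigma]
  omega

/-- Upper bound for the dimension of the variety of consistent subsystems. -/
theorem rk_genericSol_le {v : ∀ i, n i → K} {m : ∀ i, n i} (hm : ∀ i, v i (m i) ≠ 0)
    (c : (Σ i, n i) → Ω) (J : Finset κ) :
    rk k ((fun t => MvPolynomial.aeval c (genericSol v m t)) '' {t | t.1 ∈ J}) + J.card ≤
      rk k (ratios v J) + ∑ i ∈ J, Fintype.card (n i) := by
  have hA := (finite_normRatios v m J).image (algebraMap K Ω)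
  have hC : (c '' (J.biUnion (freeIdx m) : Finset _)).Finite := (Finset.finite_toSet _).image c
  have h1 : rk k ((fun t => MvPolynomial.aeval c (genericSol v m t)) '' {t | t.1 ∈ J}) ≤
      rk k (algebraMap K Ω '' normRatios v m J ∪ c '' (J.biUnion (freeIdx m) : Finset _)) := by
    refine rk_le_of_subset_acl (hA.union hC) ?_
    rintro _ ⟨⟨i, j⟩, ht, rfl⟩
    dsimp only
    by_cases hj : j = m i
    · subst hj
      rw [aeval_genericSol_self, ← mem_aclField]
      refine neg_mem (mem_aclField.2 (sum_mul_mem_acl _ _ _ (fun t h => ?_) fun t h => ?_))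
      · exact subset_acl _ (Or.inr ⟨t, Finset.mem_biUnion.2 ⟨i, ht, h⟩, rfl⟩)
      · refine subset_acl _ (Or.inl ⟨_, ⟨t, ?_, rfl⟩, rfl⟩)
        rw [Set.mem_ofPred_eq, (mem_freeIdx.1 h).1]
        exact ht
    · rw [aeval_genericSol_of_ne v m c (t := ⟨i, j⟩) hj]
      exact subset_acl _ (Or.inr ⟨⟨i, j⟩, Finset.mem_biUnion.2 ⟨i, ht, mem_freeIdx.2 ⟨rfl, hj⟩⟩,
        rfl⟩)
  have h2 := rk_union_le (k := k) hA hC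
  have h3 := rk_image_le (k := k) (J.biUnion (freeIdx m)) c
  have h4 : rk k (algebraMap K Ω '' normRatios v m J) = rk k (ratios v J) := by
    rw [← rk_normRatios hm]
    exact rk_image_eq (IsScalarTower.toAlgHom k K Ω) (finite_normRatios v m J)
  have h5 := card_biUnion_freeIdx m J
  omega

end GenericSystem

end TrRank

/-! ### Product structure of a variety with independent coordinates, and the count for two points.
-/

namespace TrRank

section Independent

variable {k Ω : Type*} [Field k] [Field Ω] [Algebra k Ω]

lemma isAlgebraic_of_isAlgebraic_adjoin {F G : IntermediateField k Ω} (hFG : F ≤ G) {T : Set Ω}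
    (hT : T ⊆ G) {x : Ω} (hx : IsAlgebraic (Algebra.adjoin F T) x) : IsAlgebraic G x := by
  have hle : Algebra.adjoin F T ≤ (IntermediateField.extendScalars hFG).toSubalgebra :=
    Algebra.adjoin_le fun x hx => hT hx
  exact IsAlgebraic.tower_top_of_subalgebra_le hle hx

/-- If some `y i` were algebraic over `S` and other members of the family, it could be dropped
without lowering the rank, and too few elements would remain to reach the bound. -/
lemma algebraicIndependent_aclField {η : Type*} [Fintype η] {S : Set Ω} (hS : S.Finite) (y : η → Ω)
    (h : rk k S + Fintype.card η ≤ rk k (S ∪ Set.range y)) :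
    AlgebraicIndependent (aclField k S) y := by
  classical
  refine algebraicIndependent_of_finite_type' (algebraMap (aclField k S) Ω).injective
    fun t ht _ i hi halg => ?_
  have hSt : aclField k S ≤ aclField k (S ∪ y '' t) := fun x hx =>
    mem_aclField.2 (acl_mono Set.subset_union_left (mem_aclField.1 hx))
  have hmem : y i ∈ acl k (S ∪ y '' t) :=
    mem_acl_of_isAlgebraic (isAlgebraic_of_isAlgebraic_adjoin hSt
      (fun x hx => mem_aclField.2 (subset_acl _ (Or.inr hx))) halg)
  have hsub : S ∪ Set.range y ⊆ acl k (S ∪ y '' (Finset.univ.erase i : Finset η)) := by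
    have hu : S ∪ y '' t ⊆ S ∪ y '' (Finset.univ.erase i : Finset η) := by
      refine Set.union_subset_union_right _ (Set.image_mono fun x hx => ?_)
      rw [Finset.mem_coe]
      exact Finset.mem_erase.2 ⟨fun h => hi (h ▸ hx), Finset.mem_univ _⟩
    refine Set.union_subset (Set.subset_union_left.trans (subset_acl _)) ?_
    rintro _ ⟨j, rfl⟩
    by_cases hj : j = i
    · subst hj
      exact acl_mono hu hmem
    · exact subset_acl _ (Or.inr ⟨j, Finset.mem_erase.2 ⟨hj, Finset.mem_univ _⟩, rfl⟩)
  have hfin : (y '' (Finset.univ.erase i : Finset η)).Finite := Set.toFinite _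
  have h1 := rk_le_of_subset_acl (hS.union hfin) hsub
  have h2 := rk_union_le (k := k) hS hfin
  have h3 := rk_image_le (k := k) (Finset.univ.erase i) y
  have h4 := Finset.card_erase_add_one (Finset.mem_univ i)
  rw [Finset.card_univ] at h4
  omega

/-- If the coordinates `w t` with `t ∉ J` are algebraically independent over the others, then the
variety with generic point `w` is a product with an affine space. -/
lemma eval_eq_zero_of_eqOn {ι : Type*} [Finite ι] (J : Set ι) (w : ι → Ω)
    (hw : AlgebraicIndependent (aclField k (w '' J)) (fun t : (Jᶜ : Set ι) => w t))
    {s t : ι → k} (hs : ∀ f, MvPolynomial.aeval w f = 0 → MvPolynomial.eval s f = 0)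
    (hst : Set.EqOn s t J) (f : MvPolynomial ι k) (hf : MvPolynomial.aeval w f = 0) :
    MvPolynomial.eval t f = 0 := by
  classical
  let R := MvPolynomial J k
  -- A relation is read as a polynomial in the variables outside `J` with coefficients in those of
  -- `J`. By independence the coefficients vanish at `w`, hence at `s`, and they see only
  -- coordinates where `s` and `t` agree.
  let Θ : MvPolynomial ι k →ₐ[k] MvPolynomial (Jᶜ : Set ι) R := MvPolynomial.aeval fun i =>
    if h : i ∈ J then MvPolynomial.C (MvPolynomial.X ⟨i, h⟩) else MvPolynomial.X ⟨i, h⟩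
  let χ : R →ₐ[k] aclField k (w '' J) := MvPolynomial.aeval fun i =>
    ⟨w i, mem_aclField.2 (subset_acl _ (Set.mem_image_of_mem w i.2))⟩
  have hχ : ∀ r : R, (χ r : Ω) = MvPolynomial.aeval w (MvPolynomial.rename Subtype.val r) := by
    intro r
    have : (IntermediateField.val _).comp χ =
        (MvPolynomial.aeval w).comp (MvPolynomial.rename Subtype.val) := by
      ext i
      simp [χ]
    exact DFunLike.congr_fun this r
  have h1 : MvPolynomial.map χ.toRingHom (Θ f) = 0 := by
    refine (algebraicIndependent_iff.1 hw) _ ?_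
    have : ((MvPolynomial.aeval (R := aclField k (w '' J)) fun t : (Jᶜ : Set ι) => w t).toRingHom.comp
        (MvPolynomial.map χ.toRingHom)).comp Θ.toRingHom =
        (MvPolynomial.aeval w : MvPolynomial ι k →ₐ[k] Ω).toRingHom := by
      refine MvPolynomial.ringHom_ext (fun r => ?_) fun i => ?_
      · simp [Θ, IsScalarTower.algebraMap_apply k R (MvPolynomial (Jᶜ : Set ι) R),
          MvPolynomial.algebraMap_eq]
      · by_cases h : i ∈ J
        · have : χ (MvPolynomial.X ⟨i, h⟩) = ⟨w i, _⟩ := MvPolynomial.aeval_X _ _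
          simp [Θ, h, this]
        · simp [Θ, h]
    have := DFunLike.congr_fun this f
    exact this.trans hf
  have h2 : MvPolynomial.map (MvPolynomial.eval fun i : J => s i) (Θ f) = 0 := by
    ext α
    rw [MvPolynomial.coeff_map, MvPolynomial.coeff_zero]
    have h3 : χ (MvPolynomial.coeff α (Θ f)) = 0 := by
      have := congrArg (MvPolynomial.coeff α) h1
      rw [MvPolynomial.coeff_map, MvPolynomial.coeff_zero] at this
      exact this
    have h4 := hs (MvPolynomial.rename Subtype.val (MvPolynomial.coeff α (Θ f)))
      (by rw [← hχ, h3]; rfl)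
    rw [MvPolynomial.eval_rename] at h4
    exact h4
  have h5 : ((MvPolynomial.eval fun i : (Jᶜ : Set ι) => t i).comp
      (MvPolynomial.map (MvPolynomial.eval fun i : J => s i))).comp Θ.toRingHom =
      MvPolynomial.eval t := by
    refine MvPolynomial.ringHom_ext (fun r => ?_) fun i => ?_
    · have : algebraMap k R r = MvPolynomial.C r := rfl
      simp [Θ, IsScalarTower.algebraMap_apply k R (MvPolynomial (Jᶜ : Set ι) R),
          MvPolynomial.algebraMap_eq, this]
    · by_cases h : i ∈ J
      · simp [Θ, h, hst h]
      · simp [Θ, h]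
  rw [← h5]
  change (MvPolynomial.eval fun i : (Jᶜ : Set ι) => t i) _ = 0
  exact (congrArg _ h2).trans (map_zero _)

end Independent

section Count

variable {k F κ : Type*} [Field k] [Field F] [Algebra k F] [Finite κ] [DecidableEq κ]
  {n : κ → Type*} [∀ i, Fintype (n i)] [∀ i, DecidableEq (n i)]

/-- The dimension count behind the fact that the generic consistent system over an essential
subcollection vanishes on one fibre only. -/
lemma false_of_two_points {a z u : ∀ i, n i → F} {m m' : ∀ i, n i} {J : Finset κ}
    {τ : Finset κ → ℕ} (ha : ∀ i, a i (m i) ≠ 0) (hz : ∀ i, z i (m' i) ≠ 0)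
    (hua : ∀ i ∈ J, ∑ j, u i j * a i j = 0) (huz : ∀ i ∈ J, ∑ j, u i j * z i j = 0)
    (h1 : ∀ I, rk k (normRatios a m I) = τ I) (h2 : rk k (normRatios z m' J) ≤ τ J)
    (h3 : ∀ I ⊂ J, τ J + I.card < τ I + J.card)
    (h4 : τ J + ∑ i ∈ J, Fintype.card (n i) ≤
      rk k ((fun t : Σ i, n i => u t.1 t.2) '' {t | t.1 ∈ J}) + J.card)
    {i₀ : κ} (hi₀ : i₀ ∈ J) {j₀ l₀ : n i₀} (hne : a i₀ j₀ * z i₀ l₀ ≠ a i₀ l₀ * z i₀ j₀) :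
    False := by
  classical
  -- These are the indices at which the two points have the same image in projective space.
  set A := J.filter fun i => ∀ j l, a i j * z i l = a i l * z i j with hA
  have hAJ : A ⊂ J := by
    refine ⟨Finset.filter_subset _ _, fun h => hne ?_⟩
    exact (Finset.mem_filter.1 (h hi₀)).2 j₀ l₀
  -- The expression is the coefficient vector of the second equation after the `m i`-th unknown is
  -- eliminated by the first. For `i ∈ J \ A` it is not zero, and `l i` serves as a second pivot;
  -- elsewhere the value `m i` is a dummy.
  have hd : ∀ i, ∃ l, i ∈ J \ A → z i l / z i (m' i) - z i (m i) / z i (m' i) *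
      (a i l / a i (m i)) ≠ 0 := by
    intro i
    by_cases hi : i ∈ J \ A
    · obtain ⟨hiJ, hiA⟩ := Finset.mem_sdiff.1 hi
      by_contra! hcon
      refine hiA (Finset.mem_filter.2 ⟨hiJ, fun j l => ?_⟩)
      have key : ∀ l, z i l = z i (m i) * (a i l / a i (m i)) := fun l => by
        have := sub_eq_zero.1 (hcon l).2
        have hz' := hz i
        field_simp at this ⊢
        exact this
      rw [key l, key j]
      ring
    · exact ⟨m i, fun h => (hi h).elim⟩
  choose l hl using hd
  set X := normRatios a m J
  set Z := normRatios z m' J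
  set U := normRatios a m A
  have hXf : X.Finite := finite_normRatios a m J
  have hZf : Z.Finite := finite_normRatios z m' J
  have hUf : U.Finite := finite_normRatios a m A
  have hUX : U ⊆ X := Set.image_mono fun t ht => hAJ.1 ht
  have hUZ : U ⊆ acl k Z := by
    rintro _ ⟨⟨i, j⟩, hi, rfl⟩
    obtain ⟨hiJ, hprop⟩ := Finset.mem_filter.1 hi
    refine ratios_subset_acl hz J ⟨i, hiJ, j, m i, ?_⟩
    have h5 : z i (m i) ≠ 0 := by
      intro h0
      have := hprop (m i) (m' i)
      rw [h0, mul_zero] at this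
      exact mul_ne_zero (ha i) (hz i) this
    have := ha i
    have h6 := hprop j (m i)
    dsimp only
    field_simp
    linear_combination h6
  -- The ratios with index in `A` are algebraic over either point, so the pair has rank at most 2τ_J
  -- - τ_A.
  have hrk := rk_add_rk_union_le (k := k) hXf hZf hUf (hUX.trans (subset_acl _)) hUZ
  -- These are the unknowns left free: one pivot is removed for `i ∈ A`, two for `i ∈ J \ A`.
  set G : Finset (Σ i, n i) := J.biUnion fun i =>
    if i ∈ A then freeIdx m i else (freeIdx m i).erase ⟨i, l i⟩ with hG
  have hlm : ∀ i ∈ J \ A, l i ≠ m i := by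
    intro i hi h0
    have := hl i hi
    rw [h0, div_self (ha i), mul_one, sub_self] at this
    exact this rfl
  have hGcard : G.card + 2 * J.card ≤ ∑ i ∈ J, Fintype.card (n i) + A.card := by
    have e1 : G.card ≤ _ := Finset.card_biUnion_le
    have e2 : A.card = ∑ i ∈ J, if i ∈ A then 1 else 0 := by
      rw [Finset.sum_boole, Nat.cast_id]
      congr 1
      ext i
      simp only [Finset.mem_filter]
      exact ⟨fun h => ⟨hAJ.1 h, h⟩, fun h => h.2⟩
    have e3 : ∀ i ∈ J, (if i ∈ A then freeIdx m i else (freeIdx m i).erase ⟨i, l i⟩).card + 2 =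
        Fintype.card (n i) + if i ∈ A then 1 else 0 := by
      intro i hi
      have := card_freeIdx m i
      by_cases hiA : i ∈ A
      · simp only [hiA, if_true]
        omega
      · simp only [hiA, if_false]
        have := Finset.card_erase_add_one (mem_freeIdx.2
          ⟨rfl, hlm i (Finset.mem_sdiff.2 ⟨hi, hiA⟩)⟩ : (⟨i, l i⟩ : Σ i, n i) ∈ freeIdx m i)
        omega
    have e4 := Finset.sum_congr (rfl : J = J) e3
    rw [Finset.sum_add_distrib, Finset.sum_add_distrib, ← e2, Finset.sum_const, smul_eq_mul] at e4
    omega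
  set uf : (Σ i, n i) → F := fun t => u t.1 t.2 with huf
  set V := X ∪ Z ∪ uf '' G
  have hVf : V.Finite := (hXf.union hZf).union (G.finite_toSet.image uf)
  have hmem : uf '' {t | t.1 ∈ J} ⊆ acl k V := by
    have hα : ∀ i ∈ J, ∀ j, a i j / a i (m i) ∈ aclField k V := fun i hi j =>
      mem_aclField.2 (subset_acl _ (Or.inl (Or.inl ⟨⟨i, j⟩, hi, rfl⟩)))
    have hζ : ∀ i ∈ J, ∀ j, z i j / z i (m' i) ∈ aclField k V := fun i hi j =>
      mem_aclField.2 (subset_acl _ (Or.inl (Or.inr ⟨⟨i, j⟩, hi, rfl⟩)))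
    have hu : ∀ t ∈ G, uf t ∈ aclField k V := fun t ht =>
      mem_aclField.2 (subset_acl _ (Or.inr ⟨t, ht, rfl⟩))
    have hsa : ∀ i ∈ J, ∑ j, u i j * (a i j / a i (m i)) = 0 := fun i hi => by
      simp_rw [← mul_div_assoc, ← Finset.sum_div, hua i hi, zero_div]
    have hsz : ∀ i ∈ J, ∑ j, u i j * (z i j / z i (m' i)) = 0 := fun i hi => by
      simp_rw [← mul_div_assoc, ← Finset.sum_div, huz i hi, zero_div]
    have hne : ∀ i ∈ J, ∀ j, j ≠ m i → u i j ∈ aclField k V := by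
      intro i hi j hj
      by_cases hiA : i ∈ A
      · refine hu ⟨i, j⟩ (Finset.mem_biUnion.2 ⟨i, hi, ?_⟩)
        rw [if_pos hiA]
        exact mem_freeIdx.2 ⟨rfl, hj⟩
      · have hiJA : i ∈ J \ A := Finset.mem_sdiff.2 ⟨hi, hiA⟩
        have hG' : ∀ j, j ≠ m i → j ≠ l i → u i j ∈ aclField k V := fun j hj hjl => by
          refine hu ⟨i, j⟩ (Finset.mem_biUnion.2 ⟨i, hi, ?_⟩)
          rw [if_neg hiA]
          refine Finset.mem_erase.2 ⟨fun h => hjl ?_, mem_freeIdx.2 ⟨rfl, hj⟩⟩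
          cases h
          rfl
        by_cases hjl : j = l i
        · subst hjl
          set δ : n i → F := fun j => z i j / z i (m' i) - z i (m i) / z i (m' i) *
            (a i j / a i (m i)) with hδ
          have hsum : ∑ j, u i j * δ j = 0 := by
            simp_rw [hδ, mul_sub, Finset.sum_sub_distrib, hsz i hi, mul_left_comm (u i _),
              ← Finset.mul_sum, hsa i hi, mul_zero, sub_zero]
          have hδm : δ (m i) = 0 := by
            simp only [hδ, div_self (ha i), mul_one, sub_self]
          rw [← Finset.add_sum_erase _ _ (Finset.mem_univ (l i))] at hsum
          have h5 : u i (l i) * δ (l i) ∈ aclField k V := by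
            rw [eq_neg_of_add_eq_zero_left hsum]
            refine neg_mem (sum_mem fun j hj => ?_)
            by_cases hjm : j = m i
            · rw [hjm, hδm, mul_zero]
              exact zero_mem _
            · exact mul_mem (hG' j hjm (Finset.ne_of_mem_erase hj))
                (sub_mem (hζ i hi j) (mul_mem (hζ i hi _) (hα i hi j)))
          have h6 := div_mem h5 (sub_mem (hζ i hi (l i)) (mul_mem (hζ i hi (m i)) (hα i hi (l i))))
          rwa [mul_div_cancel_right₀ _ (hl i hiJA)] at h6
        · exact hG' j hj hjl
    rintro _ ⟨⟨i, j⟩, hi, rfl⟩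
    rw [← mem_aclField]
    by_cases hj : j = m i
    · subst hj
      have := hsa i hi
      rw [← Finset.add_sum_erase _ _ (Finset.mem_univ (m i)), div_self (ha i), mul_one] at this
      change u i (m i) ∈ _
      rw [eq_neg_of_add_eq_zero_left this]
      exact neg_mem (sum_mem fun j hj =>
        mul_mem (hne i hi j (Finset.ne_of_mem_erase hj)) (hα i hi j))
    · exact hne i hi j hj
  have h5 := rk_le_of_subset_acl hVf hmem
  have h6 : rk k V ≤ rk k (X ∪ Z) + rk k (uf '' G) :=
    rk_union_le (hXf.union hZf) (G.finite_toSet.image uf)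
  have h7 := rk_image_le (k := k) G uf
  -- The inequalities combine to τ_A - |A| ≤ τ_J - |J|, which `h3` excludes for the proper subset
  -- `A`.
  have h8 := h3 A hAJ
  have h9 : rk k U = τ A := h1 A
  have h10 : rk k X = τ J := h1 J
  omega

end Count

end TrRank

/-! ### Chart systems and generic uniqueness of the image point. -/

namespace TrRank

universe u

/-- Take a prime containing `I` and disjoint from `S`, and the fraction field of the quotient by it.
-/
lemma exists_algHom_field {k : Type*} {T : Type u} [Field k] [CommRing T] [Algebra k T] (I : Ideal T)
    (S : Submonoid T) (h : Disjoint (I : Set T) S) :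
    ∃ (F : Type u) (_ : Field F) (_ : Algebra k F) (q : T →ₐ[k] F), (∀ t ∈ I, q t = 0) ∧
      ∀ t ∈ S, q t ≠ 0 := by
  obtain ⟨Q, hQ, hIQ, hQS⟩ := Ideal.exists_le_prime_disjoint I S h
  let q : T →ₐ[k] FractionRing (T ⧸ Q) :=
    (IsScalarTower.toAlgHom k (T ⧸ Q) (FractionRing (T ⧸ Q))).comp (Ideal.Quotient.mkₐ k Q)
  have hq : ∀ t, q t = 0 ↔ t ∈ Q := fun t => by
    change algebraMap (T ⧸ Q) (FractionRing (T ⧸ Q)) (Ideal.Quotient.mk Q t) = 0 ↔ _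
    rw [map_eq_zero_iff _ (IsFractionRing.injective _ _), Ideal.Quotient.eq_zero_iff_mem]
  exact ⟨_, inferInstance, inferInstance, q, fun t ht => (hq t).2 (hIQ ht),
    fun t ht h0 => Set.disjoint_left.1 hQS ((hq t).1 h0) ht⟩

/-- The function field, the affine charts, and the homogeneous coordinates of the Kodaira maps of a
finite collection of linear series with chosen bases. -/
structure ChartSystem (k K : Type) [Field k] [Field K] [Algebra k K] {κ : Type} (n : κ → Type)
    where
  /-- the homogeneous coordinates at the generic point -/
  v : ∀ i, n i → K
  /-- index set of the affine cover -/
  β : Type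
  finite : Finite β
  nonempty : Nonempty β
  /-- the coordinate rings of the charts -/
  A : β → Subalgebra k K
  fg : ∀ b, (A b).FG
  /-- the basis sections in the trivialization over a chart -/
  σ : ∀ b i, n i → A b
  smul : ∀ b i, ∃ l : K, l ≠ 0 ∧ ∀ j, (σ b i j : K) = l * v i j
  span : ∀ b i, Ideal.span (Set.range (σ b i)) = ⊤

namespace ChartSystem

variable {k K : Type} [Field k] [Field K] [Algebra k K] {κ : Type} {n : κ → Type}

section Basic

variable (C : ChartSystem k K n)

lemma exists_map_ne_zero {b : C.β} {F : Type*} [Field F] [Algebra k F] (x : C.A b →ₐ[k] F) (i : κ) :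
    ∃ j, x (C.σ b i j) ≠ 0 := by
  by_contra! h
  have : Ideal.span (Set.range (C.σ b i)) ≤ RingHom.ker x.toRingHom := by
    rw [Ideal.span_le]
    rintro _ ⟨j, rfl⟩
    exact h j
  rw [C.span b i, top_le_iff] at this
  exact RingHom.ker_ne_top x.toRingHom this

lemma exists_v_ne_zero (i : κ) : ∃ j, C.v i j ≠ 0 := by
  obtain ⟨b⟩ := C.nonempty
  obtain ⟨l, -, hl⟩ := C.smul b i
  obtain ⟨j, hj⟩ := C.exists_map_ne_zero (b := b) (C.A b).val i
  refine ⟨j, fun h => hj ?_⟩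
  rw [Subalgebra.coe_val, hl, h, mul_zero]

lemma ratios_σ (b : C.β) (I : Finset κ) : ratios (fun i j => (C.σ b i j : K)) I = ratios C.v I :=
  ratios_eq_of_smul (C.smul b) I

variable [∀ i, Fintype (n i)]

/-- The point `x` of the chart `b` is a zero of the equations of the system `s` with index
in `J`. -/
def IsZero (s : (Σ i, n i) → k) {b : C.β} (x : C.A b →ₐ[k] k) (J : Finset κ) : Prop :=
  ∀ i ∈ J, ∑ j, s ⟨i, j⟩ * x (C.σ b i j) = 0

/-- The Kodaira maps with index in `J` agree at two points. -/
def SameImage {b : C.β} (x : C.A b →ₐ[k] k) {b' : C.β} (x' : C.A b' →ₐ[k] k)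
    (J : Finset κ) : Prop :=
  ∀ i ∈ J, ∀ j l, x (C.σ b i j) * x' (C.σ b' i l) = x (C.σ b i l) * x' (C.σ b' i j)

/-- As the `c t` are independent, a relation of the generic solution is an identity in the free
coefficients and survives every substitution. -/
lemma aeval_solution_eq_zero [∀ i, DecidableEq (n i)] {Ω : Type*} [Field Ω] [Algebra k Ω]
    [Algebra K Ω] [IsScalarTower k K Ω]
    {m : ∀ i, n i} (hm : ∀ i, C.v i (m i) ≠ 0) {c : (Σ i, n i) → Ω}
    (hc : AlgebraicIndependent K c) {f : MvPolynomial (Σ i, n i) k}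
    (hf : MvPolynomial.aeval (fun t => MvPolynomial.aeval c (genericSol C.v m t)) f = 0)
    {s : (Σ i, n i) → K} (hs : ∀ i, ∑ j, s ⟨i, j⟩ * C.v i j = 0) : MvPolynomial.aeval s f = 0 := by
  have h1 : MvPolynomial.aeval (genericSol C.v m) f = 0 := by
    refine hc ?_
    rw [map_zero]
    have : ((MvPolynomial.aeval c : MvPolynomial _ K →ₐ[K] Ω).restrictScalars k).comp
        (MvPolynomial.aeval (genericSol C.v m)) =
        MvPolynomial.aeval (fun t => MvPolynomial.aeval c (genericSol C.v m t)) := by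
      ext t; simp
    rw [← hf, ← this]
    rfl
  have h2 : ((MvPolynomial.aeval s : MvPolynomial _ K →ₐ[K] K).restrictScalars k).comp
      (MvPolynomial.aeval (genericSol C.v m)) = MvPolynomial.aeval s := by
    ext t
    rw [AlgHom.comp_apply, MvPolynomial.aeval_X, MvPolynomial.aeval_X]
    exact eval_genericSol hm hs t
  rw [← h2, AlgHom.comp_apply, h1, map_zero]

/-- A system that vanishes at one closed point is lifted to a solution over the whole chart; the
relation holds for the lift and specializes back to `s` at `x`. -/
lemma eval_eq_zero_of_isZero [Fintype κ] [∀ i, DecidableEq (n i)] {Ω : Type*} [Field Ω]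
    [Algebra k Ω] [Algebra K Ω] [IsScalarTower k K Ω]
    {m : ∀ i, n i} (hm : ∀ i, C.v i (m i) ≠ 0) {c : (Σ i, n i) → Ω}
    (hc : AlgebraicIndependent K c) {f : MvPolynomial (Σ i, n i) k}
    (hf : MvPolynomial.aeval (fun t => MvPolynomial.aeval c (genericSol C.v m t)) f = 0)
    {s : (Σ i, n i) → k} {b : C.β} (x : C.A b →ₐ[k] k) (hs : C.IsZero s x Finset.univ) :
    MvPolynomial.eval s f = 0 := by
  choose l hl using C.exists_map_ne_zero x
  -- The system is scaled by a coordinate that is invertible at `x`, and the entry `l` is corrected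
  -- by the value of the equation itself, which vanishes at `x`. The result solves the equations
  -- identically and equals `s` at `x`.
  let t : (Σ i, n i) → C.A b := fun p => algebraMap k (C.A b) (x (C.σ b p.1 (l p.1)))⁻¹ *
    (C.σ b p.1 (l p.1) * algebraMap k (C.A b) (s p) -
      if p.2 = l p.1 then ∑ j, algebraMap k (C.A b) (s ⟨p.1, j⟩) * C.σ b p.1 j else 0)
  have ht : ∀ p, x (t p) = s p := by
    intro p
    have h0 : x (if p.2 = l p.1 then ∑ j, algebraMap k (C.A b) (s ⟨p.1, j⟩) * C.σ b p.1 j else 0)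
        = 0 := by
      split_ifs
      · rw [map_sum]
        simp_rw [map_mul, AlgHom.commutes]
        exact hs p.1 (Finset.mem_univ _)
      · exact map_zero x
    simp only [t, map_mul, map_sub, AlgHom.commutes, h0, sub_zero]
    exact inv_mul_cancel_left₀ (hl p.1) _
  have hsol : ∀ i, ∑ j, t ⟨i, j⟩ * C.σ b i j = 0 := by
    intro i
    simp only [t, mul_assoc, ← Finset.mul_sum, sub_mul, Finset.sum_sub_distrib, ite_mul, zero_mul]
    rw [Finset.sum_ite_eq' Finset.univ (l i), if_pos (Finset.mem_univ _), mul_comm (Finset.sum _ _),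
      sub_self, mul_zero]
  have hsolK : ∀ i, ∑ j, (t ⟨i, j⟩ : K) * C.v i j = 0 := by
    intro i
    obtain ⟨r, hr0, hr⟩ := C.smul b i
    have h1 := congrArg (C.A b).val (hsol i)
    simp only [map_sum, map_mul, map_zero, Subalgebra.coe_val, hr] at h1
    refine (mul_eq_zero_iff_left hr0).1 ?_
    rw [← h1, Finset.mul_sum]
    exact Finset.sum_congr rfl fun j _ => by ring
  have h1 := C.aeval_solution_eq_zero hm hc hf (s := fun p => (t p : K)) hsolK
  have h2 : MvPolynomial.aeval t f = 0 := by
    apply Subtype.val_injective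
    have : (C.A b).val.comp (MvPolynomial.aeval t) =
        MvPolynomial.aeval (fun p => (t p : K)) := by
      ext p; simp
    rw [← this] at h1
    exact h1
  have h3 : x.comp (MvPolynomial.aeval t) = MvPolynomial.aeval s := by
    ext p
    simp [ht]
  have h4 := congrArg x h2
  rw [map_zero, ← AlgHom.comp_apply, h3] at h4
  exact h4

end Basic

section BadLocus

variable (C : ChartSystem k K n) [∀ i, Fintype (n i)] [∀ i, DecidableEq (n i)] [Fintype κ]
  [DecidableEq κ]

/-- Over no field there are a generic solution with respect to one chart and a zero in another chart
with different image under the Kodaira maps. -/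
lemma false_of_generic_points {Ω : Type*} [Field Ω] [Algebra k Ω] [Algebra K Ω]
    [IsScalarTower k K Ω] {m : ∀ i, n i} {c : (Σ i, n i) → Ω} {J : Finset κ}
    (h3 : ∀ I ⊂ J, rk k (ratios C.v J) + I.card < rk k (ratios C.v I) + J.card)
    (h4 : rk k (ratios C.v J) + ∑ i ∈ J, Fintype.card (n i) ≤
      rk k ((fun t => MvPolynomial.aeval c (genericSol C.v m t)) '' {t | t.1 ∈ J}) + J.card)
    {B : Subalgebra k Ω} {b : C.β} (x : C.A b →ₐ[k] B) (hx : Function.Injective x)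
    (w : (Σ i, n i) → B) (hw : ∀ t, (w t : Ω) = MvPolynomial.aeval c (genericSol C.v m t))
    (hwx : ∀ i, ∑ j, w ⟨i, j⟩ * x (C.σ b i j) = 0)
    {F : Type*} [Field F] [Algebra k F] (y : B →ₐ[k] F) (hy : Function.Injective y)
    {b' : C.β} (x' : C.A b' →ₐ[k] F)
    (hx' : ∀ i ∈ J, ∑ j, y (w ⟨i, j⟩) * x' (C.σ b' i j) = 0) {i₀ : κ} (hi₀ : i₀ ∈ J)
    {j₀ l₀ : n i₀} (hne : y (x (C.σ b i₀ j₀)) * x' (C.σ b' i₀ l₀) ≠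
      y (x (C.σ b i₀ l₀)) * x' (C.σ b' i₀ j₀)) : False := by
  choose m₁ hm₁ using C.exists_map_ne_zero (y.comp x)
  choose m' hm' using C.exists_map_ne_zero x'
  have hyx : Function.Injective (y.comp x) := hy.comp hx
  refine false_of_two_points (k := k) (a := fun i j => y.comp x (C.σ b i j))
    (z := fun i j => x' (C.σ b' i j))
    (u := fun i j => y (w ⟨i, j⟩)) (m := m₁) (m' := m') (J := J) (τ := fun I => rk k (ratios C.v I))
    hm₁ hm' (fun i _ => ?_) hx' (fun I => ?_) ?_ h3 (h4.trans ?_) hi₀ hne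
  · have := congrArg y (hwx i)
    simp only [map_sum, map_mul, map_zero] at this
    exact this
  -- Since `y ∘ x` is injective, the first point is still generic over `F`, and specialization in
  -- both directions gives equal ranks.
  · refine le_antisymm ?_ ?_
    · have := rk_normRatios_le (k := k) (y.comp x) (C.A b).val Subtype.val_injective
        (C.σ b) m₁ hm₁ I
      rw [← C.ratios_σ b]
      exact this
    · have h0 : ∀ i, (C.A b).val (C.σ b i (m₁ i)) ≠ 0 := fun i h0 => hm₁ i <| by
        have : C.σ b i (m₁ i) = 0 := Subtype.val_injective h0
        rw [this, map_zero]
      have := rk_normRatios_le (k := k) (C.A b).val (y.comp x) hyx (C.σ b) m₁ h0 I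
      rw [← C.ratios_σ b, ← rk_normRatios (v := fun i j => (C.σ b i j : K)) h0]
      refine this.trans ?_
      rw [← rk_normRatios (v := fun i j => (y.comp x) (C.σ b i j)) hm₁]
  · have := rk_normRatios_le (k := k) x' (C.A b').val Subtype.val_injective (C.σ b') m' hm' J
    rw [← C.ratios_σ b']
    exact this
  · have := rk_image_le_rk_image (k := k) B.val y hy (S := w '' {t | t.1 ∈ J})
      ((Set.toFinite _).image _)
    rw [Set.image_image, Set.image_image] at this
    simp only [Subalgebra.coe_val, hw] at this
    exact Nat.add_le_add_right this _

open TensorProduct in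
-- This spreads `false_of_generic_points` out to closed points. In the tensor product let `I` be
-- generated by the equations in `J` and let `μ` be the minor in question. If `r * μ ^ N ∈ I` with
-- `r ≠ 0`, the minor vanishes at all common zeros where `r` does not. Otherwise some prime contains
-- `I` and avoids `μ` and all nonzero elements of `B`, which gives the excluded pair of points over
-- a field.
lemma exists_ne_zero_of_generic {Ω : Type*} [Field Ω] [Algebra k Ω] [Algebra K Ω]
    [IsScalarTower k K Ω] {m : ∀ i, n i} {c : (Σ i, n i) → Ω} {J : Finset κ}
    (h3 : ∀ I ⊂ J, rk k (ratios C.v J) + I.card < rk k (ratios C.v I) + J.card)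
    (h4 : rk k (ratios C.v J) + ∑ i ∈ J, Fintype.card (n i) ≤
      rk k ((fun t => MvPolynomial.aeval c (genericSol C.v m t)) '' {t | t.1 ∈ J}) + J.card)
    {B : Subalgebra k Ω} {b : C.β} (x : C.A b →ₐ[k] B) (hx : Function.Injective x)
    (w : (Σ i, n i) → B) (hw : ∀ t, (w t : Ω) = MvPolynomial.aeval c (genericSol C.v m t))
    (hwx : ∀ i, ∑ j, w ⟨i, j⟩ * x (C.σ b i j) = 0) (b' : C.β) {i₀ : κ} (hi₀ : i₀ ∈ J)
    (j₀ l₀ : n i₀) : ∃ r : B, r ≠ 0 ∧ ∀ (h : B →ₐ[k] k) (x' : C.A b' →ₐ[k] k), h r ≠ 0 →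
      C.IsZero (fun t => h (w t)) x' J →
      h (x (C.σ b i₀ j₀)) * x' (C.σ b' i₀ l₀) = h (x (C.σ b i₀ l₀)) * x' (C.σ b' i₀ j₀) := by
  let T := C.A b' ⊗[k] B
  let I : Ideal T := Ideal.span
    ((fun i => ∑ j, C.σ b' i j ⊗ₜ[k] w ⟨i, j⟩) '' J)
  let μ : T := C.σ b' i₀ l₀ ⊗ₜ[k] x (C.σ b i₀ j₀) - C.σ b' i₀ j₀ ⊗ₜ[k] x (C.σ b i₀ l₀)
  let ir : B →ₐ[k] T := Algebra.TensorProduct.includeRight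
  let il : C.A b' →ₐ[k] T := Algebra.TensorProduct.includeLeft
  have hil : ∀ a r, (a ⊗ₜ[k] r : T) = il a * ir r := fun a r => by
    change a ⊗ₜ[k] r = (a ⊗ₜ[k] (1 : B)) * ((1 : C.A b') ⊗ₜ[k] r)
    rw [Algebra.TensorProduct.tmul_mul_tmul, one_mul, mul_one]
  by_cases hex : ∃ r : B, r ≠ 0 ∧ ∃ N : ℕ, ir r * μ ^ N ∈ I
  · obtain ⟨r, hr, N, hN⟩ := hex
    refine ⟨r, hr, fun h x' hhr hz => ?_⟩
    let ψ : T →ₐ[k] k := Algebra.TensorProduct.lift x' h fun _ _ => Commute.all _ _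
    have hψ : ∀ a r, ψ (a ⊗ₜ[k] r) = x' a * h r := fun a r =>
      Algebra.TensorProduct.lift_tmul _ _ _ _ _
    have hI : I ≤ RingHom.ker ψ.toRingHom := by
      rw [Ideal.span_le]
      rintro _ ⟨i, hi, rfl⟩
      change ψ _ = 0
      rw [map_sum, ← hz i hi]
      exact Finset.sum_congr rfl fun j _ => by rw [hψ, mul_comm]
    have h1 : ψ (ir r * μ ^ N) = 0 := hI hN
    have h2 : ψ (ir r) = h r := by
      change ψ (1 ⊗ₜ[k] r) = _
      rw [hψ, map_one, one_mul]
    rw [map_mul, map_pow, h2, mul_eq_zero, or_iff_right hhr] at h1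
    have h5 := eq_zero_of_pow_eq_zero h1
    rw [map_sub, hψ, hψ, sub_eq_zero] at h5
    rw [mul_comm, h5, mul_comm]
  · exfalso
    push Not at hex
    let S : Submonoid T := (nonZeroDivisors B).map (ir : B →* T) ⊔ Submonoid.powers μ
    have hdis : Disjoint (I : Set T) S := by
      rw [Set.disjoint_left]
      intro t htI htS
      obtain ⟨_, ⟨r, hr, rfl⟩, _, ⟨N, rfl⟩, rfl⟩ := Submonoid.mem_sup.1 htS
      exact hex r (nonZeroDivisors.ne_zero hr) N htI
    obtain ⟨F, _, _, q, hqI, hqS⟩ := exists_algHom_field (k := k) I S hdis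
    refine C.false_of_generic_points h3 h4 x hx w hw hwx (q.comp ir) ?_ (q.comp il) ?_ hi₀
      (j₀ := j₀) (l₀ := l₀) ?_
    · rw [injective_iff_map_eq_zero]
      intro r hr
      by_contra hr0
      exact hqS (ir r) (Submonoid.mem_sup_left ⟨r, mem_nonZeroDivisors_of_ne_zero hr0, rfl⟩) hr
    · intro i hi
      have h1 : q (∑ j, C.σ b' i j ⊗ₜ[k] w ⟨i, j⟩) = 0 :=
        hqI _ (Ideal.subset_span ⟨i, hi, rfl⟩)
      rw [map_sum] at h1
      rw [← h1]
      refine Finset.sum_congr rfl fun j _ => ?_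
      rw [hil, map_mul, mul_comm]
      rfl
    · intro h0
      refine hqS μ (Submonoid.mem_sup_right (Submonoid.mem_powers μ)) ?_
      change q (_ - _) = 0
      rw [map_sub, hil, hil, map_mul, map_mul, sub_eq_zero]
      rw [mul_comm, mul_comm (q (il _))]
      exact h0

end BadLocus

end ChartSystem

end TrRank

/-! ### The generic point of the consistency variety. -/

namespace TrRank

/-- The algebra `D` is the localization `B[1/r]`, whose points are the points of `B` at which `r`
does not vanish. -/
lemma exists_fg_inv_mem {k Ω : Type*} [Field k] [Field Ω] [Algebra k Ω] {B : Subalgebra k Ω}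
    (hB : B.FG) {r : B} (hr : r ≠ 0) : ∃ (D : Subalgebra k Ω) (hBD : B ≤ D), D.FG ∧
      (r : Ω)⁻¹ ∈ D ∧
      ∀ {F : Type*} [Field F] [Algebra k F] (h : D →ₐ[k] F), h (Subalgebra.inclusion hBD r) ≠ 0 := by
  refine ⟨B ⊔ Algebra.adjoin k {(r : Ω)⁻¹}, le_sup_left,
    hB.sup ⟨{(r : Ω)⁻¹}, by rw [Finset.coe_singleton]⟩, ?_, ?_⟩
  · exact (le_sup_right : _ ≤ B ⊔ _) (Algebra.subset_adjoin rfl)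
  · intro F _ _ h h0
    have hr' : (r : Ω) ≠ 0 := fun h => hr (Subtype.ext h)
    let D := B ⊔ Algebra.adjoin k {(r : Ω)⁻¹}
    let ri : D := ⟨(r : Ω)⁻¹, (le_sup_right : _ ≤ D) (Algebra.subset_adjoin rfl)⟩
    have h1 : Subalgebra.inclusion (le_sup_left : B ≤ D) r * ri = 1 :=
      Subtype.ext (mul_inv_cancel₀ hr')
    have h2 := congrArg h h1
    rw [map_mul, h0, zero_mul, map_one] at h2
    exact zero_ne_one h2

namespace ChartSystem

variable {k K : Type} [Field k] [Field K] [Algebra k K] {κ : Type} {n : κ → Type}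
  (C : ChartSystem k K n) [∀ i, Fintype (n i)] [Fintype κ]

/-- The structure of the consistency variety of a collection with essential subcollection `J`: its
generic point lies over a single point of the image of the Kodaira map `Φ_J`, and it is a product
with an affine space. -/
theorem exists_generic [IsAlgClosed k] {J : Finset κ}
    (h1 : ∀ I, rk k (ratios C.v J) + I.card ≤ rk k (ratios C.v I) + J.card)
    (h3 : ∀ I ⊂ J, rk k (ratios C.v J) + I.card < rk k (ratios C.v I) + J.card) :
    ∃ (p : Ideal (MvPolynomial (Σ i, n i) k)) (g : MvPolynomial (Σ i, n i) k), g ∉ p ∧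
      (∀ f, f ∈ p ↔ ∀ (s : (Σ i, n i) → k) (b : C.β) (x : C.A b →ₐ[k] k),
        C.IsZero s x Finset.univ → MvPolynomial.eval s f = 0) ∧
      (∀ s : (Σ i, n i) → k, (∀ f ∈ p, MvPolynomial.eval s f = 0) → MvPolynomial.eval s g ≠ 0 →
        ∃ (b : C.β) (x : C.A b →ₐ[k] k), C.IsZero s x Finset.univ ∧
          ∀ (b' : C.β) (x' : C.A b' →ₐ[k] k), C.IsZero s x' J → C.SameImage x x' J) ∧
      ∀ s t : (Σ i, n i) → k, (∀ f ∈ p, MvPolynomial.eval s f = 0) →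
        (∀ i ∈ J, ∀ j, s ⟨i, j⟩ = t ⟨i, j⟩) → ∀ f ∈ p, MvPolynomial.eval t f = 0 := by
  classical
  have := C.finite
  have := Fintype.ofFinite C.β
  obtain ⟨b⟩ := C.nonempty
  choose m hm using C.exists_v_ne_zero
  let Ω := FractionRing (MvPolynomial (Σ i, n i) K)
  let c : (Σ i, n i) → Ω := fun t =>
    algebraMap (MvPolynomial (Σ i, n i) K) Ω (MvPolynomial.X t)
  have hc : AlgebraicIndependent K c :=
    (MvPolynomial.algebraicIndependent_X (Σ i, n i) K).map'
      (f := IsScalarTower.toAlgHom K _ Ω) (IsFractionRing.injective _ _)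
  have : Infinite k := IsAlgClosed.instInfinite
  let w' : (Σ i, n i) → Ω := fun t => MvPolynomial.aeval c (genericSol C.v m t)
  let JJ : Set (Σ i, n i) := {t | t.1 ∈ J}
  have hcard : Fintype.card (Σ i, n i) =
      ∑ i ∈ J, Fintype.card (n i) + Fintype.card (JJᶜ : Set (Σ i, n i)) := by
    have e1 : Fintype.card JJ = ∑ i ∈ J, Fintype.card (n i) := by
      rw [Fintype.card_subtype]
      have : (Finset.univ.filter fun t => t ∈ JJ) = J.sigma fun i => (Finset.univ : Finset (n i)) := by
        ext t
        simp [JJ]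
      rw [this, Finset.card_sigma]
      simp
    rw [← e1, Fintype.card_compl_set]
    have := set_fintype_card_le_univ JJ
    omega
  have hrange : Set.range w' = w' '' JJ ∪ Set.range (fun t : (JJᶜ : Set (Σ i, n i)) => w' t) := by
    rw [← Set.image_univ, ← Set.union_compl_self JJ, Set.image_union]
    congr 1
    ext; simp
  have hfin : (w' '' JJ).Finite := (Set.toFinite _).image _
  have hr1 : rk k (Set.range w') ≤ rk k (w' '' JJ) + Fintype.card (JJᶜ : Set (Σ i, n i)) := by
    rw [hrange]
    refine (rk_union_le hfin (Set.finite_range _)).trans ?_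
    gcongr
    have := rk_image_le (k := k) Finset.univ (fun t : (JJᶜ : Set (Σ i, n i)) => w' t)
    rwa [Finset.coe_univ, Set.image_univ, Finset.card_univ] at this
  have hr2 : rk k (w' '' JJ) + J.card ≤ rk k (ratios C.v J) + ∑ i ∈ J, Fintype.card (n i) :=
    rk_genericSol_le hm c J
  -- The lower bound for the whole solution, the minimality of def(E_J), and the bounds `hr1` and
  -- `hr2` force equality throughout. So the part in `J` has the expected rank, and the remaining
  -- coordinates are independent over it.
  obtain ⟨I, hI⟩ := le_rk_genericSol (k := k) hm hc
  change _ ≤ rk k (Set.range w') + I.card at hI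
  have hI' := h1 I
  have h4 : rk k (ratios C.v J) + ∑ i ∈ J, Fintype.card (n i) ≤ rk k (w' '' JJ) + J.card := by
    omega
  have hind : AlgebraicIndependent (aclField k (w' '' JJ))
      (fun t : (JJᶜ : Set (Σ i, n i)) => w' t) := by
    refine algebraicIndependent_aclField hfin _ ?_
    rw [← hrange]
    omega
  let ιK : K →ₐ[k] Ω := IsScalarTower.toAlgHom k K Ω
  -- This is the coordinate ring of an affine model of the incidence variety of pairs of a point of
  -- the chart `b` and a system vanishing there.
  let B : Subalgebra k Ω := (C.A b).map ιK ⊔ Algebra.adjoin k (Set.range w')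
  have hB : B.FG := ((C.fg b).map ιK).sup
    ⟨(Set.finite_range w').toFinset, by rw [Set.Finite.coe_toFinset]⟩
  let x : C.A b →ₐ[k] B := (ιK.comp (C.A b).val).codRestrict B fun a =>
    (le_sup_left : _ ≤ B) ⟨a, a.2, rfl⟩
  have hx : Function.Injective x := fun a a' h =>
    Subtype.ext ((algebraMap K Ω).injective (congrArg Subtype.val h))
  let w : (Σ i, n i) → B := fun t =>
    ⟨w' t, (le_sup_right : _ ≤ B) (Algebra.subset_adjoin ⟨t, rfl⟩)⟩
  have hwx : ∀ i, ∑ j, w ⟨i, j⟩ * x (C.σ b i j) = 0 := by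
    intro i
    obtain ⟨l, -, hl⟩ := C.smul b i
    apply Subtype.val_injective
    have h5 := congrArg (MvPolynomial.aeval c) (sum_genericSol_mul hm i)
    rw [map_sum, map_zero] at h5
    change B.val _ = B.val 0
    rw [map_sum, map_zero]
    have : ∀ j, B.val (w ⟨i, j⟩ * x (C.σ b i j)) = algebraMap K Ω l *
        (MvPolynomial.aeval c) (genericSol C.v m ⟨i, j⟩ * MvPolynomial.C (C.v i j)) := by
      intro j
      rw [map_mul, map_mul, MvPolynomial.aeval_C]
      change w' ⟨i, j⟩ * algebraMap K Ω (C.σ b i j) = _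
      rw [hl, map_mul]
      ring
    simp_rw [this]
    rw [← Finset.mul_sum, h5, mul_zero]
  have haev : ∀ {D : Subalgebra k Ω} (hBD : B ≤ D) (f : MvPolynomial (Σ i, n i) k),
      ((MvPolynomial.aeval fun t => Subalgebra.inclusion hBD (w t)) f : Ω) =
        MvPolynomial.aeval w' f := by
    intro D hBD f
    have : D.val.comp (MvPolynomial.aeval fun t => Subalgebra.inclusion hBD (w t)) =
        MvPolynomial.aeval w' := by
      ext t
      simp [w]
    exact DFunLike.congr_fun this f
  have hzero : ∀ {D : Subalgebra k Ω} (hBD : B ≤ D) (h : D →ₐ[k] k),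
      C.IsZero (fun t => h (Subalgebra.inclusion hBD (w t)))
        ((h.comp (Subalgebra.inclusion hBD)).comp x) Finset.univ := by
    intro D hBD h i _
    have := congrArg (h.comp (Subalgebra.inclusion hBD)) (hwx i)
    simp only [map_sum, map_mul, map_zero] at this
    exact this
  have hbad : ∀ (b' : C.β) (q : Σ i : J, n i × n i), ∃ r : B, r ≠ 0 ∧
      ∀ (h : B →ₐ[k] k) (x' : C.A b' →ₐ[k] k), h r ≠ 0 → C.IsZero (fun t => h (w t)) x' J →
        h (x (C.σ b q.1 q.2.1)) * x' (C.σ b' q.1 q.2.2) =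
          h (x (C.σ b q.1 q.2.2)) * x' (C.σ b' q.1 q.2.1) := fun b' q =>
    C.exists_ne_zero_of_generic h3 h4 x hx w (fun t => rfl) hwx b' q.1.2 q.2.1 q.2.2
  choose r hr0 hr using hbad
  -- There are finitely many charts and minors, so one localization makes every zero of the
  -- equations in `J` have the same image.
  have hrr : (∏ b', ∏ q, r b' q) ≠ 0 :=
    Finset.prod_ne_zero_iff.2 fun b' _ => Finset.prod_ne_zero_iff.2 fun q _ => hr0 b' q
  obtain ⟨D, hBD, hD, -, hDr⟩ := exists_fg_inv_mem hB hrr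
  have : Algebra.FiniteType k D := D.fg_iff_finiteType.1 hD
  obtain ⟨g, hg0, hg⟩ := exists_notMem_ker_forall_exists_lift
    (MvPolynomial.aeval (R := k) fun t => Subalgebra.inclusion hBD (w t))
  refine ⟨RingHom.ker (MvPolynomial.aeval (R := k) w').toRingHom, g, ?_, ?_, ?_, ?_⟩
  · intro hmem
    exact hg0 (Subtype.ext ((haev hBD g).trans hmem))
  · intro f
    refine ⟨fun hf s b x hs => C.eval_eq_zero_of_isZero hm hc hf x hs, fun hf => ?_⟩
    by_contra hfp
    have hr' : MvPolynomial.aeval w f ≠ 0 := by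
      intro h0
      refine hfp ?_
      have h6 := haev le_rfl f
      rw [Subalgebra.inclusion_self] at h6
      exact h6.symm.trans (congrArg Subtype.val h0)
    -- If `f` did not vanish at the generic solution, a closed point of the model with `f(w)`
    -- inverted would be a consistent system violating `f`.
    obtain ⟨D', hBD', hD', -, hDr'⟩ := exists_fg_inv_mem hB hr'
    have : Algebra.FiniteType k D' := D'.fg_iff_finiteType.1 hD'
    obtain ⟨h⟩ := exists_algHom (k := k) D'
    refine hDr' h ?_
    have h7 := hf _ b _ (hzero hBD' h)
    have h8 : ((h.comp (Subalgebra.inclusion hBD')).comp (MvPolynomial.aeval w)) =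
        MvPolynomial.aeval fun t => h (Subalgebra.inclusion hBD' (w t)) := by
      ext t
      simp
    exact (DFunLike.congr_fun h8 f).trans h7
  · intro s hs hsg
    obtain ⟨h, hh⟩ := hg s (fun f hf => hs f ((haev hBD f).symm.trans (congrArg Subtype.val hf))) hsg
    have hws : (fun t => h (Subalgebra.inclusion hBD (w t))) = s := by
      ext t
      rw [← hh t, MvPolynomial.aeval_X]
    refine ⟨b, (h.comp (Subalgebra.inclusion hBD)).comp x, hws ▸ hzero hBD h, ?_⟩
    intro b' x' hx' i hi j l
    refine hr b' ⟨⟨i, hi⟩, j, l⟩ (h.comp (Subalgebra.inclusion hBD)) x' ?_ ?_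
    · intro h0
      refine hDr h ?_
      rw [map_prod, map_prod]
      refine Finset.prod_eq_zero (Finset.mem_univ b') ?_
      rw [map_prod, map_prod]
      exact Finset.prod_eq_zero (Finset.mem_univ _) h0
    · rw [← hws] at hx'
      exact hx'
  · intro s t hs hst f hf
    exact eval_eq_zero_of_eqOn JJ w' hind hs (fun p hp => hst p.1 hp p.2) f hf

end ChartSystem

end TrRank

/-! ### Krull dimension and transcendence degree. -/

namespace TrRank

open AlgebraicIndependent

section Dimension

lemma rk_range_of_algebraicIndependent {k Ω : Type*} [Field k] [Field Ω] [Algebra k Ω]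
    {ι : Type*} [Fintype ι] {y : ι → Ω} (hy : AlgebraicIndependent k y) :
    rk k (Set.range y) = Fintype.card ι := by
  have hind : (matroid k Ω).Indep (Set.range y) := hy.coe_range
  rw [rk, hind.eRk_eq_encard, ← Set.image_univ, hy.injective.encard_image, Set.encard_univ,
    ENat.card_eq_coe_fintype_card, ENat.toNat_natCast]

/-- Incomparability gives one inequality and going up the other. Lifting starts from `⊥` in `S`, so
`⊥` is prepended to a chain that does not begin with it. -/
lemma krullDim_eq_of_isIntegral {R S : Type*} [CommRing R] [CommRing S] [IsDomain S]
    (g : R →+* S) (hinj : Function.Injective g) (hg : g.IsIntegral) :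
    ringKrullDim S = ringKrullDim R := by
  algebraize [g]
  have : Algebra.IsIntegral R S := ⟨hg⟩
  refine le_antisymm ?_ ?_
  · refine Order.krullDim_le_of_strictMono (PrimeSpectrum.comap (algebraMap R S)) fun P Q hPQ => ?_
    exact Ideal.IsIntegral.comap_lt_comap hPQ
  · have := hinj.isDomain g
    refine iSup_le fun l => ?_
    have : (⊥ : Ideal S).LiesOver (⊥ : Ideal R) :=
      ⟨((RingHom.ker_eq_bot_iff_eq_zero _).2 ((injective_iff_map_eq_zero _).1 hinj)).symm⟩
    by_cases h0 : l.head.asIdeal = ⊥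
    · have : (⊥ : Ideal S).LiesOver l.head.asIdeal := h0 ▸ this
      obtain ⟨l', hl', -⟩ := Ideal.exists_ltSeries_of_hasGoingUp l (⊥ : Ideal S)
      rw [← hl']
      exact Order.LTSeries.length_le_krullDim l'
    · let l₁ : LTSeries (PrimeSpectrum R) := l.cons ⟨⊥, Ideal.isPrime_bot⟩
        (bot_lt_iff_ne_bot.2 h0 : (⊥ : Ideal R) < l.head.asIdeal)
      have : (⊥ : Ideal S).LiesOver l₁.head.asIdeal := by
        rw [RelSeries.head_cons]
        exact this
      obtain ⟨l', hl', -⟩ := Ideal.exists_ltSeries_of_hasGoingUp l₁ (⊥ : Ideal S)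
      have h1 : l.length ≤ l'.length := by
        rw [hl', RelSeries.cons_length]
        exact Nat.le_succ _
      exact (Nat.cast_le.2 h1).trans (Order.LTSeries.length_le_krullDim l')

variable {k Ω : Type*} [Field k] [Field Ω] [Algebra k Ω]

/-- The dimension of a finitely generated algebra is its transcendence degree. -/
theorem ringKrullDim_eq_rk {A : Subalgebra k Ω} (hA : A.FG) {S : Set Ω} (hS : S.Finite)
    (hSA : S ⊆ A) (hAS : (A : Set Ω) ⊆ acl k S) : ringKrullDim A = rk k S := by
  have : Algebra.FiniteType k A := A.fg_iff_finiteType.1 hA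
  -- By Noether normalization the algebra is integral over a polynomial ring, whose variables form a
  -- transcendence basis.
  obtain ⟨s, g, hinj, hint⟩ := exists_integral_inj_algHom_of_fg k A
  have h1 := krullDim_eq_of_isIntegral g.toRingHom hinj hint
  rw [h1, MvPolynomial.ringKrullDim_of_isNoetherianRing, ringKrullDim_eq_zero_of_field, zero_add,
    Nat.card_eq_fintype_card]
  have hy : AlgebraicIndependent k (fun i => (g (MvPolynomial.X i) : Ω)) :=
    ((MvPolynomial.algebraicIndependent_X (Fin s) k).map' hinj).map' (f := A.val)
      Subtype.val_injective
  have hyA : Set.range (fun i => (g (MvPolynomial.X i) : Ω)) ⊆ A := by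
    rintro _ ⟨i, rfl⟩
    exact (g (MvPolynomial.X i)).2
  rw [← rk_range_of_algebraicIndependent hy]
  norm_cast
  refine le_antisymm (rk_le_of_subset_acl hS (hyA.trans hAS))
    (rk_le_of_subset_acl (Set.finite_range _) fun x hx => ?_)
  rw [mem_acl_iff]
  obtain ⟨p, hp, hpx⟩ := hint ⟨x, hSA hx⟩
  have hg : ∀ f, (g f : Ω) ∈
      Algebra.adjoin k (Set.range fun i => (g (MvPolynomial.X i) : Ω)) := by
    intro f
    have : (A.val.comp g) = MvPolynomial.aeval (fun i => (g (MvPolynomial.X i) : Ω)) := by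
      ext i; simp
    rw [Algebra.adjoin_range_eq_range_aeval, ← this]
    exact ⟨f, rfl⟩
  let g' : MvPolynomial (Fin s) k →+* Algebra.adjoin k (Set.range
      fun i => (g (MvPolynomial.X i) : Ω)) :=
    (A.val.comp g).toRingHom.codRestrict _ hg
  refine ⟨p.map g', (hp.map g').ne_zero, ?_⟩
  rw [Polynomial.aeval_def, Polynomial.eval₂_map]
  have h3 := congrArg A.val.toRingHom hpx
  rw [Polynomial.hom_eval₂, map_zero] at h3
  exact h3

end Dimension

/-- A finitely generated algebra is Jacobson, so `f` is nonzero at some closed point of the zero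
locus of the prime `I`. -/
lemma exists_algHom_ker_ge_of_notMem {k A : Type*} [Field k] [IsAlgClosed k] [CommRing A]
    [Algebra k A] [Algebra.FiniteType k A] (I : Ideal A) [I.IsPrime] {f : A} (hf : f ∉ I) :
    ∃ h : A →ₐ[k] k, (∀ a ∈ I, h a = 0) ∧ h f ≠ 0 := by
  have : IsJacobsonRing A := isJacobsonRing_of_finiteType (A := k)
  have h1 : f ∉ I.jacobson := by
    rwa [← Ideal.radical_eq_jacobson, Ideal.IsPrime.radical ‹_›]
  rw [Ideal.jacobson, Ideal.mem_sInf] at h1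
  push Not at h1
  obtain ⟨M, ⟨hIM, hM⟩, hfM⟩ := h1
  obtain ⟨h, hh⟩ := exists_algHom_ker_ge (k := k) M hM.ne_top
  refine ⟨h, fun a ha => hh a (hIM ha), fun h0 => hfM ?_⟩
  have : M = RingHom.ker h.toRingHom := hM.eq_of_le (RingHom.ker_ne_top _) hh
  rw [this]
  exact h0

end TrRank

/-! ### Polynomial functions and Zariski topologies in coordinates. -/

namespace LinSeries

section PolyFun

variable {V : Type} [AddCommGroup V] [Module ℂ V]

lemma mem_polyFun {n : Type*} [Fintype n] (b : Module.Basis n ℂ V) {f : V → ℂ} :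
    f ∈ polyFun V ↔ ∃ P : MvPolynomial n ℂ, ∀ v, f v = MvPolynomial.eval (b.repr v) P := by
  classical
  have hX : ∀ P : MvPolynomial n ℂ, (fun v => MvPolynomial.eval (b.repr v) P) =
      MvPolynomial.aeval (fun i (v : V) => b.coord i v) P := by
    intro P
    induction P using MvPolynomial.induction_on with
    | C a => ext v; simp
    | add p q hp hq => rw [map_add, ← hp, ← hq]; ext v; simp
    | mul_X p i hp => rw [map_mul, ← hp, MvPolynomial.aeval_X]; ext v; simp
  constructor
  · intro hf
    refine Algebra.adjoin_induction (p := fun f _ => ∃ P : MvPolynomial n ℂ, ∀ v, f v =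
      MvPolynomial.eval (b.repr v) P) ?_ ?_ ?_ ?_ hf
    · rintro _ ⟨φ, rfl⟩
      refine ⟨∑ i, MvPolynomial.C (φ (b i)) * MvPolynomial.X i, fun v => ?_⟩
      refine (congrArg φ (b.sum_repr v)).symm.trans ?_
      simp [-Module.Basis.sum_repr, mul_comm]
    · intro c
      exact ⟨MvPolynomial.C c, fun v => by simp⟩
    · rintro f g - - ⟨P, hP⟩ ⟨Q, hQ⟩
      exact ⟨P + Q, fun v => by simp [hP, hQ]⟩
    · rintro f g - - ⟨P, hP⟩ ⟨Q, hQ⟩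
      exact ⟨P * Q, fun v => by simp [hP, hQ]⟩
  · rintro ⟨P, hP⟩
    rw [funext hP, hX]
    refine MvPolynomial.induction_on (motive := fun P =>
      MvPolynomial.aeval (fun i (v : V) => b.coord i v) P ∈ polyFun V) P ?_ ?_ ?_
    · intro a
      rw [MvPolynomial.aeval_C]
      exact Subalgebra.algebraMap_mem _ a
    · intro p q hp hq
      rw [map_add]
      exact add_mem hp hq
    · intro p i hp
      rw [map_mul, MvPolynomial.aeval_X]
      exact mul_mem hp (Algebra.subset_adjoin ⟨b.coord i, rfl⟩)

lemma isOpen_zariski_iff {U : Set V} : @IsOpen V (zariski V) U ↔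
    ∀ v ∈ U, ∃ f ∈ polyFun V, f v ≠ 0 ∧ ∀ w, f w ≠ 0 → w ∈ U := by
  let := zariski V
  have hb := isTopologicalBasis_of_subbasis_of_inter (t := zariski V) rfl (by
    rintro _ ⟨f, hf, rfl⟩ _ ⟨g, hg, rfl⟩
    refine ⟨f * g, mul_mem hf hg, ?_⟩
    ext v
    simp)
  rw [hb.isOpen_iff]
  refine forall₂_congr fun v _ => ⟨?_, ?_⟩
  · rintro ⟨_, rfl | ⟨f, hf, rfl⟩, hv, hU⟩
    · exact ⟨1, one_mem _, by simp, fun w _ => hU trivial⟩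
    · exact ⟨f, hf, hv, fun w hw => hU hw⟩
  · rintro ⟨f, hf, hv, hU⟩
    exact ⟨_, Or.inr ⟨f, hf, rfl⟩, hv, hU⟩

lemma mem_closure_zariski_iff {S : Set V} {v : V} : v ∈ @closure V (zariski V) S ↔
    ∀ f ∈ polyFun V, (∀ w ∈ S, f w = 0) → f v = 0 := by
  let := zariski V
  rw [mem_closure_iff]
  constructor
  · intro h f hf hS
    by_contra hv
    obtain ⟨w, hw, hwS⟩ := h {v | f v ≠ 0}
      (TopologicalSpace.isOpen_generateFrom_of_mem ⟨f, hf, rfl⟩) hv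
    exact hw (hS w hwS)
  · intro h U hU hv
    obtain ⟨f, hf, hfv, hfU⟩ := isOpen_zariski_iff.1 hU v hv
    by_contra hne
    refine hfv (h f hf fun w hw => ?_)
    by_contra hfw
    exact hne ⟨w, hfU w hfw, hw⟩

/-- Homogeneous polynomial functions, of unspecified degree. -/
def IsHomFun (f : V → ℂ) : Prop :=
  ∃ d : ℕ, ∀ (c : ℂ) (v : V), f (c • v) = c ^ d * f v

lemma isOpen_projZariski_iff {U : Set (ℙ ℂ V)} : @IsOpen _ (projZariski V) U ↔
    ∀ p ∈ U, ∃ f ∈ polyFun V, IsHomFun f ∧ f p.rep ≠ 0 ∧ ∀ q : ℙ ℂ V, f q.rep ≠ 0 → q ∈ U := by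
  let := projZariski V
  have hb := isTopologicalBasis_of_subbasis_of_inter (t := projZariski V) rfl (by
    rintro _ ⟨f, hf, ⟨d, hd⟩, rfl⟩ _ ⟨g, hg, ⟨e, he⟩, rfl⟩
    refine ⟨f * g, mul_mem hf hg, ⟨d + e, fun c v => ?_⟩, ?_⟩
    · simp only [Pi.mul_apply, hd, he]
      ring
    · ext v
      simp)
  rw [hb.isOpen_iff]
  refine forall₂_congr fun v _ => ⟨?_, ?_⟩
  · rintro ⟨_, rfl | ⟨f, hf, hd, rfl⟩, hv, hU⟩
    · exact ⟨1, one_mem _, ⟨0, by simp⟩, by simp, fun w _ => hU trivial⟩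
    · exact ⟨f, hf, hd, hv, fun w hw => hU hw⟩
  · rintro ⟨f, hf, hd, hv, hU⟩
    exact ⟨_, Or.inr ⟨f, hf, hd, rfl⟩, hv, hU⟩

end PolyFun

end LinSeries

/-! ### Dimension of a space with homogeneous coordinates. -/

namespace TrRank

section Homogenize

variable {k : Type*} [Field k] {n : Type*}

/-- A homogenization of a polynomial, divisible by the homogenizing variable. -/
noncomputable def homog (m : n) (P : MvPolynomial n k) : MvPolynomial n k :=
  ∑ d ∈ P.support, MvPolynomial.monomial d (P.coeff d) *
    MvPolynomial.X m ^ (P.totalDegree + 1 - d.sum fun _ a => a)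

lemma aeval_homog_smul {F : Type*} [Field F] [Algebra k F] (m : n) (P : MvPolynomial n k) (c : F)
    (w : n → F) : MvPolynomial.aeval (c • w) (homog m P) =
      c ^ (P.totalDegree + 1) * MvPolynomial.aeval w (homog m P) := by
  rw [homog, map_sum, map_sum, Finset.mul_sum]
  refine Finset.sum_congr rfl fun d hd => ?_
  have h1 := MvPolynomial.le_totalDegree hd
  have h2 : P.totalDegree + 1 = (d.sum fun _ a => a) + (P.totalDegree + 1 - d.sum fun _ a => a) := by
    omega
  rw [map_mul, map_mul, map_pow, map_pow, MvPolynomial.aeval_monomial, MvPolynomial.aeval_monomial,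
    MvPolynomial.aeval_X, MvPolynomial.aeval_X]
  simp only [Pi.smul_apply, smul_eq_mul, mul_pow]
  rw [Finsupp.prod_mul]
  have h3 : (d.prod fun _ a => c ^ a) = c ^ (d.sum fun _ a => a) := by
    rw [Finsupp.prod, Finset.prod_pow_eq_pow_sum]
    rfl
  rw [h3]
  conv_rhs => rw [h2, pow_add]
  simp only [Nat.add_sub_cancel_left]
  ring

lemma aeval_homog {F : Type*} [Field F] [Algebra k F] (m : n) (P : MvPolynomial n k) {w : n → F}
    (hw : w m ≠ 0) : MvPolynomial.aeval w (homog m P) =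
      w m ^ (P.totalDegree + 1) * MvPolynomial.aeval (fun j => w j / w m) P := by
  have h1 : w = w m • fun j => w j / w m := by
    ext j
    rw [Pi.smul_apply, smul_eq_mul, mul_div_cancel₀ _ hw]
  conv_lhs => rw [h1]
  rw [aeval_homog_smul]
  congr 1
  conv_rhs => rw [P.as_sum, map_sum]
  rw [homog, map_sum]
  refine Finset.sum_congr rfl fun d _ => ?_
  rw [map_mul, map_pow, MvPolynomial.aeval_X, div_self hw, one_pow, mul_one]

/-- The surplus power of `X m` confines the nonvanishing locus of the homogenization to the chart `w
m ≠ 0`, as `IsHomCoord.isOpen_ne_zero` needs. -/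
lemma aeval_homog_eq_zero {F : Type*} [Field F] [Algebra k F] (m : n) (P : MvPolynomial n k)
    {w : n → F} (hw : w m = 0) : MvPolynomial.aeval w (homog m P) = 0 := by
  rw [homog, map_sum]
  refine Finset.sum_eq_zero fun d hd => ?_
  have h1 := MvPolynomial.le_totalDegree hd
  rw [map_mul, map_pow, MvPolynomial.aeval_X, hw, zero_pow (by omega), mul_zero]

end Homogenize

section TopDim

variable {k K : Type*} [Field k] [Field K] [Algebra k K] {n : Type*} {T : Type*}
  [TopologicalSpace T]

/-- The map `z` gives homogeneous coordinates on `T` that induce its topology. -/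
structure IsHomCoord (z : T → n → k) : Prop where
  exists_ne_zero : ∀ t, ∃ m, z t m ≠ 0
  isOpen_iff : ∀ U : Set T, IsOpen U ↔ ∀ t ∈ U, ∃ (P : MvPolynomial n k) (d : ℕ),
    (∀ (c : k) (w : n → k), MvPolynomial.eval (c • w) P = c ^ d * MvPolynomial.eval w P) ∧
    MvPolynomial.eval (z t) P ≠ 0 ∧ ∀ t', MvPolynomial.eval (z t') P ≠ 0 → t' ∈ U

variable {z : T → n → k}

lemma eval_eq_pow_mul {P : MvPolynomial n k} {d : ℕ}
    (hP : ∀ (c : k) (w : n → k), MvPolynomial.eval (c • w) P = c ^ d * MvPolynomial.eval w P)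
    {w : n → k} {m : n} (hw : w m ≠ 0) :
    MvPolynomial.eval w P = w m ^ d * MvPolynomial.eval (fun j => w j / w m) P := by
  rw [← hP]
  congr 2
  ext j
  rw [Pi.smul_apply, smul_eq_mul, mul_div_cancel₀ _ hw]

lemma IsHomCoord.isOpen_ne_zero (hz : IsHomCoord z) (m : n) (P : MvPolynomial n k) :
    IsOpen {t | z t m ≠ 0 ∧ MvPolynomial.eval (fun j => z t j / z t m) P ≠ 0} := by
  have key : ∀ w : n → k, MvPolynomial.eval w (homog m P) ≠ 0 ↔
      w m ≠ 0 ∧ MvPolynomial.eval (fun j => w j / w m) P ≠ 0 := by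
    intro w
    rw [← MvPolynomial.coe_aeval_eq_eval, ← MvPolynomial.coe_aeval_eq_eval]
    change MvPolynomial.aeval w (homog m P) ≠ 0 ↔ w m ≠ 0 ∧ MvPolynomial.aeval _ P ≠ 0
    by_cases hw : w m = 0
    · simp [hw, aeval_homog_eq_zero]
    · rw [aeval_homog m P hw]
      simp [hw]
  rw [hz.isOpen_iff]
  intro t ht
  refine ⟨homog m P, P.totalDegree + 1, fun c w => ?_, (key _).2 ht, fun t' ht' => (key _).1 ht'⟩
  exact aeval_homog_smul m P c w

lemma IsHomCoord.isOpen_coord_ne_zero (hz : IsHomCoord z) (m : n) : IsOpen {t | z t m ≠ 0} := by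
  simpa using hz.isOpen_ne_zero m 1

variable {v : n → K}

lemma exists_algHom_range {w : n → K} {s : n → k}
    (h : ∀ P : MvPolynomial n k, MvPolynomial.aeval w P = 0 → MvPolynomial.eval s P = 0) :
    ∃ f : (MvPolynomial.aeval (R := k) w).range →ₐ[k] k,
      ∀ P, f ((MvPolynomial.aeval (R := k) w).rangeRestrict P) = MvPolynomial.eval s P := by
  let φ := (MvPolynomial.aeval (R := k) w).rangeRestrict
  have hφ : Function.Surjective φ := AlgHom.rangeRestrict_surjective _
  let q := Ideal.quotientKerAlgEquivOfSurjective hφ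
  refine ⟨(Ideal.Quotient.liftₐ (RingHom.ker φ) (MvPolynomial.aeval (R := k) s) fun a ha => ?_).comp
    q.symm.toAlgHom, fun P => ?_⟩
  · exact h a (congrArg Subtype.val (show φ a = 0 from ha))
  · have : q.symm (φ P) = Ideal.Quotient.mk _ P := q.symm_apply_eq.2 rfl
    rw [AlgHom.comp_apply]
    refine (congrArg _ this).trans ?_
    rfl

/-- The members of a chain of irreducible closed sets share a point `y`. In a chart around `y` their
ideals form a strict chain of primes of the algebra generated by the `v j / v m`, whose dimension is
`r`. -/
lemma IsHomCoord.krullDim_le [Finite n] (hz : IsHomCoord z) {r : ℕ}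
    (h1 : ∀ t m, z t m ≠ 0 → v m ≠ 0 ∧ ∀ P : MvPolynomial n k,
      MvPolynomial.aeval (fun j => v j / v m) P = 0 →
        MvPolynomial.eval (fun j => z t j / z t m) P = 0)
    (hr : ∀ m, v m ≠ 0 → rk k (Set.range fun j => v j / v m) = r) :
    topologicalKrullDim T ≤ r := by
  refine iSup_le fun q => ?_
  obtain ⟨y, hy⟩ := q.head.isIrreducible'.nonempty
  obtain ⟨m, hm⟩ := hz.exists_ne_zero y
  have hvm := (h1 y m hm).1
  let w : n → K := fun j => v j / v m
  let A : Subalgebra k K := (MvPolynomial.aeval (R := k) w).range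
  let φ : MvPolynomial n k →ₐ[k] A := (MvPolynomial.aeval w).rangeRestrict
  have hφ : Function.Surjective φ := AlgHom.rangeRestrict_surjective _
  have hA : A = Algebra.adjoin k (Set.range w) := (Algebra.adjoin_range_eq_range_aeval k w).symm
  have hdim : ringKrullDim A = r := by
    rw [← hr m hvm]
    refine ringKrullDim_eq_rk ?_ (Set.finite_range w) ?_ ?_
    · rw [hA]
      exact ⟨(Set.finite_range w).toFinset, by rw [Set.Finite.coe_toFinset]⟩
    · rw [hA]
      exact Algebra.subset_adjoin
    · rw [hA]
      exact adjoin_subset_acl _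
  let spec (t : T) (f : A →ₐ[k] k) : Prop :=
    ∀ P, f (φ P) = MvPolynomial.eval (fun j => z t j / z t m) P
  have hspec : ∀ t, z t m ≠ 0 → ∃ f, spec t f := fun t ht => exists_algHom_range (h1 t m ht).2
  let I (Z : Set T) : Ideal A :=
    { carrier := {a | ∀ t ∈ Z, z t m ≠ 0 → ∀ f, spec t f → f a = 0}
      add_mem' := fun ha hb t ht h f hf => by
        rw [map_add, ha t ht h f hf, hb t ht h f hf, add_zero]
      zero_mem' := fun t ht h f hf => map_zero f
      smul_mem' := fun c a ha t ht h f hf => by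
        rw [smul_eq_mul, map_mul, ha t ht h f hf, mul_zero] }
  have hI : ∀ Z P, φ P ∈ I Z ↔
      ∀ t ∈ Z, z t m ≠ 0 → MvPolynomial.eval (fun j => z t j / z t m) P = 0 := by
    intro Z P
    refine forall₃_congr fun t _ ht => ⟨fun h => ?_, fun h f hf => (hf P).trans h⟩
    obtain ⟨f, hf⟩ := hspec t ht
    rw [← hf P]
    exact h f hf
  have hprime : ∀ Z : Set T, IsPreirreducible Z → y ∈ Z → (I Z).IsPrime := by
    intro Z hZ hyZ
    refine ⟨fun htop => ?_, fun {a b} hab => ?_⟩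
    · obtain ⟨f, hf⟩ := hspec y hm
      have h2 : (1 : A) ∈ I Z := htop ▸ Submodule.mem_top
      have := h2 y hyZ hm f hf
      rw [map_one] at this
      exact one_ne_zero this
    · obtain ⟨P, rfl⟩ := hφ a
      obtain ⟨Q, rfl⟩ := hφ b
      rw [← map_mul, hI] at hab
      rw [hI, hI]
      by_contra! hcon
      obtain ⟨⟨t, ht, htm, htP⟩, t', ht', htm', htQ⟩ := hcon
      obtain ⟨t'', ht'', ⟨hm'', hP⟩, -, hQ⟩ := hZ _ _ (hz.isOpen_ne_zero m P)
        (hz.isOpen_ne_zero m Q) ⟨t, ht, htm, htP⟩ ⟨t', ht', htm', htQ⟩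
      have := hab t'' ht'' hm''
      rw [map_mul] at this
      exact mul_ne_zero hP hQ this
  have hmono : ∀ Z Z' : IrreducibleCloseds T, y ∈ (Z : Set T) → Z < Z' → I Z' < I Z := by
    intro Z Z' hyZ hlt
    have hsub : (Z : Set T) ⊆ Z' := hlt.le
    refine lt_of_le_not_ge (fun a ha t ht => ha t (hsub ht)) fun hle => hlt.not_ge ?_
    intro t ht
    by_contra htZ
    -- As `Z'` is irreducible and meets the chart in `y`, the point of `Z'` outside `Z` may be
    -- chosen in the chart.
    obtain ⟨t', ht', htm', htZ'⟩ := Z'.isIrreducible'.isPreirreducible {t | z t m ≠ 0} (Z : Set T)ᶜ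
      (hz.isOpen_coord_ne_zero m) Z.isClosed'.isOpen_compl ⟨y, hsub hyZ, hm⟩ ⟨t, ht, htZ⟩
    obtain ⟨P, d, hP, hPt, hPZ⟩ := (hz.isOpen_iff _).1 Z.isClosed'.isOpen_compl t' htZ'
    rw [eval_eq_pow_mul hP htm'] at hPt
    refine right_ne_zero_of_mul hPt ((hI Z' P).1 (hle ((hI Z P).2 fun s hs hsm => ?_)) t' ht' htm')
    by_contra h0
    refine hPZ s ?_ hs
    rw [eval_eq_pow_mul hP hsm]
    exact mul_ne_zero (pow_ne_zero _ hsm) h0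
  have hy' : ∀ i, y ∈ (q i : Set T) := fun i => q.head_le i hy
  let q' : LTSeries (PrimeSpectrum A)ᵒᵈ := LTSeries.mk q.length
    (fun i => OrderDual.toDual ⟨I (q i), hprime _ (q i).isIrreducible'.isPreirreducible (hy' i)⟩)
    fun i j hij => hmono _ _ (hy' i) (q.strictMono hij)
  rw [← hdim]
  have h2 := Order.LTSeries.length_le_krullDim q'
  rw [Order.krullDim_orderDual] at h2
  exact h2

/-- The image of a Kodaira map need only contain an open part of its closure, cut out by `g`. Once
`g` is inverted, all points of the algebra come from `T`, and sending a prime to the closure of its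
zero set reverses strict inclusions. -/
lemma IsHomCoord.le_krullDim [Finite n] [IsAlgClosed k] (hz : IsHomCoord z) {m : n} {g : MvPolynomial n k}
    (hg : MvPolynomial.aeval (fun j => v j / v m) g ≠ 0)
    (h2 : ∀ s : n → k, (∀ P : MvPolynomial n k, MvPolynomial.aeval (fun j => v j / v m) P = 0 →
      MvPolynomial.eval s P = 0) → MvPolynomial.eval s g ≠ 0 →
      ∃ t, z t m ≠ 0 ∧ ∀ j, z t j / z t m = s j) :
    (rk k (Set.range fun j => v j / v m) : WithBot ℕ∞) ≤ topologicalKrullDim T := by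
  set w : n → K := fun j => v j / v m
  let R : Subalgebra k K := Algebra.adjoin k (Set.range w ∪ {(MvPolynomial.aeval w g)⁻¹})
  have hfin : (Set.range w ∪ {(MvPolynomial.aeval w g)⁻¹}).Finite :=
    (Set.finite_range w).union (Set.finite_singleton _)
  have hRfg : R.FG := ⟨hfin.toFinset, by rw [Set.Finite.coe_toFinset]⟩
  have : Algebra.FiniteType k R := R.fg_iff_finiteType.1 hRfg
  let w' : n → R := fun j => ⟨w j, Algebra.subset_adjoin (Or.inl ⟨j, rfl⟩)⟩
  let ψ : MvPolynomial n k →ₐ[k] R := MvPolynomial.aeval w'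
  have hψ : ∀ P, (ψ P : K) = MvPolynomial.aeval w P := fun P => by
    have : R.val.comp ψ = MvPolynomial.aeval w := by
      ext j; simp [ψ, w']
    rw [← this]
    rfl
  have hdim : ringKrullDim R = rk k (Set.range w) := by
    refine ringKrullDim_eq_rk hRfg (Set.finite_range w)
      (fun x hx => Algebra.subset_adjoin (Or.inl hx)) ?_
    have hw : ∀ P, MvPolynomial.aeval w P ∈ acl k (Set.range w) := fun P =>
      adjoin_subset_acl _ (by
        rw [Algebra.adjoin_range_eq_range_aeval]
        exact ⟨P, rfl⟩)
    have : R ≤ (aclField k (Set.range w)).toSubalgebra := by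
      refine Algebra.adjoin_le (Set.union_subset (fun x hx => ?_) ?_)
      · exact mem_aclField.2 (subset_acl _ hx)
      · rw [Set.singleton_subset_iff]
        exact (aclField k _).inv_mem (mem_aclField.2 (hw g))
    exact fun x hx => mem_aclField.1 (this hx)
  let c : R := ⟨(MvPolynomial.aeval w g)⁻¹, Algebra.subset_adjoin (Or.inr rfl)⟩
  have hc : c * ψ g = 1 := Subtype.ext (by
    rw [Subalgebra.coe_mul, hψ]
    exact inv_mul_cancel₀ hg)
  have hfrac : ∀ a : R, ∃ (N : ℕ) (P : MvPolynomial n k), a * ψ g ^ N = ψ P := by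
    rintro ⟨a, ha⟩
    induction ha using Algebra.adjoin_induction with
    | mem x hx =>
      rcases hx with ⟨j, rfl⟩ | rfl
      · exact ⟨0, MvPolynomial.X j, by simp [ψ, w']⟩
      · exact ⟨1, 1, by rw [pow_one, map_one]; exact hc⟩
    | algebraMap r => exact ⟨0, MvPolynomial.C r, Subtype.ext (by simp [ψ])⟩
    | add x y hx hy ihx ihy =>
      obtain ⟨N, P, hP⟩ := ihx
      obtain ⟨M, Q, hQ⟩ := ihy
      refine ⟨N + M, P * g ^ M + Q * g ^ N, ?_⟩
      rw [map_add, map_mul, map_mul, ← hP, ← hQ, map_pow, map_pow]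
      apply Subtype.ext
      simp only [Subalgebra.coe_mul, Subalgebra.coe_add, Subalgebra.coe_pow]
      ring
    | mul x y hx hy ihx ihy =>
      obtain ⟨N, P, hP⟩ := ihx
      obtain ⟨M, Q, hQ⟩ := ihy
      refine ⟨N + M, P * Q, ?_⟩
      rw [map_mul, ← hP, ← hQ]
      apply Subtype.ext
      simp only [Subalgebra.coe_mul, Subalgebra.coe_pow]
      ring
  have heval : ∀ (h : R →ₐ[k] k) P, h (ψ P) = MvPolynomial.eval (fun j => h (w' j)) P := by
    intro h P
    have : h.comp ψ = MvPolynomial.aeval (fun j => h (w' j)) := by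
      ext j; simp [ψ]
    exact DFunLike.congr_fun this P
  have hpt : ∀ h : R →ₐ[k] k, ∃ t, z t m ≠ 0 ∧ ∀ j, h (w' j) = z t j / z t m := by
    intro h
    have hne : MvPolynomial.eval (fun j => h (w' j)) g ≠ 0 := by
      intro h0
      have := congrArg h hc
      rw [map_mul, heval h g, h0, mul_zero, map_one] at this
      exact zero_ne_one this
    obtain ⟨t, ht, htj⟩ := h2 (fun j => h (w' j)) (fun P hP => by
      rw [← heval, (Subtype.ext ((hψ P).trans hP) : ψ P = 0), map_zero]) hne
    exact ⟨t, ht, fun j => (htj j).symm⟩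
  let Z₀ (I : Ideal R) : Set T :=
    {t | z t m ≠ 0 ∧ ∃ h : R →ₐ[k] k, (∀ a ∈ I, h a = 0) ∧ ∀ j, h (w' j) = z t j / z t m}
  have hirr : ∀ I : Ideal R, I.IsPrime → IsIrreducible (Z₀ I) := by
    intro I hI
    refine ⟨?_, ?_⟩
    · obtain ⟨h, hh⟩ := exists_algHom_ker_ge (k := k) I hI.ne_top
      obtain ⟨t, ht, htj⟩ := hpt h
      exact ⟨t, ht, h, hh, htj⟩
    · rintro U₁ U₂ hU₁ hU₂ ⟨t₁, ⟨hm₁, f₁, hf₁, hft₁⟩, ht₁⟩ ⟨t₂, ⟨hm₂, f₂, hf₂, hft₂⟩, ht₂⟩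
      obtain ⟨P₁, d₁, hP₁, hPt₁, hPU₁⟩ := (hz.isOpen_iff _).1 hU₁ t₁ ht₁
      obtain ⟨P₂, d₂, hP₂, hPt₂, hPU₂⟩ := (hz.isOpen_iff _).1 hU₂ t₂ ht₂
      rw [eval_eq_pow_mul hP₁ hm₁, ← funext hft₁, ← heval] at hPt₁
      rw [eval_eq_pow_mul hP₂ hm₂, ← funext hft₂, ← heval] at hPt₂
      have hn₁ : ψ P₁ ∉ I := fun h => right_ne_zero_of_mul hPt₁ (hf₁ _ h)
      have hn₂ : ψ P₂ ∉ I := fun h => right_ne_zero_of_mul hPt₂ (hf₂ _ h)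
      have hn : ψ P₁ * ψ P₂ ∉ I := fun h => (hI.mem_or_mem h).elim hn₁ hn₂
      obtain ⟨h, hh, hne⟩ := exists_algHom_ker_ge_of_notMem (k := k) I hn
      obtain ⟨t, ht, htj⟩ := hpt h
      rw [map_mul] at hne
      refine ⟨t, ⟨ht, h, hh, htj⟩, hPU₁ t ?_, hPU₂ t ?_⟩
      · rw [eval_eq_pow_mul hP₁ ht, ← funext htj, ← heval]
        exact mul_ne_zero (pow_ne_zero _ ht) (left_ne_zero_of_mul hne)
      · rw [eval_eq_pow_mul hP₂ ht, ← funext htj, ← heval]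
        exact mul_ne_zero (pow_ne_zero _ ht) (right_ne_zero_of_mul hne)
  let Z (p : PrimeSpectrum R) : (IrreducibleCloseds T)ᵒᵈ :=
    OrderDual.toDual ⟨closure (Z₀ p.asIdeal), (hirr _ p.isPrime).closure, isClosed_closure⟩
  have hZ : StrictMono Z := by
    intro p p' hlt
    have hle : p.asIdeal ≤ p'.asIdeal := hlt.le
    refine lt_of_le_not_ge ?_ fun hge => ?_
    · change closure (Z₀ p'.asIdeal) ⊆ closure (Z₀ p.asIdeal)
      exact closure_mono fun t ⟨ht, h, hh, htj⟩ => ⟨ht, h, fun a ha => hh a (hle ha), htj⟩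
    · have hge' : closure (Z₀ p.asIdeal) ⊆ closure (Z₀ p'.asIdeal) := hge
      obtain ⟨a, ha', ha⟩ := SetLike.exists_of_lt (show p.asIdeal < p'.asIdeal from hlt)
      obtain ⟨N, P, hP⟩ := hfrac a
      have hg' : ψ g ∉ p.asIdeal := fun h => p.isPrime.ne_top
        ((Ideal.eq_top_iff_one _).2 (hc ▸ Ideal.mul_mem_left _ c h))
      have hPp : ψ P ∉ p.asIdeal := fun h => by
        rw [← hP] at h
        exact (p.isPrime.mem_or_mem h).elim ha fun h => hg' (p.isPrime.mem_of_pow_mem _ h)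
      have hPp' : ψ P ∈ p'.asIdeal := hP ▸ Ideal.mul_mem_right _ _ ha'
      obtain ⟨h, hh, hne⟩ := exists_algHom_ker_ge_of_notMem (k := k) p.asIdeal hPp
      obtain ⟨t, ht, htj⟩ := hpt h
      have hmem := hge' (subset_closure ⟨ht, h, hh, htj⟩)
      rw [mem_closure_iff] at hmem
      obtain ⟨t', ⟨-, hne'⟩, ht', h', hh', htj'⟩ := hmem _ (hz.isOpen_ne_zero m P)
        ⟨ht, by rwa [← funext htj, ← heval]⟩
      rw [← funext htj', ← heval] at hne'
      exact hne' (hh' _ hPp')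
  have h3 := Order.krullDim_le_of_strictMono Z hZ
  rw [Order.krullDim_orderDual] at h3
  exact hdim.symm.le.trans h3

end TopDim

end TrRank

/-! ### Dimension of the image of a Kodaira map. -/

namespace LinSeries

open TrRank

section ProjDim

variable {E : Type} [AddCommGroup E] [Module ℂ E] {n : Type} [Fintype n]

lemma isHomCoord_rep (e : Module.Basis n ℂ E) (Y : Set (ℙ ℂ (Module.Dual ℂ E))) :
    @IsHomCoord ℂ _ n Y ((projZariski _).induced Subtype.val) fun p j => p.1.rep (e j) := by
  classical
  let _ := (projZariski (Module.Dual ℂ E)).induced (Subtype.val : Y → _)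
  have hd : ∀ w : Module.Dual ℂ E, (e.dualBasis.repr w : n → ℂ) = fun j => w (e j) :=
    fun w => funext fun j => e.dualBasis_repr w j
  refine ⟨fun t => ?_, fun U => ?_⟩
  · by_contra! h
    exact t.1.rep_nonzero (e.ext h)
  · constructor
    · rintro ⟨O, hO, rfl⟩ t ht
      obtain ⟨f, hf, ⟨d, hd'⟩, hft, hfO⟩ := isOpen_projZariski_iff.1 hO t.1 ht
      obtain ⟨P, hP⟩ := (mem_polyFun e.dualBasis).1 hf
      simp_rw [hd] at hP
      refine ⟨P, d, fun c w => ?_, by rwa [← hP], fun t' ht' => hfO _ (by rwa [hP])⟩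
      have h1 : w = fun j => e.constr ℂ w (e j) := funext fun j => (e.constr_basis ℂ w j).symm
      have h2 := hd' c (e.constr ℂ w)
      rw [hP, hP, ← h1] at h2
      rw [← h2]
      congr 2
      ext j
      simp
    · intro h
      refine ⟨{p | ∃ P : MvPolynomial n ℂ, ∃ d : ℕ,
        (∀ (c : ℂ) (w : n → ℂ), MvPolynomial.eval (c • w) P = c ^ d * MvPolynomial.eval w P) ∧
        MvPolynomial.eval (fun j => p.rep (e j)) P ≠ 0 ∧
        ∀ t' : Y, MvPolynomial.eval (fun j => t'.1.rep (e j)) P ≠ 0 → t' ∈ U}, ?_, ?_⟩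
      · rw [isOpen_projZariski_iff]
        rintro p ⟨P, d, hP, hp, hU⟩
        refine ⟨fun w => MvPolynomial.eval (fun j => w (e j)) P,
          (mem_polyFun e.dualBasis).2 ⟨P, fun w => by rw [hd]⟩, ⟨d, fun c w => hP c _⟩, hp,
          fun q hq => ⟨P, d, hP, hq, hU⟩⟩
      · ext t
        exact ⟨fun ⟨P, d, hP, hp, hU⟩ => hU t hp, fun ht => h t ht⟩

/-- The dimension of the image of a Kodaira map is the transcendence degree of the ratios of
homogeneous coordinates. -/
theorem projDim_eq_rk {K : Type} [Field K] [Algebra ℂ K] {κ : Type} [Finite κ] {n : κ → Type}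
    [∀ i, Fintype (n i)] (C : ChartSystem ℂ K n) (i : κ) (e : Module.Basis (n i) ℂ E)
    (Y : Set (ℙ ℂ (Module.Dual ℂ E)))
    (hY : ∀ p, p ∈ Y ↔ ∃ (b : C.β) (x : C.A b →ₐ[ℂ] ℂ) (l : ℂ), l ≠ 0 ∧
      ∀ j, p.rep (e j) = l * x (C.σ b i j)) :
    projDim Y = rk ℂ (ratios C.v {i}) := by
  have hr : ∀ m, C.v i m ≠ 0 →
      rk ℂ (Set.range fun j => C.v i j / C.v i m) = rk ℂ (ratios C.v {i}) := by
    intro m hm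
    refine le_antisymm (rk_mono (finite_ratios _ _) ?_)
      (rk_le_of_subset_acl (Set.finite_range _) ?_)
    · rintro _ ⟨j, rfl⟩
      exact ⟨i, Finset.mem_singleton_self i, j, m, rfl⟩
    · rintro _ ⟨i', hi', j, l, rfl⟩
      cases Finset.mem_singleton.1 hi'
      have h : ∀ j, C.v i j / C.v i m ∈ aclField ℂ (Set.range fun j => C.v i j / C.v i m) :=
        fun j => mem_aclField.2 (subset_acl _ ⟨j, rfl⟩)
      rw [← mem_aclField, ← div_div_div_cancel_right₀ hm]
      exact div_mem (h j) (h l)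
  have hσ : ∀ b m j, (C.σ b i j : K) / C.σ b i m = C.v i j / C.v i m := by
    intro b m j
    obtain ⟨l, hl, hv⟩ := C.smul b i
    rw [hv, hv, mul_div_mul_left _ _ hl]
  have h1 : ∀ (t : Y) m, t.1.rep (e m) ≠ 0 → C.v i m ≠ 0 ∧ ∀ P : MvPolynomial (n i) ℂ,
      MvPolynomial.aeval (fun j => C.v i j / C.v i m) P = 0 →
        MvPolynomial.eval (fun j => t.1.rep (e j) / t.1.rep (e m)) P = 0 := by
    rintro ⟨p, hp⟩ m hm
    obtain ⟨b, x, l, hl, hx⟩ := (hY p).1 hp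
    have hxm : x (C.σ b i m) ≠ 0 := fun h => hm (by rw [hx, h, mul_zero])
    have hσm : (C.σ b i m : K) ≠ 0 := fun h => hxm (by
      rw [(Subtype.ext h : C.σ b i m = 0), map_zero])
    refine ⟨fun h => ?_, fun P hP => ?_⟩
    · obtain ⟨l', -, hl'⟩ := C.smul b i
      exact hσm (by rw [hl', h, mul_zero])
    -- The coordinate `σ b i m` need not be invertible in the chart, so the relation between ratios
    -- is transported in homogenized form.
    · have h2 : MvPolynomial.aeval (fun j => (C.σ b i j : K)) (homog m P) = 0 := by
        rw [aeval_homog m P hσm]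
        simp_rw [hσ, hP, mul_zero]
      have h3 : MvPolynomial.aeval (C.σ b i) (homog m P) = 0 := by
        apply Subtype.val_injective
        have : (C.A b).val.comp (MvPolynomial.aeval (C.σ b i)) =
            MvPolynomial.aeval (fun j => (C.σ b i j : K)) := by
          ext j; simp
        rw [← this] at h2
        exact h2
      have h4 : MvPolynomial.aeval (fun j => x (C.σ b i j)) (homog m P) = 0 := by
        have : x.comp (MvPolynomial.aeval (C.σ b i)) =
            MvPolynomial.aeval (fun j => x (C.σ b i j)) := by
          ext j; simp
        rw [← this, AlgHom.comp_apply, h3, map_zero]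
      rw [aeval_homog m P hxm] at h4
      have h5 := (mul_eq_zero.1 h4).resolve_left (pow_ne_zero _ hxm)
      simp_rw [hx, mul_div_mul_left _ _ hl]
      exact h5
  let _ := (projZariski (Module.Dual ℂ E)).induced (Subtype.val : Y → _)
  have hz := isHomCoord_rep e Y
  refine le_antisymm (hz.krullDim_le h1 hr) ?_
  obtain ⟨b⟩ := C.nonempty
  obtain ⟨m, hm⟩ := C.exists_v_ne_zero i
  have hσm : C.σ b i m ≠ 0 := by
    intro h
    obtain ⟨l, hl, hv⟩ := C.smul b i
    have := hv m
    rw [h] at this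
    exact mul_ne_zero hl hm this.symm
  obtain ⟨D, hD, hDfg, hDinv, hDne⟩ := exists_fg_inv_mem (C.fg b) hσm
  have : Algebra.FiniteType ℂ D := D.fg_iff_finiteType.1 hDfg
  let r : D := ⟨_, hDinv⟩
  let φ : MvPolynomial (n i) ℂ →ₐ[ℂ] D :=
    MvPolynomial.aeval fun j => Subalgebra.inclusion hD (C.σ b i j) * r
  have hφ : ∀ P, (φ P : K) = MvPolynomial.aeval (fun j => C.v i j / C.v i m) P := by
    intro P
    have : D.val.comp φ = MvPolynomial.aeval (fun j => C.v i j / C.v i m) := by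
      ext j
      rw [MvPolynomial.aeval_X, ← hσ b m j, div_eq_mul_inv]
      simp [φ, r]
    rw [← this]
    rfl
  obtain ⟨g, hg, hlift⟩ := exists_notMem_ker_forall_exists_lift φ
  rw [← hr m hm]
  refine hz.le_krullDim (g := g) (fun h => hg (Subtype.ext ((hφ g).trans h))) fun s hs hsg => ?_
  obtain ⟨h, hh⟩ := hlift s (fun P hP => hs P ((hφ P).symm.trans (congrArg Subtype.val hP))) hsg
  have hx := hDne h
  set x := h.comp (Subalgebra.inclusion hD)
  have hxs : ∀ j, x (C.σ b i j) = s j * x (C.σ b i m) := by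
    intro j
    have h1 : Subalgebra.inclusion hD (C.σ b i j) =
        φ (MvPolynomial.X j) * Subalgebra.inclusion hD (C.σ b i m) := by
      apply Subtype.ext
      rw [Subalgebra.coe_mul, hφ, MvPolynomial.aeval_X, ← hσ b m j]
      exact (div_mul_cancel₀ _ fun h => hσm (Subtype.ext h)).symm
    rw [← hh j, AlgHom.comp_apply, h1, map_mul]
    rfl
  let f : Module.Dual ℂ E := e.constr ℂ fun j => x (C.σ b i j)
  have hf : ∀ j, f (e j) = x (C.σ b i j) := fun j => e.constr_basis ℂ _ j
  have hf0 : f ≠ 0 := fun h0 => hx (by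
    have := hf m
    rw [h0] at this
    exact this.symm)
  obtain ⟨a, ha⟩ := Projectivization.exists_smul_eq_mk_rep ℂ f hf0
  have hrep : ∀ j, (Projectivization.mk ℂ f hf0).rep (e j) = a * x (C.σ b i j) := by
    intro j
    rw [← ha, ← hf]
    rfl
  refine ⟨⟨_, (hY _).2 ⟨b, x, a, a.ne_zero, hrep⟩⟩, ?_, fun j => ?_⟩
  · change (Projectivization.mk ℂ f hf0).rep (e m) ≠ 0
    rw [hrep]
    exact mul_ne_zero a.ne_zero hx
  · change (Projectivization.mk ℂ f hf0).rep (e j) / (Projectivization.mk ℂ f hf0).rep (e m) = _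
    rw [hrep, hrep, mul_div_mul_left _ _ a.ne_zero, hxs]
    exact mul_div_cancel_right₀ _ hx

end ProjDim

end LinSeries

/-! ### Values of sections at closed and generic points. -/

namespace LinSeries

noncomputable section

variable {X : Scheme.{0}} [X.Over (Spec (.of ℂ))] {F : Type} [Field F] [Algebra ℂ F]

variable (X F) in
/-- A point of a complex scheme with values in a field. -/
structure FieldPoint where
  /-- the underlying point -/
  pt : X
  /-- the value at the point of a germ of a regular function -/
  hom : X.presheaf.stalk pt →+* F
  hom_const : ∀ c, hom (X.presheaf.germ ⊤ pt trivial (constHom X ⊤ c)) = algebraMap ℂ F c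

namespace FieldPoint

variable (p : FieldPoint X F)

/-- The value of a regular function. -/
def app (U : X.Opens) (hU : p.pt ∈ U) : Γ(X, U) →ₐ[ℂ] F :=
  { p.hom.comp (X.presheaf.germ U p.pt hU).hom with
    commutes' := fun c => by
      rw [← p.hom_const]
      change p.hom (X.presheaf.germ U p.pt hU (constHom X U c)) = _
      congr 1
      have h1 := X.presheaf.germ_res_apply (homOfLE (le_top : U ≤ ⊤)) p.pt hU (constHom X ⊤ c)
      rw [← h1]
      congr 1
      exact (res_res le_top le_top _).symm }

lemma app_res {U V : X.Opens} (h : V ≤ U) (hV : p.pt ∈ V) (f : Γ(X, U)) :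
    p.app V hV (res h f) = p.app U (h hV) f :=
  congrArg p.hom (X.presheaf.germ_res_apply (homOfLE h) p.pt hV f)

/-- A trivialization of a line bundle around the point. -/
def triv (L : LineBundle X) : L.ι := (L.cover p.pt).choose

lemma mem_triv (L : LineBundle X) : p.pt ∈ L.U (p.triv L) := (L.cover p.pt).choose_spec

/-- The value of a section of a line bundle, in a fixed trivialization. -/
def ev (L : LineBundle X) : L.Sec →ₗ[ℂ] F :=
  (p.app _ (p.mem_triv L)).toLinearMap.comp (LineBundle.Sec.coord (p.triv L))

/-- The cocycle condition for `a`, `b`, `a` exhibits `g b a` as an inverse. -/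
lemma app_g_ne_zero (L : LineBundle X) {a b : L.ι} (h : p.pt ∈ L.U a ⊓ L.U b) :
    p.app _ h (L.g a b) ≠ 0 := by
  intro h0
  have h' : p.pt ∈ L.U a ⊓ L.U b ⊓ L.U a := ⟨h, h.1⟩
  have := congrArg (p.app _ h') (L.cocycle a b a)
  rw [map_mul, app_res, app_res, app_res, L.g_self, map_one, h0, zero_mul] at this
  exact zero_ne_one this

/-- A change of trivialization scales all values by one nonzero factor, so zeros and ratios do not
depend on the trivialization chosen in `ev`. -/
lemma app_coord (L : LineBundle X) (a : L.ι) (ha : p.pt ∈ L.U a) :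
    ∃ l : F, l ≠ 0 ∧ ∀ s : L.Sec, p.app _ ha (s.coord a) = l * p.ev L s := by
  have h : p.pt ∈ L.U a ⊓ L.U (p.triv L) := ⟨ha, p.mem_triv L⟩
  refine ⟨p.app _ h (L.g a (p.triv L)), p.app_g_ne_zero L h, fun s => ?_⟩
  have := congrArg (p.app _ h) (s.2 a (p.triv L))
  rw [map_mul, app_res, app_res] at this
  exact this

lemma ev_tensorSection {κ : Type} [Fintype κ] (L : κ → LineBundle X) :
    ∃ l : F, l ≠ 0 ∧ ∀ s : ∀ j, (L j).Sec,
      p.ev (LineBundle.tensor L) (tensorSection s) = l * ∏ j, p.ev (L j) (s j) := by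
  let a : ∀ j, (L j).ι := p.triv (LineBundle.tensor L)
  have ha : p.pt ∈ ⨅ j, (L j).U (a j) := p.mem_triv (LineBundle.tensor L)
  choose l hl hl' using fun j => p.app_coord (L j) (a j) (iInf_le (fun j => (L j).U (a j)) j ha)
  refine ⟨∏ j, l j, Finset.prod_ne_zero_iff.2 fun j _ => hl j, fun s => ?_⟩
  rw [← Finset.prod_mul_distrib]
  change p.app _ ha (∏ j, res _ ((s j).coord (a j))) = _
  rw [map_prod]
  exact Finset.prod_congr rfl fun j _ => by rw [app_res, hl']

end FieldPoint

section ClosedPoint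

lemma germ_constHom (x : X) (c : ℂ) : X.residue x (X.presheaf.germ ⊤ x trivial (constHom X ⊤ c)) =
    Spec.preimage (X.fromSpecResidueField x ≫ X ↘ Spec (.of ℂ)) c := by
  let f := X ↘ Spec (.of ℂ)
  have key : (Scheme.ΓSpecIso (.of ℂ)).inv ≫ f.appTop ≫ X.presheaf.germ ⊤ x trivial ≫
      X.residue x = Spec.preimage (X.fromSpecResidueField x ≫ f) := by
    rw [← cancel_mono (Scheme.ΓSpecIso (X.residueField x)).inv,
      Scheme.ΓSpecIso_inv_naturality (Spec.preimage (X.fromSpecResidueField x ≫ f)),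
      Spec.map_preimage, Scheme.Hom.comp_appTop, Scheme.fromSpecResidueField,
      Scheme.Hom.comp_appTop, Scheme.fromSpecStalk_appTop]
    simp only [Category.assoc]
    rw [Scheme.ΓSpecIso_inv_naturality]
    congr 3
  rw [← key]
  change X.residue x (X.presheaf.germ ⊤ x trivial _) = X.residue x (X.presheaf.germ ⊤ x trivial _)
  refine congrArg (fun a => X.residue x (X.presheaf.germ ⊤ x trivial a)) ?_
  exact DFunLike.congr_fun (congrArg CommRingCat.Hom.hom (X.presheaf.map_id _)) _

variable [LocallyOfFiniteType (X ↘ Spec (.of ℂ))]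

/-- The complex point given by a closed point. -/
def closedPt (x : Pt X) : FieldPoint X ℂ where
  pt := x.1
  hom := (residueFieldIsoBase (X ↘ Spec (.of ℂ)) x.1 x.2).hom.hom.comp (X.residue x.1).hom
  hom_const c := by
    change (residueFieldIsoBase (X ↘ Spec (.of ℂ)) x.1 x.2).hom.hom (X.residue _ _) = _
    rw [germ_constHom]
    have : (residueFieldIsoBase (X ↘ Spec (.of ℂ)) x.1 x.2).inv =
      Spec.preimage (X.fromSpecResidueField x.1 ≫ X ↘ Spec (.of ℂ)) := rfl
    rw [← this]
    exact DFunLike.congr_fun (congrArg CommRingCat.Hom.hom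
      (residueFieldIsoBase (X ↘ Spec (.of ℂ)) x.1 x.2).inv_hom_id) c

lemma closedPt_app_eq_zero_iff (x : Pt X) {U : X.Opens} (hU : x.1 ∈ U) (f : Γ(X, U)) :
    (closedPt x).app U hU f = 0 ↔ X.evaluation U x.1 hU f = 0 := by
  change (residueFieldIsoBase (X ↘ Spec (.of ℂ)) x.1 x.2).hom.hom (X.evaluation U x.1 hU f) = 0 ↔ _
  exact map_eq_zero _

lemma mem_kodaira_iff {L : LineBundle X} {E : Submodule ℂ L.Sec} {s : E} {x : Pt X} :
    s ∈ kodaira E x ↔ (closedPt x).ev L s = 0 := by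
  constructor
  · intro h
    exact (closedPt_app_eq_zero_iff x _ _).2 (h _ ((closedPt x).mem_triv L))
  · intro h a ha
    obtain ⟨l, -, hl⟩ := (closedPt x).app_coord L a ha
    rw [← closedPt_app_eq_zero_iff, hl, h, mul_zero]

end ClosedPoint

end

end LinSeries

/-! ### The chart system of a collection of linear series. -/

namespace LinSeries

noncomputable section

variable {X : Scheme.{0}} [X.Over (Spec (.of ℂ))]

section Affine

variable [LocallyOfFiniteType (X ↘ Spec (.of ℂ))]

lemma finiteType_sections {U : X.Opens} (hU : IsAffineOpen U) : Algebra.FiniteType ℂ Γ(X, U) := by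
  have h1 := (X ↘ Spec (.of ℂ)).finiteType_appLE (isAffineOpen_top _) hU le_top
  have h2 : (Scheme.ΓSpecIso (.of ℂ)).inv.hom.FiniteType :=
    RingHom.FiniteType.of_surjective _
      (ConcreteCategory.bijective_of_isIso (Scheme.ΓSpecIso (.of ℂ)).inv).2
  exact h1.comp h2

/-- The kernel is a closed point of `U`, which is closed in `X` because `X` is Jacobson. Both
homomorphisms kill this kernel and fix the constants, so they agree. -/
lemma exists_closedPt_app_eq {U : X.Opens} (hU : IsAffineOpen U) (h : Γ(X, U) →ₐ[ℂ] ℂ) :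
    ∃ (x : Pt X) (hx : x.1 ∈ U), (closedPt x).app U hx = h := by
  have : JacobsonSpace X := LocallyOfFiniteType.jacobsonSpace (X ↘ Spec (.of ℂ))
  have hsurj : Function.Surjective h := fun c => ⟨algebraMap ℂ _ c, h.commutes c⟩
  have hmax : (RingHom.ker h.toRingHom).IsMaximal := RingHom.ker_isMaximal_of_surjective _ hsurj
  let P : PrimeSpectrum Γ(X, U) := ⟨RingHom.ker h.toRingHom, hmax.isPrime⟩
  have hcl : hU.fromSpec P ∈ closedPoints X := by
    have h1 := hU.fromSpec.isOpenEmbedding.preimage_closedPoints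
    have h2 : P ∈ closedPoints (Spec Γ(X, U)) :=
      (PrimeSpectrum.isClosed_singleton_iff_isMaximal P).2 hmax
    rw [← h1] at h2
    exact h2
  have hmem : hU.fromSpec P ∈ U := by
    have : hU.fromSpec P ∈ (U : Set X) := hU.range_fromSpec ▸ Set.mem_range_self P
    exact this
  refine ⟨⟨_, hcl⟩, hmem, ?_⟩
  set x : Pt X := ⟨hU.fromSpec P, hcl⟩
  have hker : ∀ f, h f = 0 → (closedPt x).app U hmem f = 0 := by
    intro f hf
    rw [closedPt_app_eq_zero_iff, Scheme.evaluation_eq_zero_iff_notMem_basicOpen]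
    intro hx
    have h3 : P ∈ hU.fromSpec ⁻¹ᵁ X.basicOpen f := hx
    rw [hU.fromSpec_preimage_basicOpen] at h3
    exact h3 hf
  ext f
  have h4 := hker (f - algebraMap ℂ _ (h f)) (by rw [map_sub, h.commutes]; exact sub_self _)
  rw [map_sub, AlgHom.commutes, sub_eq_zero] at h4
  exact h4

end Affine

section Generic

variable [IsIntegral X]

instance algebraFunctionField : Algebra ℂ X.functionField :=
  ((X.presheaf.germ ⊤ (genericPoint X) trivial).hom.comp (constHom X ⊤)).toAlgebra

variable (X) in
/-- The generic point. -/
def genericPt : FieldPoint X X.functionField where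
  pt := genericPoint X
  hom := RingHom.id _
  hom_const _ := rfl

lemma genericPt_mem {U : X.Opens} (hU : (U : Set X).Nonempty) : (genericPt X).pt ∈ U :=
  ((genericPoint_spec X).mem_open_set_iff U.isOpen).2 (by simpa using hU)

lemma genericPt_app_injective {U : X.Opens} (hU : (genericPt X).pt ∈ U) :
    Function.Injective ((genericPt X).app U hU) :=
  germ_injective_of_isIntegral _ _ hU

end Generic

open TrRank

/-- The function field, an affine cover and the homogeneous coordinates of a finite collection of
base-point free linear series with chosen bases form a chart system. -/
theorem exists_chartSystem [IsIntegral X] [LocallyOfFiniteType (X ↘ Spec (.of ℂ))]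
    [QuasiCompact (X ↘ Spec (.of ℂ))] {κ : Type} [Finite κ] (L : κ → LineBundle X)
    (E : ∀ i, Submodule ℂ (L i).Sec) (hbpf : ∀ i, BasePointFree (E i)) {n : κ → Type}
    (e : ∀ i, Module.Basis (n i) ℂ (E i)) :
    ∃ C : ChartSystem ℂ X.functionField n,
      (∀ i j, C.v i j = (genericPt X).ev (L i) (e i j).1) ∧
      (∀ x : Pt X, ∃ (b : C.β) (h : C.A b →ₐ[ℂ] ℂ), ∀ i, ∃ l : ℂ, l ≠ 0 ∧
        ∀ j, h (C.σ b i j) = l * (closedPt x).ev (L i) (e i j).1) ∧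
      ∀ (b : C.β) (h : C.A b →ₐ[ℂ] ℂ), ∃ x : Pt X, ∀ i, ∃ l : ℂ, l ≠ 0 ∧
        ∀ j, h (C.σ b i j) = l * (closedPt x).ev (L i) (e i j).1 := by
  have hcomp : CompactSpace X := by
    have := QuasiCompact.isCompact_preimage (f := X ↘ Spec (.of ℂ)) _ isOpen_univ isCompact_univ
    exact ⟨this⟩
  have hcov : ∀ x : X, ∃ (U : X.Opens) (a : ∀ i, (L i).ι), IsAffineOpen U ∧ x ∈ U ∧
      ∀ i, U ≤ (L i).U (a i) := by
    intro x
    have := Fintype.ofFinite κ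
    obtain ⟨a, ha⟩ := exists_mem_iInf L x
    obtain ⟨U, hU, hxU, hle⟩ := exists_isAffineOpen_mem_and_subset ha
    exact ⟨U, a, hU, hxU, fun i => le_trans hle (iInf_le _ i)⟩
  choose U a hU hxU hUa using hcov
  obtain ⟨t, -, ht⟩ := isCompact_univ.elim_nhds_subcover (fun x : X => (U x : Set X))
    fun x _ => (U x).isOpen.mem_nhds (hxU x)
  have hg : ∀ b : X, (genericPt X).pt ∈ U b := fun b => genericPt_mem ⟨b, hxU b⟩
  let φ (b : X) : Γ(X, U b) →ₐ[ℂ] X.functionField := (genericPt X).app (U b) (hg b)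
  have hφ : ∀ b, Function.Injective (φ b) := fun b => genericPt_app_injective (hg b)
  let q (b : X) : Γ(X, U b) ≃ₐ[ℂ] (φ b).range := AlgEquiv.ofInjective (φ b) (hφ b)
  let f (b : X) (i : κ) (j : n i) : Γ(X, U b) := res (hUa b i) ((e i j).1.coord (a b i))
  have hft : ∀ b, Algebra.FiniteType ℂ (φ b).range := fun b =>
    have := finiteType_sections (hU b)
    Algebra.FiniteType.equiv this (q b)
  have hpt : ∀ (b : X) (x : Pt X) (hx : x.1 ∈ U b) (i : κ), ∃ l : ℂ, l ≠ 0 ∧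
      ∀ j, (closedPt x).app _ hx (f b i j) = l * (closedPt x).ev (L i) (e i j).1 := by
    intro b x hx i
    obtain ⟨l, hl, hl'⟩ := (closedPt x).app_coord (L i) (a b i) (hUa b i hx)
    exact ⟨l, hl, fun j => ((closedPt x).app_res _ hx _).trans (hl' _)⟩
  have hback : ∀ (b : X) (h : (φ b).range →ₐ[ℂ] ℂ), ∃ x : Pt X, ∀ i, ∃ l : ℂ, l ≠ 0 ∧
      ∀ j, h (q b (f b i j)) = l * (closedPt x).ev (L i) (e i j).1 := by
    intro b h
    obtain ⟨x, hx, hxh⟩ := exists_closedPt_app_eq (hU b) (h.comp (q b).toAlgHom)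
    refine ⟨x, fun i => ?_⟩
    obtain ⟨l, hl, hl'⟩ := hpt b x hx i
    refine ⟨l, hl, fun j => ?_⟩
    rw [← hl', hxh]
    rfl
  have ht' : Nonempty t := by
    obtain ⟨b, hb, -⟩ := Set.mem_iUnion₂.1 (ht (Set.mem_univ (genericPoint X)))
    exact ⟨b, hb⟩
  refine ⟨{
    v := fun i j => (genericPt X).ev (L i) (e i j).1
    β := t
    finite := inferInstance
    nonempty := ht'
    A := fun b => (φ b).range
    fg := fun b => (φ b).range.fg_iff_finiteType.2 (hft b)
    σ := fun b i j => q b (f b i j)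
    smul := fun b i => ?_
    span := fun b i => ?_ }, fun _ _ => rfl, fun x => ?_, fun b h => hback b h⟩
  · obtain ⟨l, hl, hl'⟩ := (genericPt X).app_coord (L i) (a b i) (hUa b i (hg b))
    exact ⟨l, hl, fun j => ((genericPt X).app_res _ (hg b) _).trans (hl' _)⟩
  -- If the coordinates generated a proper ideal, they would vanish together at a closed point, a
  -- base point of the series.
  · by_contra hne
    have := hft b
    obtain ⟨h, hh⟩ := exists_algHom_ker_ge (k := ℂ) _ hne
    obtain ⟨x, hx⟩ := hback b h
    obtain ⟨l, hl, hx⟩ := hx i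
    obtain ⟨s, hs⟩ := hbpf i x
    refine hs (mem_kodaira_iff.2 ?_)
    have h1 : ((closedPt x).ev (L i)).comp (E i).subtype = 0 := by
      refine (e i).ext fun j => ?_
      have h2 := hx j
      rw [hh _ (Ideal.subset_span ⟨j, rfl⟩)] at h2
      exact (mul_eq_zero.1 h2.symm).resolve_left hl
    exact LinearMap.congr_fun h1 s
  · obtain ⟨b, hb, hxb⟩ := Set.mem_iUnion₂.1 (ht (Set.mem_univ x.1))
    refine ⟨⟨b, hb⟩, ((closedPt x).app (U b) hxb).comp (q b).symm.toAlgHom, fun i => ?_⟩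
    obtain ⟨l, hl, hl'⟩ := hpt b x hxb i
    refine ⟨l, hl, fun j => ?_⟩
    rw [← hl']
    change (closedPt x).app (U b) hxb ((q b).symm (q b (f b i j))) = _
    rw [AlgEquiv.symm_apply_apply]

end

end LinSeries

/-! ### Kodaira maps of products: fibres and dimension of the image. -/

namespace LinSeries

open TrRank

section Functional

lemma exists_eq_smul_of_ker_le {k V : Type*} [Field k] [AddCommGroup V] [Module k V]
    {f g : V →ₗ[k] k} (h : LinearMap.ker f ≤ LinearMap.ker g) (hf : f ≠ 0) :
    ∃ c : k, ∀ s, g s = c * f s := by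
  obtain ⟨s₀, hs₀⟩ : ∃ s, f s ≠ 0 := by
    by_contra! h0
    exact hf (LinearMap.ext h0)
  refine ⟨g s₀ / f s₀, fun s => ?_⟩
  have h1 : s - (f s / f s₀) • s₀ ∈ LinearMap.ker f := by
    rw [LinearMap.mem_ker, map_sub, map_smul, smul_eq_mul, div_mul_cancel₀ _ hs₀, sub_self]
  have h2 := h h1
  rw [LinearMap.mem_ker, map_sub, map_smul, smul_eq_mul, sub_eq_zero] at h2
  rw [h2]
  ring

end Functional

variable {X : Scheme.{0}} [X.Over (Spec (.of ℂ))]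

section ClosedPoint

variable [LocallyOfFiniteType (X ↘ Spec (.of ℂ))]

lemma kodaira_eq_ker {L : LineBundle X} (E : Submodule ℂ L.Sec) (x : Pt X) :
    kodaira E x = LinearMap.ker (((closedPt x).ev L).comp E.subtype) := by
  ext s
  exact mem_kodaira_iff

lemma BasePointFree.exists_ev_ne_zero {L : LineBundle X} {E : Submodule ℂ L.Sec}
    (h : BasePointFree E) (x : Pt X) : ∃ s : E, (closedPt x).ev L s ≠ 0 :=
  let ⟨s, hs⟩ := h x
  ⟨s, fun h0 => hs (mem_kodaira_iff.2 h0)⟩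

lemma exists_basis_ev_ne_zero {L : LineBundle X} {E : Submodule ℂ L.Sec} (h : BasePointFree E)
    {n : Type*} (e : Module.Basis n ℂ E) (x : Pt X) : ∃ j, (closedPt x).ev L (e j) ≠ 0 := by
  by_contra! h0
  obtain ⟨s, hs⟩ := h.exists_ev_ne_zero x
  have h1 : ((closedPt x).ev L).comp E.subtype = 0 := e.ext h0
  exact hs (LinearMap.congr_fun h1 s)

lemma exists_smul_of_kodaira_eq {L : LineBundle X} {E : Submodule ℂ L.Sec} (h : BasePointFree E)
    {x a : Pt X} (hxa : kodaira E x = kodaira E a) :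
    ∃ c : ℂ, ∀ s ∈ E, (closedPt x).ev L s = c * (closedPt a).ev L s := by
  rw [kodaira_eq_ker, kodaira_eq_ker] at hxa
  obtain ⟨s, hs⟩ := h.exists_ev_ne_zero a
  obtain ⟨c, hc⟩ := exists_eq_smul_of_ker_le hxa.ge fun h0 => hs (LinearMap.congr_fun h0 s)
  exact ⟨c, fun s hs => hc ⟨s, hs⟩⟩

lemma basePointFree_prodSeries {κ : Type} [Fintype κ] {L : κ → LineBundle X}
    {E : ∀ j, Submodule ℂ (L j).Sec} (h : ∀ j, BasePointFree (E j)) :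
    BasePointFree (prodSeries E) := by
  intro x
  choose s hs using fun j => (h j).exists_ev_ne_zero x
  obtain ⟨l, hl, hl'⟩ := (closedPt x).ev_tensorSection L
  refine ⟨⟨tensorSection fun j => (s j).1, Submodule.subset_span ⟨s, rfl⟩⟩, fun h0 => ?_⟩
  have h1 := mem_kodaira_iff.1 h0
  rw [hl'] at h1
  exact mul_ne_zero hl (Finset.prod_ne_zero_iff.2 fun j _ => hs j) h1

variable {κ : Type} {L : κ → LineBundle X} {E : ∀ i, Submodule ℂ (L i).Sec}
  (hbpf : ∀ i, BasePointFree (E i)) {n : κ → Type} (e : ∀ i, Module.Basis (n i) ℂ (E i))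
  (J : Finset κ)
include hbpf

/-- The fibres of the Kodaira map of a product of linear series are the intersections of fibres of
the Kodaira maps of the factors. -/
lemma mem_fibre_iff {x a : Pt X} : x ∈ fibre E J a ↔ ∀ i ∈ J, ∀ j l,
    (closedPt x).ev (L i) (e i j) * (closedPt a).ev (L i) (e i l) =
      (closedPt x).ev (L i) (e i l) * (closedPt a).ev (L i) (e i j) := by
  classical
  obtain ⟨lx, hlx, hx⟩ := (closedPt x).ev_tensorSection fun j : J => L j
  obtain ⟨la, hla, ha⟩ := (closedPt a).ev_tensorSection fun j : J => L j
  constructor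
  · intro h i hi j l
    obtain ⟨c, hc⟩ := exists_smul_of_kodaira_eq (basePointFree_prodSeries fun j : J => hbpf j) h
    -- All factors but the `i`-th are frozen at sections nonzero at `x`. By proportionality they are
    -- nonzero at `a` as well, so they cancel.
    choose r hr using fun j : J => (hbpf j).exists_ev_ne_zero x
    let T (s : ∀ j : J, E j) : (LineBundle.tensor fun j : J => L j).Sec :=
      tensorSection fun j => (s j).1
    have hT : ∀ s, T s ∈ seriesJ E J := fun s => Submodule.subset_span ⟨s, rfl⟩
    have hprod : ∀ (y : Pt X) (u : E i), ∏ j : J, (closedPt y).ev (L j)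
        (Function.update r ⟨i, hi⟩ u j).1 = (closedPt y).ev (L i) u *
          ∏ j ∈ Finset.univ.erase (⟨i, hi⟩ : J), (closedPt y).ev (L j) (r j) := by
      intro y u
      rw [← Finset.mul_prod_erase _ _ (Finset.mem_univ ⟨i, hi⟩), Function.update_self]
      congr 1
      exact Finset.prod_congr rfl fun j hj => by
        rw [Function.update_of_ne (Finset.ne_of_mem_erase hj)]
    have hPx : ∏ j ∈ Finset.univ.erase (⟨i, hi⟩ : J), (closedPt x).ev (L j) (r j) ≠ 0 :=
      Finset.prod_ne_zero_iff.2 fun j _ => hr j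
    have hPa : ∏ j ∈ Finset.univ.erase (⟨i, hi⟩ : J), (closedPt a).ev (L j) (r j) ≠ 0 := by
      have h1 := hc _ (hT r)
      rw [hx, ha] at h1
      have h2 : lx * ∏ j : J, (closedPt x).ev (L j) (r j) ≠ 0 :=
        mul_ne_zero hlx (Finset.prod_ne_zero_iff.2 fun j _ => hr j)
      rw [h1] at h2
      have h3 := Finset.prod_ne_zero_iff.1 (right_ne_zero_of_mul (right_ne_zero_of_mul h2))
      exact Finset.prod_ne_zero_iff.2 fun j _ => h3 j (Finset.mem_univ _)
    have key : (closedPt x).ev _ (T (Function.update r ⟨i, hi⟩ (e i j))) *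
        (closedPt a).ev _ (T (Function.update r ⟨i, hi⟩ (e i l))) =
        (closedPt x).ev _ (T (Function.update r ⟨i, hi⟩ (e i l))) *
        (closedPt a).ev _ (T (Function.update r ⟨i, hi⟩ (e i j))) := by
      rw [hc _ (hT _), hc _ (hT _)]
      ring
    rw [hx, hx, ha, ha, hprod, hprod, hprod, hprod] at key
    have hne := mul_ne_zero (mul_ne_zero hlx hPx) (mul_ne_zero hla hPa)
    refine mul_left_cancel₀ hne ?_
    linear_combination key
  · intro h
    have hc : ∀ j : J, ∃ c : ℂ, c ≠ 0 ∧ ∀ s : E j,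
        (closedPt x).ev (L j) s = c * (closedPt a).ev (L j) s := by
      intro j
      obtain ⟨l, hl⟩ := exists_basis_ev_ne_zero (hbpf j) (e j) a
      have h1 : ∀ s : E j, (closedPt x).ev (L j) s =
          ((closedPt x).ev (L j) (e j l) / (closedPt a).ev (L j) (e j l)) *
            (closedPt a).ev (L j) s := by
        have : ((closedPt x).ev (L j)).comp (E j).subtype =
            ((closedPt x).ev (L j) (e j l) / (closedPt a).ev (L j) (e j l)) •
              ((closedPt a).ev (L j)).comp (E j).subtype := by
          refine (e j).ext fun i => ?_
          have := h j j.2 i l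
          simp only [LinearMap.comp_apply, Submodule.subtype_apply, LinearMap.smul_apply,
            smul_eq_mul]
          field_simp
          exact this
        exact fun s => LinearMap.congr_fun this s
      refine ⟨_, fun h0 => ?_, h1⟩
      obtain ⟨s, hs⟩ := (hbpf j).exists_ev_ne_zero x
      exact hs (by rw [h1, h0, zero_mul])
    choose c hc0 hc using hc
    have hle : ∀ y ∈ seriesJ E J, (closedPt x).ev _ y =
        (lx * (∏ j, c j) / la) * (closedPt a).ev _ y := by
      intro y hy
      refine Submodule.span_induction ?_ ?_ ?_ ?_ hy
      · rintro _ ⟨s, rfl⟩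
        rw [hx, ha]
        simp_rw [hc, Finset.prod_mul_distrib]
        field_simp
      · rw [map_zero, map_zero, mul_zero]
      · intro y z _ _ hy hz
        rw [map_add, map_add, hy, hz, mul_add]
      · intro r y _ hy
        rw [map_smul, map_smul, hy, smul_eq_mul, smul_eq_mul]
        ring
    change kodaira _ _ = kodaira _ _
    ext s
    rw [mem_kodaira_iff, mem_kodaira_iff, hle _ s.2]
    have : lx * (∏ j, c j) / la ≠ 0 :=
      div_ne_zero (mul_ne_zero hlx (Finset.prod_ne_zero_iff.2 fun j _ => hc0 j)) hla
    rw [mul_eq_zero, or_iff_right this]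

end ClosedPoint

section Generic

variable [IsIntegral X]

/-- On an integral scheme regular functions embed in the function field, and one trivialization at
the generic point determines the values in all others. -/
lemma ev_genericPt_injective (L : LineBundle X) : Function.Injective ((genericPt X).ev L) := by
  rw [injective_iff_map_eq_zero]
  intro s hs
  refine Subtype.ext (funext fun a => ?_)
  change s.coord a = 0
  rcases (L.U a : Set X).eq_empty_or_nonempty with h | h
  · have : L.U a = ⊥ := Opens.ext h
    have hsub : Subsingleton Γ(X, L.U a) := by
      rw [this]
      infer_instance
    exact Subsingleton.elim _ _
  · have hg := genericPt_mem h
    obtain ⟨l, -, hl⟩ := (genericPt X).app_coord L a hg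
    refine genericPt_app_injective hg ?_
    rw [hl, hs, mul_zero, map_zero]

/-- Evaluation at the generic point embeds the product series in the function field, and by
multilinearity the image lies in the span of finitely many products of basis sections. -/
lemma finiteDimensional_prodSeries {κ : Type} [Fintype κ] {L : κ → LineBundle X}
    (E : ∀ j, Submodule ℂ (L j).Sec) [∀ j, FiniteDimensional ℂ (E j)] :
    FiniteDimensional ℂ (prodSeries E) := by
  classical
  let e := fun j => Module.finBasis ℂ (E j)
  obtain ⟨l, -, hl⟩ := (genericPt X).ev_tensorSection L
  let v (p : ∀ j, Fin (Module.finrank ℂ (E j))) : X.functionField :=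
    l * ∏ j, (genericPt X).ev (L j) (e j (p j))
  have hmem : ∀ y ∈ prodSeries E, (genericPt X).ev _ y ∈ Submodule.span ℂ (Set.range v) := by
    intro y hy
    refine Submodule.span_induction ?_ ?_ ?_ ?_ hy
    · rintro _ ⟨s, rfl⟩
      have h1 : ∀ j, (genericPt X).ev (L j) (s j) =
          ∑ i, (e j).repr (s j) i • (genericPt X).ev (L j) (e j i) := by
        intro j
        conv_lhs => rw [← (e j).sum_repr (s j)]
        simp [-Module.Basis.sum_repr]
      rw [hl]
      simp_rw [h1]
      rw [Finset.prod_univ_sum, Finset.mul_sum]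
      refine Submodule.sum_mem _ fun p _ => ?_
      rw [Finset.prod_smul, mul_smul_comm]
      exact Submodule.smul_mem _ _ (Submodule.subset_span ⟨p, rfl⟩)
    · rw [map_zero]
      exact zero_mem _
    · intro y z _ _ hy hz
      rw [map_add]
      exact add_mem hy hz
    · intro r y _ hy
      rw [map_smul]
      exact Submodule.smul_mem _ _ hy
  let f : prodSeries E →ₗ[ℂ] Submodule.span ℂ (Set.range v) :=
    (((genericPt X).ev _).comp (prodSeries E).subtype).codRestrict _ fun y => hmem y.1 y.2
  have := FiniteDimensional.span_of_finite ℂ (Set.finite_range v)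
  refine Module.Finite.of_injective f fun y z hyz => Subtype.ext ?_
  exact ev_genericPt_injective _ (congrArg Subtype.val hyz)

variable [LocallyOfFiniteType (X ↘ Spec (.of ℂ))] [QuasiCompact (X ↘ Spec (.of ℂ))]

/-- The dimension of the image of the Kodaira map in terms of the function field. -/
theorem tau_eq_rk {L : LineBundle X} {E : Submodule ℂ L.Sec} (hbpf : BasePointFree E)
    {n : Type} [Fintype n] (e : Module.Basis n ℂ E) :
    (∃ m, (genericPt X).ev L (e m) ≠ 0) ∧
    tau E = rk ℂ (ratios (fun (_ : Unit) j => (genericPt X).ev L (e j)) {()}) := by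
  obtain ⟨C, hv, hpt, hback⟩ := exists_chartSystem (fun _ : Unit => L) (fun _ => E)
    (fun _ => hbpf) (fun _ => e)
  have hv' : C.v = fun (_ : Unit) j => (genericPt X).ev L (e j) := funext₂ hv
  refine ⟨(C.exists_v_ne_zero ()).imp fun j hj => hv () j ▸ hj, ?_⟩
  -- Two nonzero functionals with the same kernel are proportional, so the image consists of the
  -- classes of evaluations at closed points.
  have hY : ∀ p, p ∈ kodairaImage E ↔ ∃ (b : C.β) (x : C.A b →ₐ[ℂ] ℂ) (l : ℂ), l ≠ 0 ∧
      ∀ j, p.rep (e j) = l * x (C.σ b () j) := by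
    intro p
    constructor
    · rintro ⟨x, hx⟩
      obtain ⟨b, h, hh⟩ := hpt x
      obtain ⟨l, hl, hh⟩ := hh ()
      rw [kodaira_eq_ker] at hx
      obtain ⟨s, hs⟩ := hbpf.exists_ev_ne_zero x
      obtain ⟨c, hc⟩ := exists_eq_smul_of_ker_le hx.ge fun h0 => hs (LinearMap.congr_fun h0 s)
      have hc0 : c ≠ 0 := by
        rintro rfl
        exact p.rep_nonzero (LinearMap.ext fun s => (hc s).trans (zero_mul _))
      refine ⟨b, h, c / l, div_ne_zero hc0 hl, fun j => ?_⟩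
      rw [hc, hh]
      field_simp
      rfl
    · rintro ⟨b, h, l, hl, hp⟩
      obtain ⟨x, hx⟩ := hback b h
      obtain ⟨c, hc, hx⟩ := hx ()
      refine ⟨x, ?_⟩
      rw [kodaira_eq_ker]
      have h1 : p.rep = (l * c) • ((closedPt x).ev L).comp E.subtype := by
        refine e.ext fun j => ?_
        rw [hp, hx, ← mul_assoc]
        rfl
      rw [h1, LinearMap.ker_smul _ _ (mul_ne_zero hl hc)]
  rw [tau, projDim_eq_rk C () e _ hY, hv']
  rfl

variable {κ : Type} [Finite κ] {L : κ → LineBundle X} {E : ∀ i, Submodule ℂ (L i).Sec}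
  [∀ i, FiniteDimensional ℂ (E i)]

/-- The dimension of the image of the Kodaira map of a product of linear series. -/
theorem tau_seriesJ (hbpf : ∀ i, BasePointFree (E i)) {n : κ → Type} [∀ i, Fintype (n i)]
    (e : ∀ i, Module.Basis (n i) ℂ (E i)) (J : Finset κ) :
    tau (seriesJ E J) = rk ℂ (ratios (fun i j => (genericPt X).ev (L i) (e i j)) J) := by
  classical
  set v : ∀ i, n i → X.functionField := fun i j => (genericPt X).ev (L i) (e i j)
  have hfd : FiniteDimensional ℂ (seriesJ E J) := finiteDimensional_prodSeries _
  let e' := Module.finBasis ℂ (seriesJ E J)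
  have hbpf' : BasePointFree (seriesJ E J) := basePointFree_prodSeries fun j : J => hbpf j
  obtain ⟨⟨m', hm'⟩, htau⟩ := tau_eq_rk hbpf' e'
  rw [htau]
  set v' : Unit → _ → X.functionField := fun _ j => (genericPt X).ev _ (e' j).1
  choose m hm using fun i => (tau_eq_rk (hbpf i) (e i)).1
  obtain ⟨l, hl, hT⟩ := (genericPt X).ev_tensorSection fun j : J => L j
  refine le_antisymm (rk_le_of_subset_acl (finite_ratios _ _) ?_)
    (rk_le_of_subset_acl (finite_ratios _ _) ?_)
  -- Divided by a product of reference coordinates, every section of the product series becomes a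
  -- polynomial in the ratios with index in `J`.
  · obtain ⟨G, hG⟩ : ∃ G, G = aclField ℂ (ratios v J) := ⟨_, rfl⟩
    have hGm : ∀ x, x ∈ G ↔ x ∈ acl ℂ (ratios v J) := fun x => hG ▸ mem_aclField
    set N := l * ∏ j : J, v j (m j)
    have hN : N ≠ 0 := mul_ne_zero hl (Finset.prod_ne_zero_iff.2 fun j _ => hm j)
    have hs : ∀ (j : J) (s : E j), (genericPt X).ev (L j) s / v j (m j) ∈ G := by
      intro j s
      rw [← (e j).sum_repr s, Submodule.coe_sum, map_sum, Finset.sum_div]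
      refine sum_mem fun i _ => ?_
      rw [Submodule.coe_smul, map_smul, smul_div_assoc]
      exact G.smul_mem ((hGm _).2 (subset_acl _ ⟨j, j.2, i, m j, rfl⟩))
    have hy : ∀ y ∈ seriesJ E J, (genericPt X).ev _ y / N ∈ G := by
      intro y hy
      refine Submodule.span_induction ?_ ?_ ?_ ?_ hy
      · rintro _ ⟨s, rfl⟩
        rw [hT, mul_div_mul_left _ _ hl, ← Finset.prod_div_distrib]
        exact prod_mem fun j _ => hs j (s j)
      · rw [map_zero, zero_div]
        exact zero_mem _
      · intro y z _ _ hy hz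
        rw [map_add, add_div]
        exact add_mem hy hz
      · intro r y _ hy
        rw [map_smul, smul_div_assoc]
        exact G.smul_mem hy
    rintro _ ⟨_, -, j, i, rfl⟩
    rw [← hGm, ← div_div_div_cancel_right₀ hN]
    exact div_mem (hy _ (e' j).2) (hy _ (e' i).2)
  · obtain ⟨G, hG⟩ : ∃ G, G = aclField ℂ (ratios v' {()}) := ⟨_, rfl⟩
    have hGm : ∀ x, x ∈ G ↔ x ∈ acl ℂ (ratios v' {()}) := fun x => hG ▸ mem_aclField
    have hy : ∀ y ∈ seriesJ E J, (genericPt X).ev _ y / v' () m' ∈ G := by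
      intro y hy
      have h1 : y = ((⟨y, hy⟩ : seriesJ E J) : (LineBundle.tensor fun j : J => L j).Sec) := rfl
      rw [h1, ← e'.sum_repr ⟨y, hy⟩, Submodule.coe_sum, map_sum, Finset.sum_div]
      refine sum_mem fun i _ => ?_
      rw [Submodule.coe_smul, map_smul, smul_div_assoc]
      exact G.smul_mem ((hGm _).2 (subset_acl _ ⟨(), Finset.mem_singleton_self _, i, m', rfl⟩))
    rintro _ ⟨i, hi, j, j', rfl⟩
    refine (hGm _).1 ?_
    -- Conversely, a ratio of two coordinates of one factor is the ratio of two product sections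
    -- that differ only in that factor.
    let T (u : E i) : (LineBundle.tensor fun j : J => L j).Sec := tensorSection fun j : J =>
      (Function.update (fun j : J => e j (m j)) ⟨i, hi⟩ u j).1
    have hTm : ∀ u, T u ∈ seriesJ E J := fun u => Submodule.subset_span ⟨_, rfl⟩
    set N := l * ∏ j ∈ Finset.univ.erase (⟨i, hi⟩ : J), v j (m j)
    have hN : N ≠ 0 := mul_ne_zero hl (Finset.prod_ne_zero_iff.2 fun j _ => hm j)
    have hTe : ∀ u, (genericPt X).ev _ (T u) = (genericPt X).ev (L i) u * N := by
      intro u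
      rw [hT, ← Finset.mul_prod_erase _ _ (Finset.mem_univ ⟨i, hi⟩), Function.update_self]
      have : ∏ j ∈ Finset.univ.erase (⟨i, hi⟩ : J), (genericPt X).ev (L j)
          (Function.update (fun j : J => e j (m j)) ⟨i, hi⟩ u j).1 =
          ∏ j ∈ Finset.univ.erase (⟨i, hi⟩ : J), v j (m j) :=
        Finset.prod_congr rfl fun j hj => by
          rw [Function.update_of_ne (Finset.ne_of_mem_erase hj)]
      rw [this]
      ring
    have h2 := div_mem (hy _ (hTm (e i j))) (hy _ (hTm (e i j')))
    rw [div_div_div_cancel_right₀ hm', hTe, hTe, mul_div_mul_right _ _ hN] at h2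
    exact h2

end Generic

end LinSeries

/-! ### Systems with prescribed equations in J, and the theorem. -/

namespace LinSeries

open TrRank

lemma comp_affine_mem_polyFun {V W : Type} [AddCommGroup V] [Module ℂ V] [AddCommGroup W]
    [Module ℂ W] {f : V → ℂ} (hf : f ∈ polyFun V) (A : W →ₗ[ℂ] V) (c : V) :
    (fun w => f (A w + c)) ∈ polyFun W := by
  refine Algebra.adjoin_induction (p := fun f _ => (fun w => f (A w + c)) ∈ polyFun W)
    ?_ ?_ ?_ ?_ hf
  · rintro _ ⟨φ, rfl⟩
    have : (fun w => φ (A w + c)) =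
        (fun w => (φ.comp A) w) + algebraMap ℂ (W → ℂ) (φ c) := by
      ext w
      exact map_add φ _ _
    rw [this]
    exact add_mem (Algebra.subset_adjoin ⟨φ.comp A, rfl⟩) (Subalgebra.algebraMap_mem _ _)
  · intro r
    exact Subalgebra.algebraMap_mem (polyFun W) r
  · intro f g _ _ hf hg
    exact add_mem hf hg
  · intro f g _ _ hf hg
    exact mul_mem hf hg

variable {X : Scheme.{0}} [X.Over (Spec (.of ℂ))] {κ : Type} {L : κ → LineBundle X}
  {E : ∀ i, Submodule ℂ (L i).Sec}

/-- Near a given system, the systems with prescribed equations indexed by `J` are parametrized by the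
restrictions of their other equations. -/
lemma exists_affine_section (J : Finset κ) (F : Set (Pt X)) (t : ∀ i, E i) :
    ∃ (A : (∀ i : {i // i ∉ J}, Restr (E i) F) →ₗ[ℂ] ∀ i, E i) (c : ∀ i, E i),
      A (restrCompl J F t) + c = t ∧ (∀ u, restrCompl J F (A u + c) = u) ∧
      ∀ u, ∀ i ∈ J, (A u + c) i = t i := by
  classical
  choose r hr using fun i : κ => (vanishingOn (E i) F).mkQ.exists_rightInverse_of_surjective
    (Submodule.range_mkQ _)
  let A : (∀ i : {i // i ∉ J}, Restr (E i) F) →ₗ[ℂ] ∀ i, E i := LinearMap.pi fun i =>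
    if h : i ∈ J then 0 else (r i).comp (LinearMap.proj (⟨i, h⟩ : {i // i ∉ J}))
  have hA : ∀ u i (h : i ∉ J), A u i = r i (u ⟨i, h⟩) := fun u i h => by simp [A, h]
  have hA' : ∀ u i, i ∈ J → A u i = 0 := fun u i h => by simp [A, h]
  refine ⟨A, t - A (restrCompl J F t), add_sub_cancel _ _, fun u => ?_, fun u i hi => ?_⟩
  · ext i
    have hr' : ∀ w, (vanishingOn (E i) F).mkQ (r i w) = w := LinearMap.congr_fun (hr i)
    change (vanishingOn (E i) F).mkQ (A u i + (t i - A (restrCompl J F t) i)) = u i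
    rw [hA _ _ i.2, hA _ _ i.2, map_add, map_sub, hr', hr']
    change u i + (restrCompl J F t i - restrCompl J F t i) = u i
    rw [sub_self, add_zero]
  · change A u i + (t i - A (restrCompl J F t) i) = t i
    rw [hA' _ _ hi, hA' _ _ hi, sub_zero, zero_add]

variable [LocallyOfFiniteType (X ↘ Spec (.of ℂ))] {n : κ → Type} [∀ i, Fintype (n i)]
  (e : ∀ i, Module.Basis (n i) ℂ (E i))

lemma ev_eq_sum {i : κ} (x : Pt X) (s : E i) : (closedPt x).ev (L i) s =
    ∑ j, (e i).repr s j * (closedPt x).ev (L i) (e i j) := by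
  conv_lhs => rw [← (e i).sum_repr s]
  simp [-Module.Basis.sum_repr]

lemma vanishes_of_mem_fibre (hbpf : ∀ i, BasePointFree (E i)) {J : Finset κ} {x a : Pt X}
    (hx : x ∈ fibre E J a) {i : κ} (hi : i ∈ J) {s : E i} (hs : Vanishes s a) : Vanishes s x := by
  have e := fun i => Module.Basis.ofVectorSpace ℂ (E i)
  have h := (mem_fibre_iff hbpf e J).1 hx i hi
  obtain ⟨l, hl⟩ := exists_basis_ev_ne_zero (hbpf i) (e i) a
  have h1 : (closedPt a).ev (L i) (e i l) • ((closedPt x).ev (L i)).comp (E i).subtype =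
      (closedPt x).ev (L i) (e i l) • ((closedPt a).ev (L i)).comp (E i).subtype := by
    refine (e i).ext fun j => ?_
    simp only [LinearMap.smul_apply, LinearMap.comp_apply, Submodule.subtype_apply, smul_eq_mul]
    rw [mul_comm, h j l]
  have h2 := LinearMap.congr_fun h1 s
  simp only [LinearMap.smul_apply, LinearMap.comp_apply, Submodule.subtype_apply, smul_eq_mul,
    mem_kodaira_iff.1 hs, mul_zero] at h2
  exact mem_kodaira_iff.2 ((mul_eq_zero.1 h2).resolve_left hl)

/-- The equations in `J` that hold at `a` hold on the whole fibre through `a`, so inside the fibre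
only the remaining equations impose conditions. -/
lemma zeroSet_eq_restrZeroSet (hbpf : ∀ i, BasePointFree (E i)) {J : Finset κ} {a : Pt X}
    {s : ∀ i, E i} (ha : ∀ i ∈ J, Vanishes (s i) a) (hs : zeroSet s ⊆ fibre E J a) :
    zeroSet s = restrZeroSet (restrCompl J (fibre E J a) s) := by
  ext x
  constructor
  · exact fun hx => ⟨hs hx, fun i => (restrVanishes_restr _ _).2 (hx i)⟩
  · rintro ⟨hx, hxs⟩ i
    by_cases hi : i ∈ J
    · exact vanishes_of_mem_fibre hbpf hx hi (ha i hi)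
    · exact (restrVanishes_restr _ _).1 (hxs ⟨i, hi⟩)

end LinSeries

theorem mainTheorem2 (X : Scheme.{0}) [X.Over (Spec (.of ℂ))] [IsIntegral X]
    [IsSeparated (X ↘ Spec (.of ℂ))] [LocallyOfFiniteType (X ↘ Spec (.of ℂ))]
    [QuasiCompact (X ↘ Spec (.of ℂ))]
    (k : ℕ) (L : Fin k → LineBundle X) (E : ∀ i, Submodule ℂ (L i).Sec)
    (hfin : ∀ i, FiniteDimensional ℂ (E i)) (hbpf : ∀ i, BasePointFree (E i))
    (hover : IsOverdetermined E) (J : Finset (Fin k)) (hJ : IsEssential E J) :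
    ∃ W : Set (∀ i, E i),
      (∃ O : Set (∀ i, E i), @IsOpen _ (zariski (∀ i, E i)) O ∧ W = consistencyVariety E ∩ O) ∧
      W.Nonempty ∧
      ∀ s ∈ W, (zeroSet s).Nonempty ∧ ∃ a : Pt X,
        zeroSet s = restrZeroSet (restrCompl J (fibre E J a) s) ∧
        IsGenericallyConsistentOn (fun i : {i // i ∉ J} => E i) (fibre E J a) ∧
        @IsOpen _ (zariski (∀ i : {i // i ∉ J}, Restr (E i) (fibre E J a)))
          {u | ∃ t ∈ W, (∀ j ∈ J, t j = s j) ∧ restrCompl J (fibre E J a) t = u ∧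
            zeroSet t = restrZeroSet u} := by
  let e := fun i => Module.finBasis ℂ (E i)
  obtain ⟨C, hv, hpt, hback⟩ := exists_chartSystem L E hbpf e
  have htau : ∀ I : Finset (Fin k),
      defect E I = (TrRank.rk ℂ (TrRank.ratios C.v I) : ℤ) - I.card := by
    intro I
    rw [defect, tau_seriesJ hbpf e, ← funext₂ hv]
  obtain ⟨p, g, hgp, hp, hgen, hprod⟩ := C.exists_generic (J := J)
    (fun I => by
      have := hJ.1 I
      rw [htau, htau] at this
      omega)
    (fun I hI => by
      have := hJ.2 I hI
      rw [htau, htau] at this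
      omega)
  let b := Pi.basis e
  have hb : ∀ (s : ∀ i, E i) i j, b.repr s ⟨i, j⟩ = (e i).repr (s i) j :=
    fun s i j => Pi.basis_repr e s ⟨i, j⟩
  have hzero : ∀ {β : C.β} (h : C.A β →ₐ[ℂ] ℂ) (x : Pt X),
      (∀ i, ∃ l : ℂ, l ≠ 0 ∧ ∀ j, h (C.σ β i j) = l * (closedPt x).ev (L i) (e i j)) →
      ∀ (s : ∀ i, E i) (I : Finset (Fin k)),
        C.IsZero (b.repr s) h I ↔ ∀ i ∈ I, Vanishes (s i) x := by
    intro β h x hx s I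
    refine forall₂_congr fun i _ => ?_
    obtain ⟨l, hl, hx⟩ := hx i
    rw [Vanishes, mem_kodaira_iff, ev_eq_sum e]
    simp_rw [hx, hb, mul_left_comm _ l]
    rw [← Finset.mul_sum, mul_eq_zero, or_iff_right hl]
  -- In coordinates, `p` is the ideal of the consistency variety, since closed points of `X` and
  -- points of charts give the same zeros.
  have hR : ∀ s, s ∈ consistencyVariety E ↔ ∀ f ∈ p, MvPolynomial.eval (b.repr s) f = 0 := by
    intro s
    rw [consistencyVariety, mem_closure_zariski_iff]
    constructor
    · intro hs f hf
      refine hs (fun t => MvPolynomial.eval (b.repr t) f) ((mem_polyFun b).2 ⟨f, fun _ => rfl⟩) ?_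
      rintro t ⟨x, hx⟩
      obtain ⟨β, h, hh⟩ := hpt x
      exact (hp f).1 hf _ β h ((hzero h x hh t _).2 fun i _ => hx i)
    · intro hs f hf hvan
      obtain ⟨P, hP⟩ := (mem_polyFun b).1 hf
      rw [hP]
      refine hs P ((hp P).2 fun w β h hw => ?_)
      obtain ⟨x, hx⟩ := hback β h
      have hw' : w = b.repr (b.equivFun.symm w) := (b.equivFun.apply_symm_apply w).symm
      rw [hw', ← hP]
      rw [hw'] at hw
      exact hvan _ ⟨x, fun i => (hzero h x hx _ _).1 hw i (Finset.mem_univ i)⟩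
  have hgpoly : (fun s => MvPolynomial.eval (b.repr s) g) ∈ polyFun (∀ i, E i) :=
    (mem_polyFun b).2 ⟨g, fun _ => rfl⟩
  refine ⟨consistencyVariety E ∩ {s | MvPolynomial.eval (b.repr s) g ≠ 0},
    ⟨_, isOpen_zariski_iff.2 fun s hs => ⟨_, hgpoly, hs, fun w hw => hw⟩, rfl⟩, ?_, ?_⟩
  -- As `g ∉ p`, some consistent system has `g ≠ 0`.
  · by_contra hne
    refine hgp ((hp g).2 fun w β h hw => ?_)
    by_contra hg
    obtain ⟨x, hx⟩ := hback β h
    have hw' : w = b.repr (b.equivFun.symm w) := (b.equivFun.apply_symm_apply w).symm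
    rw [hw'] at hw hg
    refine hne ⟨_, ?_, hg⟩
    exact @subset_closure _ (zariski _) _ _
      ⟨x, fun i => (hzero h x hx _ _).1 hw i (Finset.mem_univ i)⟩
  -- Only the equations in `J` decide which fibre contains the zeros, so one fibre serves all
  -- systems that share them with `s`.
  have hcons : ∀ s : ∀ i, E i, s ∈ consistencyVariety E → MvPolynomial.eval (b.repr s) g ≠ 0 →
      ∃ a : Pt X, a ∈ zeroSet s ∧ ∀ t : ∀ i, E i, (∀ j ∈ J, t j = s j) →
        zeroSet t ⊆ fibre E J a := by
    intro s hs hsg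
    obtain ⟨β, h, hz, hsame⟩ := hgen _ ((hR s).1 hs) hsg
    obtain ⟨a, ha⟩ := hback β h
    refine ⟨a, fun i => (hzero h a ha _ _).1 hz i (Finset.mem_univ i), fun t ht x hx => ?_⟩
    obtain ⟨β', h', hh'⟩ := hpt x
    have hz' : C.IsZero (b.repr s) h' J :=
      (hzero h' x hh' s J).2 fun i hi => ht i hi ▸ hx i
    rw [mem_fibre_iff hbpf e]
    intro i hi j l
    obtain ⟨c, hc, hc'⟩ := ha i
    obtain ⟨d, hd, hd'⟩ := hh' i
    have := hsame β' h' hz' i hi j l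
    rw [hc', hc', hd', hd'] at this
    refine mul_left_cancel₀ (mul_ne_zero hc hd) ?_
    linear_combination -this
  rintro s ⟨hs, hsg⟩
  obtain ⟨a, has, hfib⟩ := hcons s hs hsg
  have heq : ∀ t : ∀ i, E i, (∀ j ∈ J, t j = s j) →
      zeroSet t = restrZeroSet (restrCompl J (fibre E J a) t) := fun t ht =>
    zeroSet_eq_restrZeroSet hbpf (fun i hi => (ht i hi).symm ▸ has i) (hfib t ht)
  have hopen : @IsOpen _ (zariski (∀ i : {i // i ∉ J}, Restr (E i) (fibre E J a)))
      {u | ∃ t ∈ consistencyVariety E ∩ {s | MvPolynomial.eval (b.repr s) g ≠ 0},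
        (∀ j ∈ J, t j = s j) ∧ restrCompl J (fibre E J a) t = u ∧
          zeroSet t = restrZeroSet u} := by
    rw [isOpen_zariski_iff]
    rintro u ⟨t, ⟨ht, htg⟩, hts, rfl, -⟩
    -- Along this affine family the equations in `J` are fixed, so by the product structure it stays
    -- in the consistency variety. The only condition left is `g ≠ 0`, which is open in the
    -- restricted equations.
    obtain ⟨A, c, hAt, hA, hAJ⟩ := exists_affine_section J (fibre E J a) t
    refine ⟨_, comp_affine_mem_polyFun hgpoly A c, ?_, fun w hw => ?_⟩
    · rw [hAt]
      exact htg
    · have hws : ∀ j ∈ J, (A w + c) j = s j := fun j hj => (hAJ w j hj).trans (hts j hj)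
      refine ⟨A w + c, ⟨(hR _).2 (hprod _ _ ((hR s).1 hs) fun i hi j => ?_), hw⟩, hws, hA w, ?_⟩
      · rw [hb, hb, hws i hi]
      · rw [heq _ hws, hA]
  refine ⟨⟨a, has⟩, a, heq s fun _ _ => rfl, ⟨_, hopen, ?_, ?_⟩, hopen⟩
  · exact ⟨_, s, ⟨hs, hsg⟩, fun _ _ => rfl, rfl, heq s fun _ _ => rfl⟩
  · rintro u ⟨t, ⟨ht, htg⟩, -, -, htu⟩
    obtain ⟨a', ha', -⟩ := hcons t ht htg
    exact ⟨a', htu ▸ ha'⟩
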